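/- Let $g(x)=-\frac1{2\pi}\ln|x|$ on $\mathbb R^2$ and let $\Delta$ be the diagonal of $(\mathbb R^2)^2$. A *density* is a real-valued function in $L^1\cap L^\infty(\mathbb R^2)$ with compact support. For $M\ge 0$ let $B(M)\ge 0$ be the least non-negative number such that $$\int_{(\mathbb R^2)^2\setminus\Delta} g(x-y)\Big(\mu-\frac1N\sum_{i=1}^N\delta_{x_i}\Big)^{\otimes 2}(dx\,dy)+\frac{B(M)}{N}+\frac{\ln N}{2N}\ \ge 0$$ for all $N\ge1$, all pairwise distinct $x_1,\dots,x_N\in\mathbb R^2$ and all densities $\mu$ with $\int\mu=1$ and $\|\mu\|_{L^\infty}=M$. For densities $\omega,\rho,\omega_N$, a field $v\in W^{2,\infty}(\mathbb R^2,\mathbb R^2)$ (identified with its continuous representative), $Q_N=(q_1,\dots,q_N)$ with pairwise distinct $q_i\in\mathbb R^2$, and $P_N=(p_1,\dots,p_N)\in(\mathbb R^2)^N$, put $\rho_N=\frac1N\sum_{i=1}^N\delta_{q_i}$ and $$\mathcal H_N=\mathcal H(\omega,\rho,v,\omega_N,Q_N,P_N)=\frac1N\sum_{i=1}^N|v(q_i)-p_i|^2+\int_{(\mathbb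 R^2)^2\setminus\Delta} g(x-y)(\rho+\omega-\rho_N-\omega_N)^{\otimes2}(dx\,dy)+\|\omega-\omega_N\|_{L^2}^2+\frac{B(\|\rho+\omega-\omega_N\|_{L^\infty})}{N}+\frac{\ln N}{2N}.$$ For a finite signed measure $\sigma$ on $\mathbb R^d$ and $s\in\mathbb R$, $\|\sigma\|_{H^s}=\big(\int(1+|\zeta|^2)^s|\widehat\sigma(\zeta)|^2d\zeta\big)^{1/2}$, where $\widehat\sigma(\zeta)=\int e^{-i x\cdot\zeta}\sigma(dx)$. The measure $\rho\otimes\delta_{\xi=v(x)}$ on $\mathbb R^2\times\mathbb R^2$ is the image of $\rho(x)\,dx$ under $x\mapsto(x,v(x))$, and $\|\nabla v\|_{W^{1,\infty}}=\|\nabla v\|_{L^\infty}+\|\nabla^2v\|_{L^\infty}$. **Proposition.** There is $\beta>0$ such that for every $M$ there is $C>0$ with the following property. For all $N\ge1$, all densities $\omega,\rho,\omega_N$ with $\int(\rho+\omega-\omega_N)=1$, $\|\omega\|_{L^\infty}\le M$ and $\|\omega_N\|_{L^\infty}\le M$, all $v\in W^{2,\infty}(\mathbb R^2,\mathbb R^2)$,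 all $Q_N\in(\mathbb R^2)^N$ with pairwise distinct entries and all $P_N\in(\mathbb R^2)^N$, $$\Big\|\frac1N\sum_{i=1}^N\delta_{(q_i,p_i)}-\rho\otimes\delta_{\xi=v(x)}\Big\|_{H^{-5}}\le C\big(1+\|\nabla v\|_{W^{1,\infty}}^2\big)\Big(\mathcal H_N+(1+\|\rho\|_{L^\infty})N^{-\beta}\Big)^{1/2}.$$ Moreover, fix densities $\omega,\rho$ and $v\in W^{2,\infty}(\mathbb R^2,\mathbb R^2)$, and for each $N\ge 1$ let $\omega_N$ be a density with $\int(\rho+\omega-\omega_N)=1$, let $Q_N\in(\mathbb R^2)^N$ have pairwise distinct entries and let $P_N\in(\mathbb R^2)^N$ (the entries of $Q_N$, $P_N$ may depend on $N$). If $\sup_{N\ge1}\|\omega_N\|_{L^\infty}<\infty$ and $\mathcal H(\omega,\rho,v,\omega_N,Q_N,P_N)\to0$ as $N\to\infty$, then $\omega_N\to\omega$ in $L^2$, $\rho_N\to\rho$ in $H^a$ for every $a<-1$, and $\frac1N\sum_{i=1}^N\delta_{(q_i,p_i)}\to\rho\otimes\delta_{\xi=v(x)}$ in $H^{-5}$.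 -/

import Mathlib

open MeasureTheory Filter Topology
open scoped ENNReal

noncomputable section

namespace Spray

/-- The Euclidean plane `ℝ²`. -/
abbrev Plane := EuclideanSpace ℝ (Fin 2)

/-- The phase space `ℝ² × ℝ²` of pairs (position, velocity), with the Euclidean structure of `ℝ⁴`. -/
abbrev Phase := WithLp 2 (Plane × Plane)

/-! ### Measures, Coulomb energy and Sobolev norms -/

/-- The kernel `g(x) = -(1 / 2π) ln |x|` on the plane. -/
def coulomb (x : Plane) : ℝ := -(1 / (2 * Real.pi)) * Real.log ‖x‖

/-- The empirical measure `(1 / N) ∑ᵢ δ_{xᵢ}`, as a signed measure. -/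
def empirical {E : Type*} [MeasurableSpace E] {N : ℕ} (x : Fin N → E) : SignedMeasure E :=
  (1 / (N : ℝ)) • ∑ i, VectorMeasure.dirac (x i) (1 : ℝ)

/-- The signed measure `f(x) dx` on the plane, for an integrable function `f`. -/
def density (f : Plane → ℝ) : SignedMeasure Plane := volume.withDensityᵥ f

/-- The monokinetic measure `ρ ⊗ δ_{ξ = v(x)}` on the phase space: the image of `ρ(x) dx` under
`x ↦ (x, v(x))`. -/
def monokinetic (ρ : Plane → ℝ) (v : Plane → Plane) : SignedMeasure Phase :=
  (density ρ).map (fun x => WithLp.toLp 2 (x, v x))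

/-- `∬_{(ℝ² × ℝ²) ∖ Δ} g(x - y) σ(dx) σ(dy)`, where `Δ` is the diagonal. -/
def offDiagEnergy (σ : SignedMeasure Plane) : ℝ :=
  ∫ᵛ z in (Set.diagonal Plane)ᶜ, coulomb (z.1 - z.2)
    ∂<•(σ.prod σ (ContinuousLinearMap.mul ℝ ℝ))

/-- The Fourier transform `ζ ↦ ∫ exp(-i ⟨x, ζ⟩) σ(dx)` of a signed measure. -/
def fourierMeasure {E : Type*} [NormedAddCommGroup E] [InnerProductSpace ℝ E] [MeasurableSpace E]
    (σ : SignedMeasure E) (ζ : E) : ℂ :=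
  ∫ᵛ x, Complex.exp (-((inner ℝ x ζ : ℝ) : ℂ) * Complex.I) ∂<•σ

/-- The norm `‖σ‖_{H^s} = (∫ (1 + |ζ|²)^s |σ̂(ζ)|² dζ)^{1/2}` (possibly infinite) of a signed
measure. -/
def sobolevNorm {E : Type*} [NormedAddCommGroup E] [InnerProductSpace ℝ E] [FiniteDimensional ℝ E]
    [MeasurableSpace E] [BorelSpace E] (s : ℝ) (σ : SignedMeasure E) : ℝ≥0∞ :=
  (∫⁻ ζ : E, ENNReal.ofReal ((1 + ‖ζ‖ ^ 2) ^ s) * ‖fourierMeasure σ ζ‖ₑ ^ 2) ^ (1 / 2 : ℝ)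

/-! ### Function spaces -/

/-- The `L^∞` norm (essential supremum), as a real number; meaningful for `MemLp f ∞`. -/
def normLinf {F : Type*} [NormedAddCommGroup F] (f : Plane → F) : ℝ :=
  (eLpNorm f ∞ volume).toReal

/-- `f ∈ L¹ ∩ L^∞` with compact support. -/
structure IsDensity (f : Plane → ℝ) : Prop where
  memLp_one : MemLp f 1 volume
  memLp_top : MemLp f ∞ volume
  compact : HasCompactSupport f

/-- `u'` is the weak (distributional) derivative of `u` on the plane. -/
def HasWeakFDeriv {F : Type*} [NormedAddCommGroup F] [NormedSpace ℝ F]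
    (u : Plane → F) (u' : Plane → Plane →L[ℝ] F) : Prop :=
  LocallyIntegrable u volume ∧ LocallyIntegrable u' volume ∧
    ∀ φ : Plane → ℝ, ContDiff ℝ (⊤ : ℕ∞) φ → HasCompactSupport φ → ∀ e : Plane,
      ∫ x, (fderiv ℝ φ x e) • u x = -∫ x, φ x • u' x e

/-- `v ∈ W^{2,∞}(ℝ², ℝ²)`, with first and second weak derivatives `Dv` and `D2v`. The field `v` is
its continuous representative, since it is evaluated at points. -/
structure IsW2Inf (v : Plane → Plane) (Dv : Plane → Plane →L[ℝ] Plane)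
    (D2v : Plane → Plane →L[ℝ] Plane →L[ℝ] Plane) : Prop where
  cont : Continuous v
  memLp : MemLp v ∞ volume
  memLp_deriv : MemLp Dv ∞ volume
  memLp_deriv2 : MemLp D2v ∞ volume
  weak_deriv : HasWeakFDeriv v Dv
  weak_deriv2 : HasWeakFDeriv Dv D2v

/-- `‖∇v‖_{W^{1,∞}}`, in terms of the first and second weak derivatives of `v`. -/
def gradNorm (Dv : Plane → Plane →L[ℝ] Plane)
    (D2v : Plane → Plane →L[ℝ] Plane →L[ℝ] Plane) : ℝ :=
  normLinf Dv + normLinf D2v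

/-! ### The modulated energies -/

/-- The numbers `b ≥ 0` such that
`∬_{Δᶜ} g(x - y) (μ - μ_N)^{⊗2}(dx dy) + b / N + ln N / (2N) ≥ 0`
for all `N ≥ 1`, all empirical measures `μ_N` of `N` distinct points and all `μ ∈ L¹ ∩ L^∞` with
compact support, integral `1` and `‖μ‖_{L^∞} = M`. -/
def correctionSet (M : ℝ) : Set ℝ :=
  {b | 0 ≤ b ∧ ∀ (N : ℕ) (X : Fin N → Plane) (μ : Plane → ℝ), 1 ≤ N → Function.Injective X →
    IsDensity μ → ∫ x, μ x = 1 → normLinf μ = M →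
      0 ≤ offDiagEnergy (density μ - empirical X) + b / N + Real.log N / (2 * N)}

/-- The least admissible correction constant; it depends only on the value `M` of the `L^∞` norm. -/
def correction (M : ℝ) : ℝ := sInf (correctionSet M)

/-- The modulated energy `𝓗(ω, ρ, v, ω_N, Q_N, P_N)`. -/
def modulatedEnergy (ω ρ : Plane → ℝ) (v : Plane → Plane) (ωN : Plane → ℝ) {N : ℕ}
    (Q P : Fin N → Plane) : ℝ :=
  1 / (N : ℝ) * ∑ i, ‖v (Q i) - P i‖ ^ 2
    + offDiagEnergy (density (fun x => ρ x + ω x - ωN x) - empirical Q)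
    + (eLpNorm (fun x => ω x - ωN x) 2 volume).toReal ^ 2
    + correction (normLinf (fun x => ρ x + ω x - ωN x)) / N
    + Real.log N / (2 * N)

end Spray

end

open MeasureTheory Filter Topology
open scoped ENNReal

noncomputable section

namespace Spray


/-! ### The Fourier transform on `L¹ ∩ L²` -/

section Fourier

variable {E : Type*} [NormedAddCommGroup E] [InnerProductSpace ℝ E] [MeasurableSpace E]

/-! Write f = ρ + ω - ω_N, which has integral 1, and μ_N for the empirical measure of the positions.
The heart of the proof is a coercivity estimate (`lintegral_rft_smeared_le`): up to O((1 + ‖f‖_∞)/N)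
and the term ln N / 2N, the off-diagonal Coulomb energy of f - μ_N controls the squared homogeneous
H⁻¹ norm of f - μ_N * η_N, where η_N is the Gaussian density of width N^(-1/2).

Coercivity comes from Frullani's formula -ln r = ∫₀^∞ t⁻¹ (exp(-tr) - exp(-t)) dt with r = |x - y|².
It makes the energy a superposition in t of Gaussian energies, from which the diagonal contribution
1/N, damped by 1 - exp(-t), has been removed (`offDiagEnergy_eq_integral`). Each full Gaussian
energy is a weighted L² norm of a Fourier transform, hence nonnegative. For t ≤ N it is kept, and
the missing diagonal costs (1 + ln N)/N in total. For t > N only the self-energy of f is kept: the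
diagonal terms of the points compensate the removed diagonal, and the cross terms are O(‖f‖_∞ / t),
hence O(‖f‖_∞ / N) after integration. Integrating in t leaves the weights θ/|ζ|² on |f̂ - μ̂_N|² and
(1 - θ)/|ζ|² on |f̂|², with θ = exp(-|ζ|²/4N) the transform of η_N. Convexity of the square bounds
the sum below by |f̂ - θ μ̂_N|²/|ζ|². In particular the correction constant is well defined, and
every summand of the modulated energy other than the Coulomb energy is nonnegative, while the
correction terms compensate the negative part of the Coulomb energy.

The Fourier transform of the phase-space defect splits into four pieces
(`fourierMeasure_monokinetic_defect_eq`): replacing p_i by v(q_i), controlled by the kinetic term;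
replacing δ_{q_i} by η_N(· - q_i), an error O(N^(-1/2)) on Lipschitz functions; the smeared
difference multiplied by x ↦ exp(-i v(x)·ζ₂); and ω - ω_N multiplied by the same phase, controlled
by Plancherel. The third piece uses that multiplication by a bounded Lipschitz function maps
homogeneous H⁻¹ into H⁻² (`lintegral_bessel_mul_ft_mul_le`), which is proved by duality. The weight
of order -5 pays for all growth in frequency: four powers of (1 + |ζ|²) give integrability in the
two variables, and the fifth absorbs the quadratic growth of the constants.

Since squared errors are O(1/N), the exponent β = 1 works. Convergence of the phase-space measures
follows from the quantitative bound, that of ω_N from the nonnegativity of the remaining energy, and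
that of ρ_N from coercivity and dominated convergence in the smearing. -/

/-- The character `x ↦ exp (-i ⟨x, ζ⟩)`. -/
def chr (x ζ : E) : ℂ := Complex.exp (-((inner ℝ x ζ : ℝ) : ℂ) * Complex.I)

/-- The Fourier transform `ζ ↦ ∫ exp (-i ⟨x, ζ⟩) f(x) dx`. -/
def ft [BorelSpace E] [FiniteDimensional ℝ E] (f : E → ℂ) (ζ : E) : ℂ := ∫ x, chr x ζ * f x

omit [MeasurableSpace E] in
@[simp] lemma norm_chr (x ζ : E) : ‖chr x ζ‖ = 1 := by
  rw [chr, ← Complex.ofReal_neg, Complex.norm_exp_ofReal_mul_I]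

omit [MeasurableSpace E] in
@[simp] lemma enorm_chr (x ζ : E) : ‖chr x ζ‖ₑ = 1 := by
  rw [← ofReal_norm, norm_chr, ENNReal.ofReal_one]

omit [MeasurableSpace E] in
lemma chr_add_left (x y ζ : E) : chr (x + y) ζ = chr x ζ * chr y ζ := by
  simp only [chr, ← Complex.exp_add, inner_add_left]
  congr 1; push_cast; ring

omit [MeasurableSpace E] in
lemma chr_neg_left (x ζ : E) : chr (-x) ζ = (starRingEnd ℂ) (chr x ζ) := by
  simp only [chr, ← Complex.exp_conj, inner_neg_left]
  congr 1; simp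

omit [MeasurableSpace E] in
lemma chr_comm (x ζ : E) : chr x ζ = chr ζ x := by
  simp only [chr, real_inner_comm]

omit [MeasurableSpace E] in
lemma continuous_chr : Continuous (fun p : E × E => chr p.1 p.2) := by
  unfold chr; fun_prop

omit [MeasurableSpace E] in
@[fun_prop] lemma Continuous.chr {X : Type*} [TopologicalSpace X] {a b : X → E} (ha : Continuous a)
    (hb : Continuous b) : Continuous (fun x => Spray.chr (a x) (b x)) :=
  continuous_chr.comp (ha.prodMk hb)

variable [BorelSpace E] [FiniteDimensional ℝ E]

open FourierTransform in
lemma ft_eq_fourier (f : E → ℂ) (ζ : E) : ft f ζ = 𝓕 f ((2 * Real.pi)⁻¹ • ζ) := by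
  rw [Real.fourier_eq', ft]
  congr 1; ext x
  rw [chr, smul_eq_mul, inner_smul_right]
  have hpi : (Real.pi : ℝ) ≠ 0 := Real.pi_ne_zero
  have : -2 * Real.pi * ((2 * Real.pi)⁻¹ * inner ℝ x ζ) = -inner ℝ x ζ := by field_simp
  rw [this, Complex.ofReal_neg]

lemma integrable_chr_mul {f : E → ℂ} (hf : Integrable f) (ζ : E) :
    Integrable (fun x => chr x ζ * f x) :=
  hf.bdd_mul (c := 1) (by fun_prop) (by simp)

lemma continuous_ft {f : E → ℂ} (hf : Integrable f) : Continuous (ft f) := by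
  unfold ft
  refine continuous_of_dominated (bound := fun x => ‖f x‖)
    (fun ζ => (integrable_chr_mul hf ζ).aestronglyMeasurable) ?_ hf.norm ?_
  · intro ζ; exact Eventually.of_forall fun x => by simp
  · exact Eventually.of_forall fun x => by fun_prop

lemma norm_ft_le (f : E → ℂ) (ζ : E) : ‖ft f ζ‖ ≤ ∫ x, ‖f x‖ := by
  refine (norm_integral_le_integral_norm _).trans (le_of_eq ?_)
  simp

lemma ft_comp_add_right (f : E → ℂ) (h ζ : E) :
    ft (fun x => f (x + h)) ζ = chr (-h) ζ * ft f ζ := by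
  unfold ft
  rw [← integral_const_mul, ← integral_add_right_eq_self (fun x => chr (-h) ζ * (chr x ζ * f x)) h]
  congr 1; ext x
  rw [← mul_assoc, ← chr_add_left]; simp

lemma ft_sub {f g : E → ℂ} (hf : Integrable f) (hg : Integrable g) (ζ : E) :
    ft (fun x => f x - g x) ζ = ft f ζ - ft g ζ := by
  unfold ft
  rw [← integral_sub (integrable_chr_mul hf ζ) (integrable_chr_mul hg ζ)]
  congr 1; ext x; ring

-- Links the abstract L² transform to the integral. Both are tested against smooth compactly
-- supported functions: the L² transform agrees with the distributional one, and the integral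
-- transform can be moved onto the test function by Fubini.
open FourierTransform SchwartzMap in
lemma fourier_toLp_ae_eq {f : E → ℂ} (h1 : Integrable f) (h2 : MemLp f 2 volume) :
    (𝓕 (h2.toLp f) : Lp ℂ 2 (volume : Measure E)) =ᵐ[volume] 𝓕 f := by
  have hc : Continuous (𝓕 f) :=
    VectorFourier.fourierIntegral_continuous Real.continuous_fourierChar continuous_inner h1
  refine ae_eq_of_integral_contDiff_smul_eq ?_ hc.locallyIntegrable ?_
  · exact (Lp.memLp _).locallyIntegrable (by norm_num)
  intro g hg hg'
  have hgc : HasCompactSupport (fun x => (g x : ℂ)) := hg'.comp_left (g := ((↑) : ℝ → ℂ)) (by simp)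
  let G : 𝓢(E, ℂ) := hgc.toSchwartzMap (Complex.ofRealCLM.contDiff.comp hg)
  have key := DFunLike.congr_fun (Lp.fourier_toTemperedDistribution_eq (h2.toLp f)) G
  rw [TemperedDistribution.fourier_apply, Lp.toTemperedDistribution_apply,
    Lp.toTemperedDistribution_apply] at key
  have e1 : ∫ x, g x • (𝓕 (h2.toLp f) : Lp ℂ 2 (volume : Measure E)) x
      = ∫ x, G x • (𝓕 (h2.toLp f) : Lp ℂ 2 (volume : Measure E)) x := by
    congr 1
  have e2 : ∫ x, g x • 𝓕 f x = ∫ x, G x • 𝓕 f x := by congr 1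
  rw [e1, e2, ← key]
  have := VectorFourier.integral_fourierIntegral_smul_eq_flip (L := innerₗ E) (μ := volume)
    (ν := volume) Real.continuous_fourierChar continuous_inner G.integrable h1
  rw [flip_innerₗ] at this
  refine Eq.trans ?_ this
  refine integral_congr_ae ?_
  filter_upwards [h2.coeFn_toLp] with x hx
  rw [hx]; rfl

lemma lintegral_comp_inv_smul {g : E → ℝ≥0∞} (hg : Measurable g) {c : ℝ} (hc : 0 < c) :
    ∫⁻ x, g (c⁻¹ • x) = ENNReal.ofReal (c ^ Module.finrank ℝ E) * ∫⁻ x, g x := by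
  rw [← lintegral_map hg (measurable_const_smul _), Measure.map_addHaar_smul _ (inv_ne_zero hc.ne'),
    lintegral_smul_measure, smul_eq_mul]
  congr 2
  rw [inv_pow, inv_inv, abs_of_pos (by positivity)]

/-- The normalization constant in Plancherel's theorem. -/
def plancherelConst (E : Type*) [NormedAddCommGroup E] [InnerProductSpace ℝ E] : ℝ≥0∞ :=
  ENNReal.ofReal ((2 * Real.pi) ^ Module.finrank ℝ E)

omit [MeasurableSpace E] [BorelSpace E] [FiniteDimensional ℝ E] in
lemma plancherelConst_ne_zero : plancherelConst E ≠ 0 := by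
  have := Real.pi_pos
  simp only [plancherelConst, ne_eq, ENNReal.ofReal_eq_zero, not_le]; positivity

omit [MeasurableSpace E] [BorelSpace E] [FiniteDimensional ℝ E] in
lemma plancherelConst_ne_top : plancherelConst E ≠ ∞ := ENNReal.ofReal_ne_top

lemma eLpNorm_two_sq {X : Type*} [MeasurableSpace X] {ν : Measure X} {F : Type*}
    [NormedAddCommGroup F] (f : X → F) :
    eLpNorm f 2 ν ^ 2 = ∫⁻ x, ‖f x‖ₑ ^ 2 ∂ν := by
  rw [eLpNorm_eq_lintegral_rpow_enorm_toReal (by norm_num) (by norm_num)]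
  simp only [ENNReal.toReal_ofNat]
  rw [← ENNReal.rpow_natCast, ← ENNReal.rpow_mul]
  norm_num

open FourierTransform in
/-- Plancherel's theorem on `L¹ ∩ L²`. -/
lemma lintegral_enorm_ft_sq {f : E → ℂ} (h1 : Integrable f) (h2 : MemLp f 2 volume) :
    ∫⁻ ζ, ‖ft f ζ‖ₑ ^ 2 = plancherelConst E * ∫⁻ x, ‖f x‖ₑ ^ 2 := by
  have hc : Continuous (𝓕 f) :=
    VectorFourier.fourierIntegral_continuous Real.continuous_fourierChar continuous_inner h1
  have hpi := Real.pi_pos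
  simp_rw [ft_eq_fourier]
  rw [lintegral_comp_inv_smul (g := fun ζ => ‖𝓕 f ζ‖ₑ ^ 2) (by fun_prop) (by positivity)]
  rw [plancherelConst]
  congr 1
  rw [← eLpNorm_two_sq, ← eLpNorm_two_sq, ← eLpNorm_congr_ae (fourier_toLp_ae_eq h1 h2),
    ← Lp.enorm_def, ← eLpNorm_congr_ae h2.coeFn_toLp, ← Lp.enorm_def, ← ofReal_norm, ← ofReal_norm,
    Lp.norm_fourier_eq]

open FourierTransform in
/-- Parseval's inequality on `L¹ ∩ L²`. -/
lemma enorm_integral_conj_mul_le {f g : E → ℂ} (hf1 : Integrable f) (hf2 : MemLp f 2 volume)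
    (hg1 : Integrable g) (hg2 : MemLp g 2 volume) :
    plancherelConst E * ‖∫ x, (starRingEnd ℂ) (f x) * g x‖ₑ ≤ ∫⁻ ζ, ‖ft f ζ‖ₑ * ‖ft g ζ‖ₑ := by
  have hcf : Continuous (𝓕 f) :=
    VectorFourier.fourierIntegral_continuous Real.continuous_fourierChar continuous_inner hf1
  have hcg : Continuous (𝓕 g) :=
    VectorFourier.fourierIntegral_continuous Real.continuous_fourierChar continuous_inner hg1
  have hpi := Real.pi_pos
  simp_rw [ft_eq_fourier]
  rw [lintegral_comp_inv_smul (g := fun ζ => ‖𝓕 f ζ‖ₑ * ‖𝓕 g ζ‖ₑ) (by fun_prop) (by positivity)]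
  rw [plancherelConst]
  gcongr
  have h := Lp.inner_fourier_eq (hf2.toLp f) (hg2.toLp g)
  rw [L2.inner_def, L2.inner_def] at h
  have e1 : ∫ x, (starRingEnd ℂ) (f x) * g x = ∫ x, (starRingEnd ℂ) (𝓕 f x) * 𝓕 g x := by
    calc _ = ∫ x, inner ℂ (hf2.toLp f x) (hg2.toLp g x) := by
            refine integral_congr_ae ?_
            filter_upwards [hf2.coeFn_toLp, hg2.coeFn_toLp] with x h1 h2
            rw [h1, h2, RCLike.inner_apply, mul_comm]
      _ = _ := by
            rw [← h]
            refine integral_congr_ae ?_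
            filter_upwards [fourier_toLp_ae_eq hf1 hf2, fourier_toLp_ae_eq hg1 hg2] with x h1 h2
            rw [h1, h2, RCLike.inner_apply, mul_comm]
  rw [e1]
  refine (enorm_integral_le_lintegral_enorm _).trans (le_of_eq ?_)
  congr 1; ext x
  rw [enorm_mul, RCLike.enorm_conj]

end Fourier


/-! ### Multiplication by Lipschitz functions in negative Sobolev spaces -/

lemma enorm_chr_sub_one_le {E : Type*} [NormedAddCommGroup E] [InnerProductSpace ℝ E] (h ζ : E) :
    ‖chr h ζ - 1‖ₑ ≤ ‖h‖ₑ * ‖ζ‖ₑ := by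
  rw [← ofReal_norm, ← ofReal_norm, ← ofReal_norm, ← ENNReal.ofReal_mul (norm_nonneg _)]
  refine ENNReal.ofReal_le_ofReal ?_
  have := Real.norm_exp_I_mul_ofReal_sub_one_le (x := -inner ℝ h ζ)
  rw [chr, mul_comm, ← Complex.ofReal_neg]
  refine this.trans ?_
  rw [norm_neg]
  exact norm_inner_le_norm h ζ

lemma enorm_chr_neg_sub_one_le {E : Type*} [NormedAddCommGroup E] [InnerProductSpace ℝ E]
    (h ζ : E) : ‖chr (-h) ζ - 1‖ₑ ≤ ‖h‖ₑ * ‖ζ‖ₑ := by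
  simpa using enorm_chr_sub_one_le (-h) ζ

lemma chr_neg_neg {E : Type*} [NormedAddCommGroup E] [InnerProductSpace ℝ E] (x ζ : E) :
    chr (-x) (-ζ) = chr x ζ := by simp [chr]

lemma enorm_sq_le_two_mul {F : Type*} [SeminormedAddCommGroup F] {z : F} {s t : ℝ} (hs : 0 ≤ s)
    (ht : 0 ≤ t) (h : ‖z‖ ≤ s + t) :
    ‖z‖ₑ ^ 2 ≤ 2 * (ENNReal.ofReal s ^ 2 + ENNReal.ofReal t ^ 2) := by
  rw [← ENNReal.ofReal_pow hs, ← ENNReal.ofReal_pow ht, ← ENNReal.ofReal_add (by positivity)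
    (by positivity), ← ENNReal.ofReal_ofNat 2, ← ENNReal.ofReal_mul (by positivity),
    ← ofReal_norm, ← ENNReal.ofReal_pow (norm_nonneg _)]
  refine ENNReal.ofReal_le_ofReal ?_
  calc ‖z‖ ^ 2 ≤ (s + t) ^ 2 := by gcongr
    _ ≤ _ := by nlinarith [sq_nonneg (s - t)]

lemma tendsto_mul_chr_sub_one {E : Type*} [NormedAddCommGroup E] [InnerProductSpace ℝ E]
    (e ζ : E) :
    Tendsto (fun n : ℕ => ((n : ℂ) + 1) * (chr (-(((n : ℝ) + 1)⁻¹ • e)) ζ - 1)) atTop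
      (𝓝 ((inner ℝ e ζ : ℝ) * Complex.I)) := by
  have hd : HasDerivAt (fun t : ℝ => Complex.exp (((t * inner ℝ e ζ : ℝ) : ℂ) * Complex.I))
      ((inner ℝ e ζ : ℝ) * Complex.I) 0 := by
    have h1 : HasDerivAt (fun t : ℝ => (((t * inner ℝ e ζ : ℝ) : ℂ) * Complex.I))
        ((inner ℝ e ζ : ℝ) * Complex.I) 0 := by
      have := ((hasDerivAt_id (0 : ℝ)).mul_const (inner ℝ e ζ)).ofReal_comp.mul_const Complex.I
      simpa using this
    simpa using h1.cexp
  have h2 := hd.tendsto_slope_zero_right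
  have h3 : Tendsto (fun n : ℕ => ((n : ℝ) + 1)⁻¹) atTop (𝓝[>] 0) := by
    refine tendsto_nhdsWithin_iff.2 ⟨?_, Eventually.of_forall fun n => ?_⟩
    · simpa [one_div] using tendsto_one_div_add_atTop_nhds_zero_nat (𝕜 := ℝ)
    · simp only [Set.mem_Ioi]; positivity
  refine (h2.comp h3).congr fun n => ?_
  simp only [Function.comp, chr, inner_neg_left, inner_smul_left]
  simp

/-- A difference quotient along e multiplies the transform by (exp(i h·ζ) - 1)/|h|, which tends to i
e·ζ. Plancherel bounds each quotient uniformly, and Fatou passes to the limit without a weak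
derivative of ψ. -/
lemma lintegral_inner_sq_mul_ft_le {ψ : Plane → ℂ} (h1 : Integrable ψ) (h2 : MemLp ψ 2 volume)
    {K : ℝ≥0∞} (hK : ∀ h : Plane, ∫⁻ x, ‖ψ (x + h) - ψ x‖ₑ ^ 2 ≤ K * ‖h‖ₑ ^ 2) {e : Plane}
    (he : ‖e‖ = 1) :
    ∫⁻ ζ, ‖(inner ℝ e ζ : ℝ)‖ₑ ^ 2 * ‖ft ψ ζ‖ₑ ^ 2 ≤ plancherelConst Plane * K := by
  have hc := continuous_ft h1
  set G : ℕ → Plane → ℝ≥0∞ := fun n ζ =>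
    ‖((n : ℂ) + 1) * (chr (-(((n : ℝ) + 1)⁻¹ • e)) ζ - 1)‖ₑ ^ 2 * ‖ft ψ ζ‖ₑ ^ 2 with hG
  have hlim : ∀ ζ, Tendsto (fun n => G n ζ) atTop
      (𝓝 (‖(inner ℝ e ζ : ℝ)‖ₑ ^ 2 * ‖ft ψ ζ‖ₑ ^ 2)) := by
    intro ζ
    have := (tendsto_mul_chr_sub_one e ζ).enorm
    have h3 : ‖((inner ℝ e ζ : ℝ) : ℂ) * Complex.I‖ₑ = ‖(inner ℝ e ζ : ℝ)‖ₑ := by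
      rw [← ofReal_norm, ← ofReal_norm]; simp
    rw [h3] at this
    refine ENNReal.Tendsto.mul_const (ENNReal.Tendsto.pow this) (Or.inr ?_)
    finiteness
  have hmeas : ∀ n, Measurable (G n) := fun n => by
    have : Continuous fun ζ => chr (-(((n : ℝ) + 1)⁻¹ • e)) ζ := by fun_prop
    simp only [hG]
    fun_prop
  calc _ = ∫⁻ ζ, liminf (fun n => G n ζ) atTop := by
        congr 1; ext ζ; exact (hlim ζ).liminf_eq.symm
    _ ≤ liminf (fun n => ∫⁻ ζ, G n ζ) atTop := lintegral_liminf_le hmeas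
    _ ≤ plancherelConst Plane * K := by
        refine liminf_le_of_le (by isBoundedDefault) fun b hb => ?_
        obtain ⟨n, hn⟩ := hb.exists
        refine hn.trans ?_
        set h : Plane := ((n : ℝ) + 1)⁻¹ • e with hh
        have hnorm : ‖h‖ₑ = ((n : ℝ≥0∞) + 1)⁻¹ := by
          rw [← ofReal_norm, hh, norm_smul, he, mul_one, norm_inv, ENNReal.ofReal_inv_of_pos]
          · congr 1
            rw [Real.norm_of_nonneg (by positivity), ENNReal.ofReal_add (by positivity) (by simp)]
            simp
          · rw [Real.norm_of_nonneg (by positivity)]; positivity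
        have hI : Integrable (fun x => ψ (x + h)) := h1.comp_add_right h
        have hM : MemLp (fun x => ψ (x + h)) 2 volume :=
          h2.comp_measurePreserving (measurePreserving_add_right volume h)
        have hn1 : ‖(n : ℂ) + 1‖ₑ = (n : ℝ≥0∞) + 1 := by
          rw [← ofReal_norm]
          have : ‖(n : ℂ) + 1‖ = (n : ℝ) + 1 := by
            rw [← Nat.cast_succ, Complex.norm_natCast]; simp
          rw [this, ENNReal.ofReal_add (by positivity) (by simp)]; simp
        calc ∫⁻ ζ, G n ζ = ∫⁻ ζ, ((n : ℝ≥0∞) + 1) ^ 2 * ‖ft (fun x => ψ (x + h) - ψ x) ζ‖ₑ ^ 2 := by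
              congr 1; ext ζ
              rw [ft_sub hI h1, ft_comp_add_right, hG]
              simp only
              rw [← sub_one_mul, enorm_mul, enorm_mul, hn1]
              ring
          _ = ((n : ℝ≥0∞) + 1) ^ 2 *
                (plancherelConst Plane * ∫⁻ x, ‖ψ (x + h) - ψ x‖ₑ ^ 2) := by
              rw [lintegral_const_mul' _ _ (by finiteness),
                lintegral_enorm_ft_sq (f := fun x => ψ (x + h) - ψ x) (hI.sub h1) (hM.sub h2)]
          _ ≤ ((n : ℝ≥0∞) + 1) ^ 2 * (plancherelConst Plane * (K * ‖h‖ₑ ^ 2)) := by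
              gcongr; exact hK h
          _ = (((n : ℝ≥0∞) + 1) * ((n : ℝ≥0∞) + 1)⁻¹) ^ 2 * (plancherelConst Plane * K) := by
              rw [hnorm]; ring
          _ = _ := by rw [ENNReal.mul_inv_cancel (by simp) (by finiteness)]; simp

/-- Sum over the two coordinate directions; this is the origin of the factor 2. -/
lemma lintegral_norm_sq_mul_ft_le {ψ : Plane → ℂ} (h1 : Integrable ψ) (h2 : MemLp ψ 2 volume)
    {K : ℝ≥0∞} (hK : ∀ h : Plane, ∫⁻ x, ‖ψ (x + h) - ψ x‖ₑ ^ 2 ≤ K * ‖h‖ₑ ^ 2) :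
    ∫⁻ ζ, ‖ζ‖ₑ ^ 2 * ‖ft ψ ζ‖ₑ ^ 2 ≤ 2 * plancherelConst Plane * K := by
  have hc := continuous_ft h1
  have h := fun j : Fin 2 => lintegral_inner_sq_mul_ft_le h1 h2 hK
    (e := EuclideanSpace.single j (1 : ℝ)) (by simp)
  calc _ = ∫⁻ ζ, ((‖(inner ℝ (EuclideanSpace.single 0 (1 : ℝ)) ζ : ℝ)‖ₑ ^ 2 * ‖ft ψ ζ‖ₑ ^ 2)
        + ‖(inner ℝ (EuclideanSpace.single 1 (1 : ℝ)) ζ : ℝ)‖ₑ ^ 2 * ‖ft ψ ζ‖ₑ ^ 2) := by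
        congr 1; ext ζ
        rw [← add_mul]
        congr 1
        simp only [← ofReal_norm, ← ENNReal.ofReal_pow (norm_nonneg _)]
        rw [← ENNReal.ofReal_add (by positivity) (by positivity), EuclideanSpace.norm_sq_eq]
        simp [EuclideanSpace.inner_single_left]
    _ ≤ plancherelConst Plane * K + plancherelConst Plane * K := by
        rw [lintegral_add_left (by fun_prop)]
        exact add_le_add (h 0) (h 1)
    _ = _ := by ring

lemma lintegral_comp_neg_plane (g : Plane → ℝ≥0∞) : ∫⁻ x, g (-x) = ∫⁻ x, g x := by
  exact (Measure.measurePreserving_neg (volume : Measure Plane)).lintegral_comp_emb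
    (MeasurableEquiv.neg Plane).measurableEmbedding g

lemma lintegral_enorm_ft_neg_sq {a : Plane → ℂ} (h1 : Integrable a) (h2 : MemLp a 2 volume) :
    ∫⁻ x, ‖ft a (-x)‖ₑ ^ 2 = plancherelConst Plane * ∫⁻ ζ, ‖a ζ‖ₑ ^ 2 := by
  rw [lintegral_comp_neg_plane (fun x => ‖ft a x‖ₑ ^ 2), lintegral_enorm_ft_sq h1 h2]

/-- Translating the transform of a multiplies a by a character, and |exp(iθ) - 1| ≤ |θ|; Plancherel
does the rest. -/
lemma lintegral_enorm_ft_neg_add_sub_sq_le {a : Plane → ℂ} (h1 : Integrable a)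
    (h2 : MemLp a 2 volume) (h : Plane) :
    ∫⁻ x, ‖ft a (-(x + h)) - ft a (-x)‖ₑ ^ 2
      ≤ plancherelConst Plane * ‖h‖ₑ ^ 2 * ∫⁻ ζ, ‖ζ‖ₑ ^ 2 * ‖a ζ‖ₑ ^ 2 := by
  have hI : Integrable (fun ζ => chr (-h) ζ * a ζ) := by
    simp_rw [chr_comm (-h)]; exact integrable_chr_mul h1 _
  have hM : MemLp (fun ζ => chr (-h) ζ * a ζ) 2 volume := by
    refine h2.of_le hI.aestronglyMeasurable (Eventually.of_forall fun x => by simp)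
  calc _ = ∫⁻ x, ‖ft (fun ζ => chr (-h) ζ * a ζ - a ζ) (-x)‖ₑ ^ 2 := by
        congr 1; ext x
        rw [ft_sub hI h1]
        congr 3
        unfold ft
        congr 1; ext ζ
        rw [neg_add, chr_comm, chr_add_left, chr_comm ζ]; ring
    _ = plancherelConst Plane * ∫⁻ ζ, ‖chr (-h) ζ * a ζ - a ζ‖ₑ ^ 2 :=
        lintegral_enorm_ft_neg_sq (hI.sub h1) (hM.sub h2)
    _ ≤ plancherelConst Plane * ∫⁻ ζ, ‖h‖ₑ ^ 2 * (‖ζ‖ₑ ^ 2 * ‖a ζ‖ₑ ^ 2) := by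
        refine mul_le_mul' le_rfl (lintegral_mono fun ζ => ?_)
        rw [← sub_one_mul, enorm_mul, mul_pow, ← mul_assoc, ← mul_pow ‖h‖ₑ]
        gcongr
        exact enorm_chr_neg_sub_one_le h ζ
    _ = _ := by rw [lintegral_const_mul' _ _ (by finiteness)]; ring

/-- The Sobolev weight `(1 + |ζ|²)^{-2}`. -/
def bessel (ζ : Plane) : ℝ := ((1 + ‖ζ‖ ^ 2) ^ 2)⁻¹

lemma bessel_pos (ζ : Plane) : 0 < bessel ζ := by unfold bessel; positivity

lemma bessel_le_one (ζ : Plane) : bessel ζ ≤ 1 := by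
  unfold bessel
  exact inv_le_one_of_one_le₀ (one_le_pow₀ (by nlinarith [sq_nonneg ‖ζ‖]))

lemma add_sq_mul_bessel_le (ζ : Plane) : (1 + ‖ζ‖ ^ 2) * bessel ζ ≤ 1 := by
  unfold bessel
  rw [← div_eq_mul_inv, div_le_one (by positivity)]
  nlinarith [sq_nonneg ‖ζ‖]

@[fun_prop] lemma continuous_bessel : Continuous bessel := by
  unfold bessel
  refine Continuous.inv₀ (by fun_prop) fun ζ => by positivity

lemma integrable_bessel : Integrable bessel := by
  have := integrable_rpow_neg_one_add_norm_sq (E := Plane) (μ := volume) (r := 4) (by simp; norm_num)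
  refine this.congr (Eventually.of_forall fun ζ => ?_)
  simp only [bessel]
  rw [show (-4 / 2 : ℝ) = -(2 : ℕ) by norm_num, Real.rpow_neg (by positivity), Real.rpow_natCast]

lemma memLp_two_of_memLp_one_top {X F : Type*} [MeasurableSpace X] {ν : Measure X}
    [NormedAddCommGroup F] {f : X → F} (h1 : MemLp f 1 ν) (ht : MemLp f ∞ ν) : MemLp f 2 ν := by
  refine (memLp_two_iff_integrable_sq_norm h1.1).2 ?_
  have h1' := (memLp_one_iff_integrable.1 h1).norm
  have hb : ∀ᵐ x ∂ν, ‖‖f x‖‖ ≤ (eLpNorm f ∞ ν).toReal := by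
    filter_upwards [enorm_ae_le_eLpNormEssSup f ν] with x hx
    rw [norm_norm, ← toReal_enorm]
    exact ENNReal.toReal_mono ht.2.ne (by simpa using hx)
  simpa only [sq] using h1'.bdd_mul h1'.aestronglyMeasurable hb

lemma memLp_two_of_bounded {a : Plane → ℂ} (h1 : Integrable a) {C : ℝ} (hC : ∀ x, ‖a x‖ ≤ C) :
    MemLp a 2 volume :=
  memLp_two_of_memLp_one_top (memLp_one_iff_integrable.2 h1)
    (memLp_top_of_bound h1.aestronglyMeasurable C (Eventually.of_forall hC))

lemma lintegral_mul_sq_le {X : Type*} [MeasurableSpace X] {ν : Measure X} {f g : X → ℝ≥0∞}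
    (hf : AEMeasurable f ν) (hg : AEMeasurable g ν) :
    (∫⁻ x, f x * g x ∂ν) ^ 2 ≤ (∫⁻ x, f x ^ 2 ∂ν) * ∫⁻ x, g x ^ 2 ∂ν := by
  have h := ENNReal.lintegral_mul_le_Lp_mul_Lq ν Real.HolderConjugate.two_two hf hg
  calc _ ≤ ((∫⁻ x, f x ^ (2 : ℝ) ∂ν) ^ (1 / 2 : ℝ) * (∫⁻ x, g x ^ (2 : ℝ) ∂ν) ^ (1 / 2 : ℝ)) ^ 2 := by
        gcongr; exact h
    _ = _ := by
        rw [mul_pow, ← ENNReal.rpow_natCast, ← ENNReal.rpow_natCast, ← ENNReal.rpow_mul,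
          ← ENNReal.rpow_mul]
        norm_num

/-- Multiplication by an integrable function bounded by `1` and `L`-Lipschitz is bounded from
the homogeneous Sobolev space of order `-1` to the inhomogeneous one of order `-2`. -/
lemma lintegral_bessel_mul_ft_mul_le_of_integrable {f w : Plane → ℂ} {L : ℝ} (hf1 : Integrable f)
    (hf2 : MemLp f 2 volume) (hw1 : Integrable w) (hwb : ∀ x, ‖w x‖ ≤ 1) (hL : 0 ≤ L)
    (hwL : ∀ x y, ‖w x - w y‖ ≤ L * ‖x - y‖) :
    ∫⁻ ζ, ENNReal.ofReal (bessel ζ) * ‖ft (fun x => w x * f x) ζ‖ₑ ^ 2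
      ≤ 4 * (1 + ENNReal.ofReal L ^ 2) * ∫⁻ ζ, ‖ft f ζ‖ₑ ^ 2 / ‖ζ‖ₑ ^ 2 := by
  have hwf : Integrable (fun x => w x * f x) := hf1.bdd_mul hw1.aestronglyMeasurable
    (Eventually.of_forall hwb)
  set H : Plane → ℂ := ft (fun x => w x * f x) with hH
  have hHc : Continuous H := continuous_ft hwf
  obtain ⟨B, hB⟩ : ∃ B : ℝ, ∀ ζ, ‖H ζ‖ ≤ B := ⟨_, norm_ft_le _⟩
  -- The dual element: pairing it with H returns the squared norm T to be bounded. The weight of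
  -- order -2, unlike the one of order -1, is integrable on the plane, so a is in L¹ and its
  -- transform is an honest bounded continuous function.
  set a : Plane → ℂ := fun ζ => (bessel ζ : ℂ) * H ζ with ha
  have ha1 : Integrable a := by
    refine (integrable_bessel.ofReal (𝕜 := ℂ)).mul_bdd (c := B) hHc.aestronglyMeasurable ?_
    exact Eventually.of_forall hB
  have ha2 : MemLp a 2 volume := by
    refine memLp_two_of_bounded ha1 (C := B) fun ζ => ?_
    rw [ha, norm_mul, Complex.norm_real, Real.norm_of_nonneg (bessel_pos ζ).le]
    have := bessel_le_one ζ; have := bessel_pos ζ; have := hB ζ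
    nlinarith [norm_nonneg (H ζ)]
  set T : ℝ≥0∞ := ∫⁻ ζ, ENNReal.ofReal (bessel ζ) * ‖H ζ‖ₑ ^ 2 with hT
  -- Finiteness is needed because a factor T is cancelled at the end.
  have hTfin : T ≠ ∞ := by
    have : T ≤ ∫⁻ ζ, ENNReal.ofReal (bessel ζ) * ENNReal.ofReal B ^ 2 := by
      refine lintegral_mono fun ζ => ?_
      gcongr
      rw [← ofReal_norm]; exact ENNReal.ofReal_le_ofReal (hB ζ)
    refine ne_top_of_le_ne_top ?_ this
    rw [lintegral_mul_const' _ _ (by finiteness)]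
    refine ENNReal.mul_ne_top ?_ (by finiteness)
    rw [← ofReal_integral_eq_lintegral_ofReal integrable_bessel
      (Eventually.of_forall fun ζ => (bessel_pos ζ).le)]
    finiteness
  have haT0 : ∫⁻ ζ, ‖a ζ‖ₑ ^ 2 ≤ T := by
    refine lintegral_mono fun ζ => ?_
    rw [ha, enorm_mul, mul_pow]
    gcongr
    have h1 := bessel_le_one ζ; have h0 := bessel_pos ζ
    rw [← ofReal_norm, Complex.norm_real, Real.norm_of_nonneg h0.le, ← ENNReal.ofReal_pow h0.le]
    exact ENNReal.ofReal_le_ofReal (by nlinarith)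
  have haT1 : ∫⁻ ζ, ‖ζ‖ₑ ^ 2 * ‖a ζ‖ₑ ^ 2 ≤ T := by
    refine lintegral_mono fun ζ => ?_
    rw [ha, enorm_mul, mul_pow, ← mul_assoc]
    gcongr
    have h1 := add_sq_mul_bessel_le ζ; have h0 := bessel_pos ζ
    rw [← ofReal_norm, ← ofReal_norm, Complex.norm_real, Real.norm_of_nonneg h0.le,
      ← ENNReal.ofReal_pow h0.le, ← ENNReal.ofReal_pow (norm_nonneg _),
      ← ENNReal.ofReal_mul (by positivity)]
    exact ENNReal.ofReal_le_ofReal (by nlinarith)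
  -- Up to normalization, the inverse transform of a; then ψ below is the adjoint of multiplication
  -- by w applied to u.
  set u : Plane → ℂ := fun x => ft a (-x) with hu
  have huc : Continuous u := (continuous_ft ha1).comp continuous_neg
  obtain ⟨D, hD⟩ : ∃ D : ℝ, ∀ x, ‖u x‖ ≤ D := ⟨_, fun x => norm_ft_le a (-x)⟩
  set ψ : Plane → ℂ := fun x => (starRingEnd ℂ) (w x) * u x with hψ
  have hcw : Integrable (fun x => (starRingEnd ℂ) (w x)) := by
    refine hw1.congr' (RCLike.continuous_conj.comp_aestronglyMeasurable hw1.aestronglyMeasurable) ?_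
    exact Eventually.of_forall fun x => by simp
  have hψ1 : Integrable ψ :=
    hcw.mul_bdd (c := D) huc.aestronglyMeasurable (Eventually.of_forall hD)
  have hψ2 : MemLp ψ 2 volume := by
    refine memLp_two_of_bounded hψ1 (C := D) fun x => ?_
    rw [hψ, norm_mul, RCLike.norm_conj]
    have := hwb x; have := hD x
    nlinarith [norm_nonneg (u x), norm_nonneg (w x)]
  set pc := plancherelConst Plane
  have hpc0 : pc ≠ 0 := plancherelConst_ne_zero
  have hpct : pc ≠ ∞ := plancherelConst_ne_top
  -- Discrete Leibniz rule: a difference of u, bounded through |ζ|²|a|², plus a difference of w,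
  -- bounded by L|h|. The two integrals of |a|² and |ζ|²|a|² are both at most T.
  have hdiff : ∀ h : Plane, ∫⁻ x, ‖ψ (x + h) - ψ x‖ₑ ^ 2
      ≤ (2 * pc * (1 + ENNReal.ofReal L ^ 2) * T) * ‖h‖ₑ ^ 2 := by
    intro h
    have h1 : ∀ x, ‖ψ (x + h) - ψ x‖ₑ ^ 2
        ≤ 2 * (‖u (x + h) - u x‖ₑ ^ 2 + ENNReal.ofReal L ^ 2 * ‖h‖ₑ ^ 2 * ‖u x‖ₑ ^ 2) := by
      intro x
      have hn : ‖ψ (x + h) - ψ x‖ ≤ ‖u (x + h) - u x‖ + L * ‖h‖ * ‖u x‖ := by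
        have e : ψ (x + h) - ψ x = (starRingEnd ℂ) (w (x + h)) * (u (x + h) - u x)
            + (starRingEnd ℂ) (w (x + h) - w x) * u x := by
          simp only [hψ, map_sub]; ring
        rw [e]
        refine (norm_add_le _ _).trans ?_
        rw [norm_mul, norm_mul, RCLike.norm_conj, RCLike.norm_conj]
        have h3 := hwL (x + h) x
        rw [add_sub_cancel_left] at h3
        have h4 := hwb (x + h)
        gcongr
        nlinarith [norm_nonneg (u (x + h) - u x)]
      refine (enorm_sq_le_two_mul (by positivity) (by positivity) hn).trans (le_of_eq ?_)
      rw [ENNReal.ofReal_mul (by positivity), ENNReal.ofReal_mul hL, ofReal_norm, ofReal_norm,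
        ofReal_norm, mul_pow, mul_pow]
    calc _ ≤ ∫⁻ x, 2 * (‖u (x + h) - u x‖ₑ ^ 2
            + ENNReal.ofReal L ^ 2 * ‖h‖ₑ ^ 2 * ‖u x‖ₑ ^ 2) := lintegral_mono h1
      _ = 2 * ((∫⁻ x, ‖u (x + h) - u x‖ₑ ^ 2)
            + ENNReal.ofReal L ^ 2 * ‖h‖ₑ ^ 2 * ∫⁻ x, ‖u x‖ₑ ^ 2) := by
          rw [lintegral_const_mul' _ _ (by finiteness), lintegral_add_left (by fun_prop),
            lintegral_const_mul' _ _ (by finiteness)]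
      _ ≤ 2 * (pc * ‖h‖ₑ ^ 2 * T + ENNReal.ofReal L ^ 2 * ‖h‖ₑ ^ 2 * (pc * T)) := by
          gcongr
          · refine (lintegral_enorm_ft_neg_add_sub_sq_le ha1 ha2 h).trans ?_
            gcongr
          · rw [hu, lintegral_enorm_ft_neg_sq ha1 ha2]
            gcongr
      _ = _ := by ring
  have hgrad := lintegral_norm_sq_mul_ft_le hψ1 hψ2 hdiff
  -- Fubini instead of Plancherel, so that the pairing of a with H becomes the pairing of ψ with f
  -- without constants.
  have hswap : ∫ x, (starRingEnd ℂ) (ψ x) * f x = ∫ ζ, (starRingEnd ℂ) (a ζ) * H ζ := by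
    have hca : Integrable (fun ζ => (starRingEnd ℂ) (a ζ)) :=
      ha1.congr' (RCLike.continuous_conj.comp_aestronglyMeasurable ha1.aestronglyMeasurable)
        (Eventually.of_forall fun x => by simp)
    calc _ = ∫ x, ∫ ζ, chr x ζ * ((w x * f x) * (starRingEnd ℂ) (a ζ)) := by
          congr 1; ext x
          have : (starRingEnd ℂ) (u x) = ∫ ζ, chr x ζ * (starRingEnd ℂ) (a ζ) := by
            simp only [hu, ft]
            rw [← integral_conj]
            congr 1; ext ζ
            rw [map_mul, ← chr_neg_left, chr_neg_neg, chr_comm]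
          simp only [hψ]
          rw [map_mul, Complex.conj_conj, this, mul_right_comm, ← integral_const_mul]
          congr 1; ext ζ; ring
      _ = ∫ ζ, ∫ x, chr x ζ * ((w x * f x) * (starRingEnd ℂ) (a ζ)) := by
          refine integral_integral_swap ?_
          exact (hwf.mul_prod hca).bdd_mul (c := 1) continuous_chr.aestronglyMeasurable
            (Eventually.of_forall fun p => by simp)
      _ = _ := by
          congr 1; ext ζ
          rw [hH, ft, ← integral_const_mul]
          congr 1; ext x; ring
  have hTint : T = ‖∫ x, (starRingEnd ℂ) (ψ x) * f x‖ₑ := by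
    rw [hswap]
    have e : ∀ ζ, (starRingEnd ℂ) (a ζ) * H ζ = ((bessel ζ * ‖H ζ‖ ^ 2 : ℝ) : ℂ) := fun ζ => by
      simp only [ha, map_mul, Complex.conj_ofReal]
      rw [mul_assoc, Complex.conj_mul']
      push_cast; ring
    have hint : Integrable (fun ζ => bessel ζ * ‖H ζ‖ ^ 2) := by
      refine integrable_bessel.mul_bdd (c := B ^ 2) (by fun_prop) (Eventually.of_forall fun ζ => ?_)
      rw [Real.norm_of_nonneg (by positivity)]
      have := hB ζ
      gcongr
    have hnn : ∀ ζ, 0 ≤ bessel ζ * ‖H ζ‖ ^ 2 := fun ζ =>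
      mul_nonneg (bessel_pos ζ).le (by positivity)
    simp_rw [e]
    rw [integral_complex_ofReal, ← ofReal_norm, Complex.norm_real,
      Real.norm_of_nonneg (integral_nonneg hnn),
      ofReal_integral_eq_lintegral_ofReal hint (Eventually.of_forall hnn), hT]
    congr 1; ext ζ
    rw [ENNReal.ofReal_mul (bessel_pos ζ).le, ENNReal.ofReal_pow (norm_nonneg _), ofReal_norm]
  have hpars := enorm_integral_conj_mul_le hψ1 hψ2 hf1 hf2
  rw [← hTint] at hpars
  set Q : ℝ≥0∞ := ∫⁻ ζ, ‖ft f ζ‖ₑ ^ 2 / ‖ζ‖ₑ ^ 2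
  -- Parseval, then Cauchy–Schwarz after inserting |ζ|·|ζ|⁻¹, which is legitimate off the null set ζ
  -- = 0. The right side is linear in T, so one factor T cancels.
  have hCS : (pc * T) ^ 2 ≤ (2 * pc * (2 * pc * (1 + ENNReal.ofReal L ^ 2) * T)) * Q := by
    have hψc := continuous_ft hψ1
    have hfc := continuous_ft hf1
    have h0 : ∀ᵐ ζ : Plane, ζ ≠ 0 := by
      simp [ae_iff, measure_singleton]
    calc (pc * T) ^ 2 ≤ (∫⁻ ζ, ‖ft ψ ζ‖ₑ * ‖ft f ζ‖ₑ) ^ 2 := by gcongr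
      _ = (∫⁻ ζ, (‖ζ‖ₑ * ‖ft ψ ζ‖ₑ) * (‖ft f ζ‖ₑ / ‖ζ‖ₑ)) ^ 2 := by
          congr 1
          refine lintegral_congr_ae ?_
          filter_upwards [h0] with ζ hζ
          rw [mul_comm ‖ζ‖ₑ, mul_assoc, ENNReal.mul_div_cancel (by simpa using hζ) (by finiteness)]
      _ ≤ (∫⁻ ζ, (‖ζ‖ₑ * ‖ft ψ ζ‖ₑ) ^ 2) * ∫⁻ ζ, (‖ft f ζ‖ₑ / ‖ζ‖ₑ) ^ 2 :=
          lintegral_mul_sq_le (by fun_prop) (by fun_prop)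
      _ ≤ _ := by
          simp only [mul_pow, div_eq_mul_inv] at hgrad ⊢
          refine mul_le_mul' hgrad (le_of_eq ?_)
          simp only [Q, div_eq_mul_inv, ENNReal.inv_pow]
  rcases eq_or_ne T 0 with hT0 | hT0
  · rw [hT0]; exact zero_le
  have h1 : (pc ^ 2 * T) * T ≤ (pc ^ 2 * T) * (4 * (1 + ENNReal.ofReal L ^ 2) * Q) := by
    calc _ = (pc * T) ^ 2 := by ring
      _ ≤ _ := hCS
      _ = _ := by ring
  exact (ENNReal.mul_le_mul_iff_right (mul_ne_zero (pow_ne_zero _ hpc0) hT0)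
    (ENNReal.mul_ne_top (by finiteness) hTfin)).1 h1

/-- The Lipschitz cutoff `max (1 - |x| / n) 0`. -/
def cutoff (n : ℕ) (x : Plane) : ℝ := max (1 - ‖x‖ / (n + 1)) 0

lemma cutoff_nonneg (n : ℕ) (x : Plane) : 0 ≤ cutoff n x := le_max_right _ _

lemma cutoff_le_one (n : ℕ) (x : Plane) : cutoff n x ≤ 1 :=
  max_le (by have : 0 ≤ ‖x‖ / ((n : ℝ) + 1) := by positivity
             linarith) zero_le_one

@[fun_prop] lemma continuous_cutoff (n : ℕ) : Continuous (cutoff n) := by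
  unfold cutoff; fun_prop

lemma abs_cutoff_sub_le (n : ℕ) (x y : Plane) : |cutoff n x - cutoff n y| ≤ ‖x - y‖ := by
  unfold cutoff
  refine (abs_max_sub_max_le_abs _ _ _).trans ?_
  rw [show (1 - ‖x‖ / ((n : ℝ) + 1)) - (1 - ‖y‖ / (n + 1)) = (‖y‖ - ‖x‖) / (n + 1) by ring, abs_div,
    abs_of_pos (by positivity : (0 : ℝ) < n + 1)]
  refine (div_le_self (abs_nonneg _) (by simp)).trans ?_
  rw [norm_sub_rev]
  exact abs_norm_sub_norm_le y x

lemma hasCompactSupport_cutoff (n : ℕ) : HasCompactSupport (cutoff n) := by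
  refine HasCompactSupport.intro (isCompact_closedBall (0 : Plane) (n + 1)) fun x hx => ?_
  have h : (n : ℝ) + 1 < ‖x‖ := by simpa using hx
  refine max_eq_right ?_
  have := (one_lt_div (by positivity : (0 : ℝ) < n + 1)).2 h
  linarith

lemma tendsto_cutoff (x : Plane) : Tendsto (fun n => cutoff n x) atTop (𝓝 1) := by
  have h : Tendsto (fun n : ℕ => ‖x‖ / ((n : ℝ) + 1)) atTop (𝓝 0) := by
    have := (tendsto_one_div_add_atTop_nhds_zero_nat (𝕜 := ℝ)).const_mul ‖x‖
    simpa [div_eq_mul_inv] using this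
  have := (h.const_sub 1).max (tendsto_const_nhds (x := (0 : ℝ)))
  simpa [cutoff] using this

/-- Multiplication by a function bounded by `1` and `L`-Lipschitz is bounded from
the homogeneous Sobolev space of order `-1` to the inhomogeneous one of order `-2`. -/
lemma lintegral_bessel_mul_ft_mul_le {f w : Plane → ℂ} {L : ℝ} (hf1 : Integrable f)
    (hf2 : MemLp f 2 volume) (hwc : Continuous w) (hwb : ∀ x, ‖w x‖ ≤ 1) (hL : 0 ≤ L)
    (hwL : ∀ x y, ‖w x - w y‖ ≤ L * ‖x - y‖) :
    ∫⁻ ζ, ENNReal.ofReal (bessel ζ) * ‖ft (fun x => w x * f x) ζ‖ₑ ^ 2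
      ≤ 4 * (1 + ENNReal.ofReal (L + 1) ^ 2) * ∫⁻ ζ, ‖ft f ζ‖ₑ ^ 2 / ‖ζ‖ₑ ^ 2 := by
  -- A phase such as exp(-i v(x)·ζ₂) is not integrable, so it is truncated. The cutoffs are
  -- 1-Lipschitz uniformly in n, whence L + 1, and Fatou removes the truncation.
  set W : ℕ → Plane → ℂ := fun n x => (cutoff n x : ℂ) * w x with hW
  have hWc : ∀ n, Continuous (W n) := fun n => by
    have := continuous_cutoff n
    fun_prop
  have hWb : ∀ n x, ‖W n x‖ ≤ 1 := fun n x => by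
    rw [hW, norm_mul, Complex.norm_real, Real.norm_of_nonneg (cutoff_nonneg n x)]
    exact mul_le_one₀ (cutoff_le_one n x) (norm_nonneg _) (hwb x)
  have hWi : ∀ n, Integrable (W n) := fun n => by
    refine (hWc n).integrable_of_hasCompactSupport ?_
    exact ((hasCompactSupport_cutoff n).comp_left (g := ((↑) : ℝ → ℂ)) (by simp)).mul_right
  have hWL : ∀ n x y, ‖W n x - W n y‖ ≤ (L + 1) * ‖x - y‖ := fun n x y => by
    have e : W n x - W n y
        = (cutoff n x : ℂ) * (w x - w y) + ((cutoff n x - cutoff n y : ℝ) : ℂ) * w y := by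
      simp only [hW]; push_cast; ring
    rw [e]
    refine (norm_add_le _ _).trans ?_
    rw [norm_mul, norm_mul, Complex.norm_real, Complex.norm_real,
      Real.norm_of_nonneg (cutoff_nonneg n x), Real.norm_eq_abs]
    have h1 := cutoff_le_one n x
    have h2 := abs_cutoff_sub_le n x y
    have h3 := hwL x y
    have h4 := hwb y
    nlinarith [norm_nonneg (w x - w y), norm_nonneg (w y), norm_nonneg (x - y),
      cutoff_nonneg n x, abs_nonneg (cutoff n x - cutoff n y)]
  have hWf : ∀ n, Integrable (fun x => W n x * f x) := fun n =>
    hf1.bdd_mul (c := 1) (hWc n).aestronglyMeasurable (Eventually.of_forall (hWb n))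
  have hlim : ∀ ζ, Tendsto (fun n => ENNReal.ofReal (bessel ζ) * ‖ft (fun x => W n x * f x) ζ‖ₑ ^ 2)
      atTop (𝓝 (ENNReal.ofReal (bessel ζ) * ‖ft (fun x => w x * f x) ζ‖ₑ ^ 2)) := by
    intro ζ
    refine ENNReal.Tendsto.const_mul (ENNReal.Tendsto.pow (Tendsto.enorm ?_)) (Or.inr (by finiteness))
    refine tendsto_integral_of_dominated_convergence (fun x => ‖f x‖)
      (fun n => (integrable_chr_mul (hWf n) ζ).aestronglyMeasurable) hf1.norm ?_ ?_
    · refine fun n => Eventually.of_forall fun x => ?_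
      rw [norm_mul, norm_mul, norm_chr, one_mul]
      exact mul_le_of_le_one_left (norm_nonneg _) (hWb n x)
    · refine Eventually.of_forall fun x => ?_
      have := ((Complex.continuous_ofReal.tendsto 1).comp (tendsto_cutoff x))
      have := ((this.mul_const (w x)).mul_const (f x)).const_mul (chr x ζ)
      simpa using this
  calc _ = ∫⁻ ζ, liminf (fun n => ENNReal.ofReal (bessel ζ) *
          ‖ft (fun x => W n x * f x) ζ‖ₑ ^ 2) atTop := by
        congr 1; ext ζ; exact (hlim ζ).liminf_eq.symm
    _ ≤ liminf (fun n => ∫⁻ ζ, ENNReal.ofReal (bessel ζ) *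
          ‖ft (fun x => W n x * f x) ζ‖ₑ ^ 2) atTop := by
        refine lintegral_liminf_le fun n => ?_
        have := continuous_ft (hWf n)
        fun_prop
    _ ≤ _ := by
        refine liminf_le_of_le (by isBoundedDefault) fun b hb => ?_
        obtain ⟨n, hn⟩ := hb.exists
        exact hn.trans (lintegral_bessel_mul_ft_mul_le_of_integrable hf1 hf2 (hWi n) (hWb n)
          (by positivity) (hWL n))

/-! ### Integrals against signed measures -/

section SignedMeasure

variable {X F : Type*} [MeasurableSpace X] [NormedAddCommGroup F] [NormedSpace ℝ F]

lemma integrable_variation_withDensityᵥ {ν : Measure X} {f : X → ℝ} {φ : X → F}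
    (hf : Integrable f ν) (h : Integrable (fun x => f x • φ x) ν)
    (hφ : AEStronglyMeasurable φ ν) : Integrable φ (ν.withDensityᵥ f).variation := by
  have hm := hf.aestronglyMeasurable
  rw [Measure.variation_withDensityᵥ hf,
    integrable_withDensity_iff_integrable_smul₀' (by fun_prop) (by simp)]
  refine h.congr' (AEStronglyMeasurable.smul ?_ hφ) (Eventually.of_forall fun x => ?_)
  · simpa only [toReal_enorm] using hm.norm
  · simp [norm_smul]

/-- The signed density is split into its positive and negative parts. Only integrability of the
product is assumed, which is what allows the unbounded logarithm as integrand. -/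
lemma integral_withDensityᵥ {ν : Measure X} {f : X → ℝ} {φ : X → F}
    (hf : Integrable f ν) (h : Integrable (fun x => f x • φ x) ν)
    (hφ : AEStronglyMeasurable φ ν) :
    ∫ᵛ x, φ x ∂<•(ν.withDensityᵥ f) = ∫ x, f x • φ x ∂ν := by
  have h1 := isFiniteMeasure_withDensity_ofReal hf.2
  have h2 := isFiniteMeasure_withDensity_ofReal hf.neg.2
  have hm := hf.aestronglyMeasurable
  have i1 : Integrable (fun x => (ENNReal.ofReal (f x)).toReal • φ x) ν := by
    refine h.mono (AEStronglyMeasurable.smul ?_ hφ) (Eventually.of_forall fun x => ?_)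
    · exact (AEMeasurable.ennreal_toReal (by fun_prop)).aestronglyMeasurable
    rw [norm_smul, norm_smul, Real.norm_of_nonneg ENNReal.toReal_nonneg, ENNReal.toReal_ofReal']
    gcongr
    exact max_le (le_abs_self _) (abs_nonneg _)
  have i2 : Integrable (fun x => (ENNReal.ofReal (-f x)).toReal • φ x) ν := by
    refine h.mono (AEStronglyMeasurable.smul ?_ hφ) (Eventually.of_forall fun x => ?_)
    · exact (AEMeasurable.ennreal_toReal (by fun_prop)).aestronglyMeasurable
    rw [norm_smul, norm_smul, Real.norm_of_nonneg ENNReal.toReal_nonneg, ENNReal.toReal_ofReal']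
    gcongr
    exact max_le (neg_le_abs _) (abs_nonneg _)
  rw [withDensityᵥ_eq_withDensity_pos_part_sub_withDensity_neg_part hf,
    VectorMeasure.integral_sub_vectorMeasure, VectorMeasure.integral_toSignedMeasure,
    VectorMeasure.integral_toSignedMeasure,
    integral_withDensity_eq_integral_toReal_smul₀ (by fun_prop) (by simp),
    integral_withDensity_eq_integral_toReal_smul₀ (by fun_prop) (by simp), ← integral_sub i1 i2]
  · congr 1; ext x
    rw [← sub_smul, ENNReal.toReal_ofReal', ENNReal.toReal_ofReal']
    congr 1
    rcases le_total (f x) 0 with h0 | h0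
    · rw [max_eq_right h0, max_eq_left (by linarith)]; ring
    · rw [max_eq_left h0, max_eq_right (by linarith)]; ring
  · rw [VectorMeasure.Integrable, Measure.variation_toSignedMeasure,
      integrable_withDensity_iff_integrable_smul₀' (by fun_prop) (by simp)]
    exact i1
  · rw [VectorMeasure.Integrable, Measure.variation_toSignedMeasure,
      integrable_withDensity_iff_integrable_smul₀' (by fun_prop) (by simp)]
    exact i2

omit [NormedSpace ℝ F] in
lemma integrable_variation_dirac [MeasurableSingletonClass X] (φ : X → F) (x : X) (c : ℝ) :
    Integrable φ (VectorMeasure.dirac x c).variation := by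
  rw [VectorMeasure.variation_dirac]
  exact (integrable_dirac (by finiteness)).smul_measure (by finiteness)

omit [NormedSpace ℝ F] in
lemma integrable_variation_empirical [MeasurableSingletonClass X] (φ : X → F) {N : ℕ}
    (x : Fin N → X) : Integrable φ (empirical x).variation :=
  VectorMeasure.Integrable.smul_vectorMeasure (VectorMeasure.Integrable.finsetSum_vectorMeasure
    fun i _ => integrable_variation_dirac φ (x i) 1) _

lemma integral_empirical [MeasurableSingletonClass X] [CompleteSpace F] (φ : X → F) {N : ℕ}
    (x : Fin N → X) : ∫ᵛ z, φ z ∂<•(empirical x) = (1 / (N : ℝ)) • ∑ i, φ (x i) := by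
  rw [empirical, VectorMeasure.integral_smul_vectorMeasure,
    VectorMeasure.integral_finsetSum_vectorMeasure fun i _ => integrable_variation_dirac φ (x i) 1]
  congr 1
  refine Finset.sum_congr rfl fun i _ => ?_
  rw [VectorMeasure.integral_dirac]
  simp

end SignedMeasure

lemma fourierMeasure_empirical_sub_density {N : ℕ} (x : Fin N → Plane) {f : Plane → ℝ}
    (hf : Integrable f) (ζ : Plane) :
    fourierMeasure (empirical x - density f) ζ
      = (1 / (N : ℝ)) • ∑ i, chr (x i) ζ - ft (fun y => (f y : ℂ)) ζ := by
  have h1 : Integrable (fun y => f y • chr y ζ) := by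
    refine (integrable_chr_mul hf.ofReal ζ).congr (Eventually.of_forall fun y => ?_)
    simp [mul_comm]
  have hm : AEStronglyMeasurable (fun y => chr y ζ) (volume : Measure Plane) :=
    (by fun_prop : Continuous fun y => chr y ζ).aestronglyMeasurable
  have h2 := integral_withDensityᵥ hf h1 hm
  have h3 := VectorMeasure.integral_sub_vectorMeasure (B := (ContinuousLinearMap.lsmul ℝ ℝ).flip)
    (integrable_variation_empirical (fun y => chr y ζ) x)
    (integrable_variation_withDensityᵥ hf h1 hm)
  rw [fourierMeasure]
  refine h3.trans ?_
  rw [integral_empirical, h2, ft]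
  congr 2; ext y; simp [mul_comm]

lemma chr_toLp (x ξ : Plane) (ζ : Phase) :
    chr (WithLp.toLp 2 (x, ξ) : Phase) ζ = chr x ζ.fst * chr ξ ζ.snd := by
  simp only [chr, ← Complex.exp_add, WithLp.prod_inner_apply]
  congr 1; push_cast
  simp only [WithLp.fst, WithLp.snd]
  ring

lemma fourierMeasure_empirical_sub_monokinetic {N : ℕ} (Q P : Fin N → Plane) {ρ : Plane → ℝ}
    (hρ : Integrable ρ) {v : Plane → Plane} (hv : Continuous v) (ζ : Phase) :
    fourierMeasure (empirical (fun i => (WithLp.toLp 2 (Q i, P i) : Phase)) - monokinetic ρ v) ζ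
      = (1 / (N : ℝ)) • ∑ i, chr (Q i) ζ.fst * chr (P i) ζ.snd
        - ft (fun x => chr (v x) ζ.snd * ρ x) ζ.fst := by
  set Φ : Plane → Phase := fun x => WithLp.toLp 2 (x, v x) with hΦ
  have hΦc : Continuous Φ := by fun_prop
  have hcΦ : Continuous fun x => chr (Φ x) ζ := by fun_prop
  have h1 : Integrable (fun y => ρ y • chr (Φ y) ζ) :=
    hρ.smul_bdd 1 hcΦ.aestronglyMeasurable (Eventually.of_forall fun y => by simp)
  have hm := hcΦ.aestronglyMeasurable (μ := (volume : Measure Plane))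
  have h2 := integral_withDensityᵥ hρ h1 hm
  have hi := integrable_variation_withDensityᵥ hρ h1 hm
  have hm2 : ∀ ν : Measure Phase, AEStronglyMeasurable (fun y : Phase => chr y ζ) ν := fun ν =>
    (by fun_prop : Continuous fun y : Phase => chr y ζ).aestronglyMeasurable
  have hmap : ∫ᵛ y, chr y ζ ∂<•(monokinetic ρ v) = ∫ᵛ x, chr (Φ x) ζ ∂<•(density ρ) :=
    VectorMeasure.integral_map hΦc.measurable (hm2 _) hi
  have h3 := VectorMeasure.integral_sub_vectorMeasure (B := (ContinuousLinearMap.lsmul ℝ ℝ).flip)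
    (integrable_variation_empirical (fun y : Phase => chr y ζ)
      (fun i => (WithLp.toLp 2 (Q i, P i) : Phase)))
    (VectorMeasure.Integrable.map (φ := Φ) (f := fun y => chr y ζ) (hm2 _) hi)
  rw [fourierMeasure]
  refine h3.trans ?_
  rw [integral_empirical]
  congr 1
  · simp only [chr_toLp]
  · refine hmap.trans (h2.trans ?_)
    rw [ft]
    congr 1; ext y
    simp only [hΦ, chr_toLp, Complex.real_smul]; ring

/-! ### The off-diagonal energy -/

lemma coulomb_zero : coulomb 0 = 0 := by simp [coulomb]

lemma coulomb_neg (x : Plane) : coulomb (-x) = coulomb x := by simp [coulomb]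

lemma measurable_coulomb : Measurable coulomb := by unfold coulomb; fun_prop

/-- A product measure is determined by its values on rectangles, where this is the expansion of a
bilinear form into self, cross and point-point terms. -/
lemma prod_density_sub_empirical {f : Plane → ℝ} (hf : Integrable f) {N : ℕ} (x : Fin N → Plane) :
    (density f - empirical x).prod (density f - empirical x) (ContinuousLinearMap.mul ℝ ℝ)
      = ((volume : Measure (Plane × Plane)).withDensityᵥ (fun z => f z.1 * f z.2)
          - (1 / (N : ℝ)) • ∑ i, ((density f).map (fun y => (y, x i))
              + (density f).map (fun y => (x i, y))))
        + (1 / (N : ℝ) ^ 2) • ∑ i, ∑ j, VectorMeasure.dirac (x i, x j) (1 : ℝ) := by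
  refine VectorMeasure.prod_eq_of_forall_apply_prod fun s t hs ht => ?_
  have hff : Integrable (fun z : Plane × Plane => f z.1 * f z.2) := hf.mul_prod hf
  have hst := hs.prod ht
  have h1 : (volume : Measure (Plane × Plane)).withDensityᵥ (fun z => f z.1 * f z.2) (s ×ˢ t)
      = density f s * density f t := by
    rw [withDensityᵥ_apply hff hst, density, withDensityᵥ_apply hf hs, withDensityᵥ_apply hf ht,
      Measure.volume_eq_prod, setIntegral_prod_mul]
  have h2 : ∀ i, (density f).map (fun y => (y, x i)) (s ×ˢ t)
      = density f s * VectorMeasure.dirac (x i) (1 : ℝ) t := fun i => by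
    rw [VectorMeasure.map_apply _ (by fun_prop) hst]
    by_cases h : x i ∈ t
    · simp [h, ht]
    · simp [h]
  have h3 : ∀ i, (density f).map (fun y => (x i, y)) (s ×ˢ t)
      = VectorMeasure.dirac (x i) (1 : ℝ) s * density f t := fun i => by
    rw [VectorMeasure.map_apply _ (by fun_prop) hst]
    by_cases h : x i ∈ s
    · simp [h, hs]
    · simp [h]
  have h4 : ∀ i j, VectorMeasure.dirac (x i, x j) (1 : ℝ) (s ×ˢ t)
      = VectorMeasure.dirac (x i) (1 : ℝ) s * VectorMeasure.dirac (x j) (1 : ℝ) t := fun i j => by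
    by_cases h : x i ∈ s <;> by_cases h' : x j ∈ t <;> simp [h, h', hs, ht, hst]
  simp only [empirical, _root_.sub_apply, _root_.add_apply, _root_.smul_apply,
    FunLike.coe_sum, Finset.sum_apply, h1, h2, h3, h4, Finset.sum_add_distrib, ← Finset.mul_sum,
    ← Finset.sum_mul]
  simp only [ContinuousLinearMap.mul_apply', smul_eq_mul]
  ring

lemma offDiagEnergy_density_sub_empirical {f : Plane → ℝ} (hf : Integrable f)
    (hff : Integrable (fun z : Plane × Plane => f z.1 * f z.2 * coulomb (z.1 - z.2)))
    (hfx : ∀ y, Integrable (fun z => f z * coulomb (z - y))) {N : ℕ} (x : Fin N → Plane) :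
    offDiagEnergy (density f - empirical x)
      = (∫ z : Plane × Plane, f z.1 * f z.2 * coulomb (z.1 - z.2))
        - (2 / (N : ℝ)) * (∑ i, ∫ y, f y * coulomb (y - x i))
        + (1 / (N : ℝ) ^ 2) * ∑ i, ∑ j, coulomb (x i - x j) := by
  set g : Plane × Plane → ℝ := fun z => coulomb (z.1 - z.2) with hg
  have hgm : Measurable g := measurable_coulomb.comp (by fun_prop)
  have hprod : Integrable (fun z : Plane × Plane => f z.1 * f z.2) := hf.mul_prod hf
  -- Since `Real.log 0 = 0`, the kernel vanishes on the diagonal and removing the diagonal changes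
  -- nothing; the terms i = j below are zero for the same reason.
  have hind : (Set.diagonal Plane)ᶜ.indicator g = g := by
    ext z
    by_cases hz : z ∈ (Set.diagonal Plane)ᶜ
    · rw [Set.indicator_of_mem hz]
    · rw [Set.indicator_of_notMem hz]
      have : z.1 = z.2 := by simpa using hz
      simp [hg, this, coulomb_zero]
  have hfx' : ∀ i, Integrable (fun y => f y • g (y, x i)) := fun i => hfx (x i)
  have hfx'' : ∀ i, Integrable (fun y => f y • g (x i, y)) := fun i => by
    refine (hfx (x i)).congr (Eventually.of_forall fun y => ?_)
    simp only [hg, smul_eq_mul]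
    rw [← coulomb_neg, neg_sub]
  have m1 : ∀ i, AEStronglyMeasurable (fun y => g (y, x i)) (volume : Measure Plane) := fun i =>
    (hgm.comp (by fun_prop)).aestronglyMeasurable
  have m2 : ∀ i, AEStronglyMeasurable (fun y => g (x i, y)) (volume : Measure Plane) := fun i =>
    (hgm.comp (by fun_prop)).aestronglyMeasurable
  have i1 := integrable_variation_withDensityᵥ hprod (φ := g) hff hgm.aestronglyMeasurable
  have i2' : ∀ i, (density f).Integrable (fun y => g (y, x i)) := fun i =>
    integrable_variation_withDensityᵥ hf (hfx' i) (m1 i)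
  have i3' : ∀ i, (density f).Integrable (fun y => g (x i, y)) := fun i =>
    integrable_variation_withDensityᵥ hf (hfx'' i) (m2 i)
  have i2 : ∀ i, ((density f).map (fun y => (y, x i))).Integrable g := fun i =>
    VectorMeasure.Integrable.map hgm.aestronglyMeasurable (i2' i)
  have i3 : ∀ i, ((density f).map (fun y => (x i, y))).Integrable g := fun i =>
    VectorMeasure.Integrable.map hgm.aestronglyMeasurable (i3' i)
  have i23 : VectorMeasure.Integrable ((1 / (N : ℝ)) • ∑ i, ((density f).map (fun y => (y, x i))
      + (density f).map (fun y => (x i, y)))) g :=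
    VectorMeasure.Integrable.smul_vectorMeasure (VectorMeasure.Integrable.finsetSum_vectorMeasure
      fun i _ => (i2 i).add_vectorMeasure (i3 i)) _
  have i4 : VectorMeasure.Integrable ((1 / (N : ℝ) ^ 2) •
      ∑ i, ∑ j, VectorMeasure.dirac (x i, x j) (1 : ℝ)) g :=
    VectorMeasure.Integrable.smul_vectorMeasure (VectorMeasure.Integrable.finsetSum_vectorMeasure
      fun i _ => VectorMeasure.Integrable.finsetSum_vectorMeasure
        fun j _ => integrable_variation_dirac g _ 1) _
  rw [offDiagEnergy, ← VectorMeasure.integral_indicator measurableSet_diagonal.compl, hind,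
    prod_density_sub_empirical hf, VectorMeasure.integral_add_vectorMeasure
      (VectorMeasure.Integrable.sub_vectorMeasure i1 i23) i4,
    VectorMeasure.integral_sub_vectorMeasure i1 i23, VectorMeasure.integral_smul_vectorMeasure,
    VectorMeasure.integral_smul_vectorMeasure, VectorMeasure.integral_finsetSum_vectorMeasure
      fun i _ => (i2 i).add_vectorMeasure (i3 i), VectorMeasure.integral_finsetSum_vectorMeasure
      fun i _ => VectorMeasure.Integrable.finsetSum_vectorMeasure
        fun j _ => integrable_variation_dirac g _ 1]
  congr 1
  · congr 1
    · exact integral_withDensityᵥ hprod hff hgm.aestronglyMeasurable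
    · have : ∀ i, ∫ᵛ z, g z ∂<•((density f).map (fun y => (y, x i))
          + (density f).map (fun y => (x i, y))) = 2 * ∫ y, f y * coulomb (y - x i) := fun i => by
        rw [VectorMeasure.integral_add_vectorMeasure (i2 i) (i3 i),
          VectorMeasure.integral_map (by fun_prop) hgm.aestronglyMeasurable (i2' i),
          VectorMeasure.integral_map (by fun_prop) hgm.aestronglyMeasurable (i3' i)]
        have e1 : ∫ᵛ y, g (y, x i) ∂<•(density f) = ∫ y, f y * coulomb (y - x i) :=
          integral_withDensityᵥ hf (hfx' i) (m1 i)
        have e2 : ∫ᵛ y, g (x i, y) ∂<•(density f) = ∫ y, f y * coulomb (y - x i) := by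
          refine (integral_withDensityᵥ hf (hfx'' i) (m2 i)).trans ?_
          congr 1; ext y
          simp only [hg, smul_eq_mul]
          rw [← coulomb_neg, neg_sub]
        rw [e1, e2]; ring
      simp_rw [this]
      rw [← Finset.mul_sum, smul_eq_mul]; ring
  · rw [smul_eq_mul]
    congr 1
    refine Finset.sum_congr rfl fun i _ => ?_
    rw [VectorMeasure.integral_finsetSum_vectorMeasure
      fun j _ => integrable_variation_dirac g _ 1]
    refine Finset.sum_congr rfl fun j _ => ?_
    rw [VectorMeasure.integral_dirac]
    simp [hg]

/-! ### Integrability of the logarithmic kernel -/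

lemma IsDensity.integrable {f : Plane → ℝ} (hf : IsDensity f) : Integrable f :=
  memLp_one_iff_integrable.1 hf.memLp_one

lemma ae_norm_le_normLinf {F : Type*} [NormedAddCommGroup F] {f : Plane → F}
    (hf : MemLp f ∞ volume) : ∀ᵐ x, ‖f x‖ ≤ normLinf f := by
  filter_upwards [enorm_ae_le_eLpNormEssSup f volume] with x hx
  rw [← toReal_enorm]
  exact ENNReal.toReal_mono hf.2.ne (by simpa using hx)

lemma normLinf_nonneg {F : Type*} [NormedAddCommGroup F] (f : Plane → F) : 0 ≤ normLinf f :=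
  ENNReal.toReal_nonneg

lemma IsDensity.integrable_norm_mul {f : Plane → ℝ} (hf : IsDensity f) :
    Integrable (fun x => ‖x‖ * f x) := by
  obtain ⟨R, hR⟩ := hf.compact.isCompact.isBounded.exists_norm_le
  refine (hf.integrable.norm.const_mul R).mono'
    (continuous_norm.aestronglyMeasurable.mul hf.integrable.aestronglyMeasurable)
    (Eventually.of_forall fun x => ?_)
  by_cases hx : f x = 0
  · simp [hx]
  · rw [norm_mul, norm_norm]
    gcongr
    exact hR x (subset_tsupport _ hx)

/-- The singular part `1_{|x| < 1} ln |x|` of the logarithm. -/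
def logNear : Plane → ℝ := (Metric.ball 0 1).indicator fun x => Real.log ‖x‖

/-- On the unit disc |ln r| ≤ 1/r, and the exponent 1 is smaller than the dimension 2. -/
lemma integrable_logNear : Integrable logNear := by
  have hm : Measurable fun x : Plane => Real.log ‖x‖ := by fun_prop
  refine (integrable_indicator_iff Metric.isOpen_ball.measurableSet).2 ?_
  refine integrableOn_ball_of_norm_le_rpow (C := 1) (α := 1) (by simp) (by simp) ?_
    hm.aestronglyMeasurable
  filter_upwards [ae_restrict_mem Metric.isOpen_ball.measurableSet] with x hx
  have hx1 : ‖x‖ < 1 := by simpa using hx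
  rcases eq_or_ne x 0 with rfl | h0
  · simp
  have hpos : 0 < ‖x‖ := norm_pos_iff.2 h0
  rw [Real.norm_eq_abs, abs_of_nonpos (Real.log_nonpos hpos.le hx1.le), one_mul,
    Real.rpow_neg_one, ← Real.log_inv]
  exact (Real.log_le_sub_one_of_pos (by positivity)).trans (by linarith)

lemma abs_log_norm_le (x : Plane) : |Real.log ‖x‖| ≤ |logNear x| + ‖x‖ := by
  by_cases hx : x ∈ Metric.ball (0 : Plane) 1
  · rw [logNear, Set.indicator_of_mem hx]
    linarith [norm_nonneg x]
  · rw [logNear, Set.indicator_of_notMem hx]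
    have h1 : 1 ≤ ‖x‖ := by simpa using hx
    rw [abs_of_nonneg (Real.log_nonneg h1), abs_zero, zero_add]
    exact (Real.log_le_sub_one_of_pos (by positivity)).trans (by linarith)

lemma measurable_log_norm : Measurable fun x : Plane => Real.log ‖x‖ := by fun_prop

/-- Near the singularity f is bounded and the logarithm is integrable; far away the logarithm grows
at most linearly, and f has a finite first moment by compact support. -/
lemma IsDensity.integrable_mul_log {f : Plane → ℝ} (hf : IsDensity f) (y : Plane) :
    Integrable (fun x => f x * Real.log ‖x - y‖) := by
  have h1 : Integrable (fun x => normLinf f * |logNear (x - y)| + (|‖x‖ * f x| + ‖y‖ * |f x|)) :=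
    (((integrable_logNear.comp_sub_right y).abs).const_mul _).add
      (hf.integrable_norm_mul.abs.add (hf.integrable.abs.const_mul _))
  refine h1.mono' (hf.integrable.aestronglyMeasurable.mul
    (measurable_log_norm.comp (by fun_prop)).aestronglyMeasurable) ?_
  filter_upwards [ae_norm_le_normLinf hf.memLp_top] with x hx
  rw [norm_mul, Real.norm_eq_abs, Real.norm_eq_abs, abs_mul, abs_norm]
  rw [Real.norm_eq_abs] at hx
  have h2 := abs_log_norm_le (x - y)
  have h3 := norm_sub_le x y
  calc |f x| * |Real.log ‖x - y‖| ≤ |f x| * (|logNear (x - y)| + (‖x‖ + ‖y‖)) := by gcongr; linarith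
    _ = |f x| * |logNear (x - y)| + (‖x‖ * |f x| + ‖y‖ * |f x|) := by ring
    _ ≤ _ := by gcongr

/-- Same splitting; the singular part is now dominated by a convolution integrand of two L¹
functions. -/
lemma IsDensity.integrable_mul_mul_log {f : Plane → ℝ} (hf : IsDensity f) :
    Integrable (fun z : Plane × Plane => f z.1 * f z.2 * Real.log ‖z.1 - z.2‖) := by
  have hc : Integrable (fun z : Plane × Plane => f z.2 * logNear (z.1 - z.2)) :=
    hf.integrable.convolution_integrand (ContinuousLinearMap.mul ℝ ℝ) integrable_logNear
  have h1 : Integrable (fun z : Plane × Plane => normLinf f * |f z.2 * logNear (z.1 - z.2)|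
      + (|(‖z.1‖ * f z.1) * f z.2| + |f z.1 * (‖z.2‖ * f z.2)|)) :=
    (hc.abs.const_mul _).add ((hf.integrable_norm_mul.mul_prod hf.integrable).abs.add
      (hf.integrable.mul_prod hf.integrable_norm_mul).abs)
  refine h1.mono' ((hf.integrable.mul_prod hf.integrable).aestronglyMeasurable.mul
    (measurable_log_norm.comp (by fun_prop)).aestronglyMeasurable) ?_
  have hb : ∀ᵐ z : Plane × Plane, ‖f z.1‖ ≤ normLinf f :=
    Measure.quasiMeasurePreserving_fst.ae (ae_norm_le_normLinf hf.memLp_top)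
  filter_upwards [hb] with z hz
  simp only [norm_mul, Real.norm_eq_abs, abs_mul, abs_norm]
  rw [Real.norm_eq_abs] at hz
  have h2 := abs_log_norm_le (z.1 - z.2)
  have h3 := norm_sub_le z.1 z.2
  calc |f z.1| * |f z.2| * |Real.log ‖z.1 - z.2‖|
      ≤ |f z.1| * |f z.2| * (|logNear (z.1 - z.2)| + (‖z.1‖ + ‖z.2‖)) := by gcongr; linarith
    _ = |f z.1| * (|f z.2| * |logNear (z.1 - z.2)|)
        + (‖z.1‖ * |f z.1| * |f z.2| + |f z.1| * (‖z.2‖ * |f z.2|)) := by ring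
    _ ≤ _ := by gcongr

/-! ### The logarithm as a superposition of Gaussians -/

/-- Factor out the larger exponential and use 1 - exp(-s) ≤ s, which cancels the singularity t⁻¹ at
the origin. -/
lemma norm_exp_sub_exp_le (a : ℝ) {t : ℝ} (ht : 0 < t) :
    ‖t⁻¹ * (Real.exp (-(a * t)) - Real.exp (-(1 * t)))‖
      ≤ |a - 1| * Real.exp (-(min a 1 * t)) := by
  rw [norm_mul, norm_inv, Real.norm_of_nonneg ht.le, Real.norm_eq_abs, inv_mul_le_iff₀ ht]
  rcases le_total a 1 with h | h
  · have e : Real.exp (-(1 * t)) = Real.exp (-(a * t)) * Real.exp (-((1 - a) * t)) := by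
      rw [← Real.exp_add]; congr 1; ring
    have h1 := Real.add_one_le_exp (-((1 - a) * t))
    have h2 : Real.exp (-((1 - a) * t)) ≤ 1 := Real.exp_le_one_iff.2 (by nlinarith)
    have h3 := Real.exp_pos (-(a * t))
    rw [min_eq_left h, abs_of_nonpos (by linarith : a - 1 ≤ 0), e, abs_of_nonneg (by nlinarith)]
    nlinarith
  · have e : Real.exp (-(a * t)) = Real.exp (-(1 * t)) * Real.exp (-((a - 1) * t)) := by
      rw [← Real.exp_add]; congr 1; ring
    have h1 := Real.add_one_le_exp (-((a - 1) * t))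
    have h2 : Real.exp (-((a - 1) * t)) ≤ 1 := Real.exp_le_one_iff.2 (by nlinarith)
    have h3 := Real.exp_pos (-(1 * t))
    rw [min_eq_right h, abs_of_nonneg (by linarith : 0 ≤ a - 1), e, abs_of_nonpos (by nlinarith)]
    nlinarith

lemma integrableOn_exp_sub_exp {a : ℝ} (ha : 0 < a) :
    IntegrableOn (fun t => t⁻¹ * (Real.exp (-(a * t)) - Real.exp (-(1 * t)))) (Set.Ioi 0) := by
  have h := (exp_neg_integrableOn_Ioi 0 (lt_min ha one_pos)).const_mul |a - 1|
  refine Integrable.mono' h ?_ ?_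
  · exact (by fun_prop : Measurable _).aestronglyMeasurable
  · filter_upwards [ae_restrict_mem measurableSet_Ioi] with t ht
    simpa only [neg_mul] using norm_exp_sub_exp_le a ht

/-- Frullani's integral for exp(-t), with limits 1 at 0 and 0 at infinity. -/
lemma integral_exp_sub_exp {a : ℝ} (ha : 0 < a) :
    ∫ t in Set.Ioi 0, t⁻¹ * (Real.exp (-(a * t)) - Real.exp (-(1 * t))) = -Real.log a := by
  have h := Frullani.integral_Ioi_eq (f := fun t : ℝ => Real.exp (-t)) (L := 1) (R := 0)
    ((by fun_prop : Continuous fun t : ℝ => Real.exp (-t)).locallyIntegrable.locallyIntegrableOn _)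
    ha one_pos ?_ ?_ (integrableOn_exp_sub_exp ha)
  · simpa [Real.log_inv] using h
  · have : Tendsto (fun t : ℝ => Real.exp (-t)) (𝓝 0) (𝓝 (Real.exp (-0))) :=
      (by fun_prop : Continuous fun t : ℝ => Real.exp (-t)).tendsto 0
    simpa using this.mono_left nhdsWithin_le_nhds
  · exact Real.tendsto_exp_neg_atTop_nhds_zero

/-- The integrand has constant sign, so its L¹ norm is exactly |ln a|. Hence integrability of h ln r
is all that Fubini will require. -/
lemma integral_norm_exp_sub_exp {a : ℝ} (ha : 0 < a) :
    ∫ t in Set.Ioi 0, ‖t⁻¹ * (Real.exp (-(a * t)) - Real.exp (-(1 * t)))‖ = |Real.log a| := by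
  rcases le_total a 1 with h | h
  · rw [abs_of_nonpos (Real.log_nonpos ha.le h), ← integral_exp_sub_exp ha]
    refine setIntegral_congr_fun measurableSet_Ioi fun t (ht : 0 < t) => Real.norm_of_nonneg ?_
    refine mul_nonneg (by positivity) (sub_nonneg.2 (Real.exp_le_exp.2 ?_))
    nlinarith
  · rw [abs_of_nonneg (Real.log_nonneg h), ← neg_neg (Real.log a), ← integral_exp_sub_exp ha,
      ← integral_neg]
    refine setIntegral_congr_fun measurableSet_Ioi fun t (ht : 0 < t) => Real.norm_of_nonpos ?_
    refine mul_nonpos_of_nonneg_of_nonpos (by positivity) (sub_nonpos.2 (Real.exp_le_exp.2 ?_))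
    nlinarith

/-- Integrals of `-ln r` as superpositions of integrals of `exp (-t r) - exp (-t)`. -/
lemma integral_mul_neg_log {X : Type*} [MeasurableSpace X] {ν : Measure X} [SFinite ν] {r h : X → ℝ}
    (hr : Measurable r) (hr0 : ∀ᵐ x ∂ν, 0 < r x) (hh : AEStronglyMeasurable h ν)
    (hint : Integrable (fun x => h x * Real.log (r x)) ν) :
    Integrable (fun t => ∫ x, h x * (t⁻¹ * (Real.exp (-(r x * t)) - Real.exp (-(1 * t)))) ∂ν)
        (volume.restrict (Set.Ioi 0)) ∧
      ∫ t in Set.Ioi 0, ∫ x, h x * (t⁻¹ * (Real.exp (-(r x * t)) - Real.exp (-(1 * t)))) ∂ν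
        = ∫ x, h x * -Real.log (r x) ∂ν := by
  set K : X → ℝ → ℝ := fun x t => h x * (t⁻¹ * (Real.exp (-(r x * t)) - Real.exp (-(1 * t)))) with hK
  have hm : AEStronglyMeasurable (Function.uncurry K) (ν.prod (volume.restrict (Set.Ioi 0))) := by
    refine (hh.comp_fst).mul (Measurable.aestronglyMeasurable ?_)
    fun_prop
  have hI : Integrable (Function.uncurry K) (ν.prod (volume.restrict (Set.Ioi 0))) := by
    refine (integrable_prod_iff hm).2 ⟨?_, ?_⟩
    · filter_upwards [hr0] with x hx
      have : Integrable (K x) (volume.restrict (Set.Ioi 0)) :=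
        (integrableOn_exp_sub_exp hx).const_mul (h x)
      exact this
    · refine hint.norm.congr ?_
      filter_upwards [hr0] with x hx
      simp only [Function.uncurry, hK, norm_mul _ (_ * _)]
      rw [integral_const_mul, integral_norm_exp_sub_exp hx, norm_mul, Real.norm_eq_abs (Real.log _)]
  refine ⟨hI.integral_prod_right, ?_⟩
  rw [← integral_integral_swap hI]
  refine integral_congr_ae ?_
  filter_upwards [hr0] with x hx
  simp only [hK]
  rw [integral_const_mul, integral_exp_sub_exp hx]

/-! ### Gaussian energies in Fourier variables -/

/-- The Fourier weight `(4πt)⁻¹ exp (-|ζ|² / 4t)` of the Gaussian `exp (-t |x|²)`. -/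
def gaussWeight (t : ℝ) (ζ : Plane) : ℝ := (4 * Real.pi * t)⁻¹ * Real.exp (-(‖ζ‖ ^ 2 / (4 * t)))

lemma gaussWeight_nonneg {t : ℝ} (ht : 0 < t) (ζ : Plane) : 0 ≤ gaussWeight t ζ := by
  have := Real.pi_pos
  unfold gaussWeight; positivity

lemma continuous_gaussWeight (t : ℝ) : Continuous (gaussWeight t) := by
  unfold gaussWeight; fun_prop

lemma integrable_exp_neg_mul_norm_sq {b : ℝ} (hb : 0 < b) :
    Integrable fun x : Plane => Real.exp (-b * ‖x‖ ^ 2) := by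
  have h := GaussianFourier.integrable_cexp_neg_mul_sq_norm_add (V := Plane) (b := (b : ℂ))
    (by simpa using hb) 0 0
  refine h.norm.congr (Eventually.of_forall fun x => ?_)
  simp only [Complex.norm_exp]
  congr 1
  norm_cast
  simp

lemma integral_exp_neg_mul_norm_sq {b : ℝ} (hb : 0 < b) :
    ∫ x : Plane, Real.exp (-b * ‖x‖ ^ 2) = Real.pi / b := by
  rw [GaussianFourier.integral_rexp_neg_mul_sq_norm hb]
  simp

lemma integrable_gaussWeight {t : ℝ} (ht : 0 < t) : Integrable (gaussWeight t) := by
  refine ((integrable_exp_neg_mul_norm_sq (b := (4 * t)⁻¹) (by positivity)).const_mul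
    (4 * Real.pi * t)⁻¹).congr (Eventually.of_forall fun x => ?_)
  simp only [gaussWeight]
  congr 2; field_simp

/-- A Gaussian is the transform of a positive Gaussian weight; this positivity is the source of the
sign of the Gaussian energies. -/
lemma ofReal_exp_neg_norm_sq_mul {t : ℝ} (ht : 0 < t) (x : Plane) :
    ((Real.exp (-(‖x‖ ^ 2 * t)) : ℝ) : ℂ) = ∫ ζ, (gaussWeight t ζ : ℂ) * chr x ζ := by
  have hpi : (Real.pi : ℂ) ≠ 0 := by exact_mod_cast Real.pi_ne_zero
  have htc : (t : ℂ) ≠ 0 := by exact_mod_cast ht.ne'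
  have h := GaussianFourier.integral_cexp_neg_mul_sq_norm_add (V := Plane)
    (b := (((4 * t)⁻¹ : ℝ) : ℂ)) (by simpa using ht) (-Complex.I) x
  have e : ∀ ζ : Plane, (gaussWeight t ζ : ℂ) * chr x ζ = (4 * Real.pi * t : ℂ)⁻¹ *
      Complex.exp (-(((4 * t)⁻¹ : ℝ) : ℂ) * ‖ζ‖ ^ 2 + -Complex.I * (inner ℝ x ζ : ℝ)) := fun ζ => by
    rw [gaussWeight, chr, Complex.exp_add]
    push_cast
    rw [mul_assoc]
    congr 3
    · field_simp
    · ring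
  simp_rw [e]
  rw [integral_const_mul, h]
  simp only [finrank_euclideanSpace, Fintype.card_fin]
  push_cast
  rw [div_self two_ne_zero, Complex.cpow_one, ← mul_assoc]
  have e2 : (4 * (Real.pi : ℂ) * (t : ℂ))⁻¹ * ((Real.pi : ℂ) / (4 * (t : ℂ))⁻¹) = 1 := by
    field_simp
  rw [e2, one_mul]
  congr 1
  rw [neg_sq, Complex.I_sq]
  field_simp

/-- The Gaussian energy of a density along a map, in Fourier variables. -/
lemma ofReal_integral_mul_exp {X : Type*} [MeasurableSpace X] {ν : Measure X} [SFinite ν]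
    {H : X → ℝ} {r : X → Plane} (hH : Integrable H ν) (hr : Measurable r) {t : ℝ} (ht : 0 < t) :
    ((∫ z, H z * Real.exp (-(‖r z‖ ^ 2 * t)) ∂ν : ℝ) : ℂ)
      = ∫ ζ, (gaussWeight t ζ : ℂ) * (∫ z, chr (r z) ζ * H z ∂ν) := by
  have hI : Integrable (Function.uncurry fun (z : X) (ζ : Plane) =>
      chr (r z) ζ * ((H z : ℂ) * (gaussWeight t ζ : ℂ))) (ν.prod volume) := by
    refine (hH.ofReal.mul_prod (integrable_gaussWeight ht).ofReal).bdd_mul (c := 1) ?_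
      (Eventually.of_forall fun p => by simp)
    exact (continuous_chr.measurable.comp
      ((hr.comp measurable_fst).prodMk measurable_snd)).aestronglyMeasurable
  calc _ = ∫ z, (H z : ℂ) * (∫ ζ, (gaussWeight t ζ : ℂ) * chr (r z) ζ) ∂ν := by
        rw [← integral_complex_ofReal]
        congr 1; ext z
        rw [← ofReal_exp_neg_norm_sq_mul ht]; push_cast; rfl
    _ = ∫ z, (∫ ζ, chr (r z) ζ * ((H z : ℂ) * (gaussWeight t ζ : ℂ))) ∂ν := by
        congr 1; ext z
        rw [← integral_const_mul]
        congr 1; ext ζ; ring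
    _ = ∫ ζ, (∫ z, chr (r z) ζ * ((H z : ℂ) * (gaussWeight t ζ : ℂ)) ∂ν) :=
        integral_integral_swap hI
    _ = _ := by
        congr 1; ext ζ
        rw [← integral_const_mul]
        congr 1; ext z; ring

/-- The Fourier transform of an empirical measure. -/
def empFt {N : ℕ} (x : Fin N → Plane) (ζ : Plane) : ℂ := (1 / (N : ℂ)) * ∑ i, chr (x i) ζ

@[fun_prop] lemma continuous_empFt {N : ℕ} (x : Fin N → Plane) : Continuous (empFt x) := by
  unfold empFt; fun_prop

lemma norm_empFt_le {N : ℕ} (x : Fin N → Plane) (ζ : Plane) : ‖empFt x ζ‖ ≤ 1 := by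
  rw [empFt, norm_mul]
  have h : ‖∑ i, chr (x i) ζ‖ ≤ N := by
    refine (norm_sum_le _ _).trans ?_
    simp
  have h1 : ‖(1 / (N : ℂ))‖ = 1 / (N : ℝ) := by simp
  rw [h1]
  calc 1 / (N : ℝ) * ‖∑ i, chr (x i) ζ‖ ≤ 1 / (N : ℝ) * N := by gcongr
    _ ≤ 1 := by
      rcases eq_or_ne (N : ℝ) 0 with h0 | h0
      · simp [h0]
      · rw [one_div_mul_cancel h0]

/-- The Fourier transform of a real function. -/
def rft (f : Plane → ℝ) : Plane → ℂ := ft fun y => (f y : ℂ)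

lemma conj_rft (f : Plane → ℝ) (ζ : Plane) :
    (starRingEnd ℂ) (rft f ζ) = ∫ y, chr (-y) ζ * f y := by
  rw [rft, ft, ← integral_conj]
  congr 1; ext y
  rw [map_mul, chr_neg_left, Complex.conj_ofReal]

/-- `∬ exp (-t |x - y|²) f(x) f(y) dx dy`. -/
def selfGauss (f : Plane → ℝ) (t : ℝ) : ℝ :=
  ∫ z : Plane × Plane, (f z.1 * f z.2) * Real.exp (-(‖z.1 - z.2‖ ^ 2 * t))

/-- `∫ exp (-t |x - y|²) f(x) dx`. -/
def pointGauss (f : Plane → ℝ) (y : Plane) (t : ℝ) : ℝ :=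
  ∫ z, f z * Real.exp (-(‖z - y‖ ^ 2 * t))

/-- The Gaussian energy of `f dx - (1 / N) ∑ᵢ δ_{xᵢ}`, including the diagonal. -/
def fullGauss (f : Plane → ℝ) {N : ℕ} (x : Fin N → Plane) (t : ℝ) : ℝ :=
  selfGauss f t - (2 / (N : ℝ)) * (∑ i, pointGauss f (x i) t)
    + (1 / (N : ℝ) ^ 2) * ∑ i, ∑ j, Real.exp (-(‖x i - x j‖ ^ 2 * t))

lemma ofReal_selfGauss {f : Plane → ℝ} (hf : Integrable f) {t : ℝ} (ht : 0 < t) :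
    ((selfGauss f t : ℝ) : ℂ)
      = ∫ ζ, (gaussWeight t ζ : ℂ) * (rft f ζ * (starRingEnd ℂ) (rft f ζ)) := by
  rw [selfGauss, Measure.volume_eq_prod, ofReal_integral_mul_exp (hf.mul_prod hf) (by fun_prop) ht]
  congr 1; ext ζ; congr 1
  rw [conj_rft, rft, ft, ← integral_prod_mul]
  congr 1; ext z
  rw [sub_eq_add_neg, chr_add_left]; push_cast; ring

lemma ofReal_pointGauss {f : Plane → ℝ} (hf : Integrable f) (y : Plane) {t : ℝ} (ht : 0 < t) :
    ((pointGauss f y t : ℝ) : ℂ)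
      = ∫ ζ, (gaussWeight t ζ : ℂ) * (rft f ζ * (starRingEnd ℂ) (chr y ζ)) := by
  rw [pointGauss, ofReal_integral_mul_exp hf (by fun_prop) ht]
  congr 1; ext ζ; congr 1
  rw [rft, ft, ← integral_mul_const]
  congr 1; ext z
  rw [sub_eq_add_neg, chr_add_left, chr_neg_left]; ring

lemma ofReal_pointGauss' {f : Plane → ℝ} (hf : Integrable f) (y : Plane) {t : ℝ} (ht : 0 < t) :
    ((pointGauss f y t : ℝ) : ℂ)
      = ∫ ζ, (gaussWeight t ζ : ℂ) * (chr y ζ * (starRingEnd ℂ) (rft f ζ)) := by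
  rw [← Complex.conj_ofReal, ofReal_pointGauss hf y ht, ← integral_conj]
  congr 1; ext ζ
  simp only [map_mul, Complex.conj_ofReal, Complex.conj_conj]; ring

lemma selfGauss_eq {f : Plane → ℝ} (hf : Integrable f) {t : ℝ} (ht : 0 < t) :
    selfGauss f t = ∫ ζ, gaussWeight t ζ * ‖rft f ζ‖ ^ 2 := by
  rw [← Complex.ofReal_inj, ofReal_selfGauss hf ht, ← integral_complex_ofReal]
  congr 1; ext ζ
  rw [Complex.mul_conj']; push_cast; rfl

/-- With the diagonal included, the point-point sum is a complete square in Fourier variables, so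
the whole energy is an integral of |f̂ - μ̂_N|² against a positive weight. -/
lemma fullGauss_eq {f : Plane → ℝ} (hf : Integrable f) {N : ℕ} (x : Fin N → Plane) {t : ℝ}
    (ht : 0 < t) :
    fullGauss f x t = ∫ ζ, gaussWeight t ζ * ‖rft f ζ - empFt x ζ‖ ^ 2 := by
  have hF : Continuous (rft f) := continuous_ft hf.ofReal
  obtain ⟨B, hB⟩ : ∃ B : ℝ, ∀ ζ, ‖rft f ζ‖ ≤ B := ⟨_, norm_ft_le _⟩
  have hB0 : 0 ≤ B := (norm_nonneg _).trans (hB 0)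
  have hint : ∀ u : Plane → ℂ, Continuous u → ∀ D : ℝ, (∀ ζ, ‖u ζ‖ ≤ D) →
      Integrable fun ζ => (gaussWeight t ζ : ℂ) * u ζ := fun u hu D hD =>
    (integrable_gaussWeight ht).ofReal.mul_bdd (c := D) hu.aestronglyMeasurable
      (Eventually.of_forall hD)
  have i1 := hint (fun ζ => rft f ζ * (starRingEnd ℂ) (rft f ζ)) (by fun_prop) (B * B) fun ζ => by
    rw [norm_mul, RCLike.norm_conj]; gcongr <;> exact hB ζ
  have i2 := fun i => hint (fun ζ => rft f ζ * (starRingEnd ℂ) (chr (x i) ζ)) (by fun_prop) B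
    fun ζ => by rw [norm_mul, RCLike.norm_conj, norm_chr, mul_one]; exact hB ζ
  have i3 := fun i => hint (fun ζ => chr (x i) ζ * (starRingEnd ℂ) (rft f ζ)) (by fun_prop) B
    fun ζ => by rw [norm_mul, RCLike.norm_conj, norm_chr, one_mul]; exact hB ζ
  have i4 := fun i j => hint (fun ζ => chr (x i - x j) ζ) (by fun_prop) 1 fun ζ => by simp
  have e4 := fun i j => ofReal_exp_neg_norm_sq_mul ht (x i - x j)
  rw [← Complex.ofReal_inj, fullGauss, ← integral_complex_ofReal]
  -- The factor 2 of the cross term is split into two halves, one written with each of the two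
  -- conjugate cross products of the expanded square.
  have hsum : ((selfGauss f t - (2 / (N : ℝ)) * (∑ i, pointGauss f (x i) t)
      + (1 / (N : ℝ) ^ 2) * ∑ i, ∑ j, Real.exp (-(‖x i - x j‖ ^ 2 * t)) : ℝ) : ℂ)
      = (selfGauss f t : ℂ) - (1 / (N : ℂ)) * (∑ i, (pointGauss f (x i) t : ℂ))
        - (1 / (N : ℂ)) * (∑ i, (pointGauss f (x i) t : ℂ))
        + (1 / (N : ℂ) ^ 2) * ∑ i, ∑ j, ((Real.exp (-(‖x i - x j‖ ^ 2 * t)) : ℝ) : ℂ) := by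
    push_cast; ring
  rw [hsum, ofReal_selfGauss hf ht]
  nth_rewrite 1 [Finset.sum_congr rfl fun i _ => ofReal_pointGauss hf (x i) ht]
  rw [Finset.sum_congr rfl fun i _ => ofReal_pointGauss' hf (x i) ht,
    Finset.sum_congr rfl fun i _ => Finset.sum_congr rfl fun j _ => e4 i j,
    ← integral_finsetSum _ fun i _ => i2 i, ← integral_finsetSum _ fun i _ => i3 i,
    Finset.sum_congr rfl fun i _ => (integral_finsetSum _ fun j _ => i4 i j).symm,
    ← integral_finsetSum _ fun i _ => integrable_finsetSum _ fun j _ => i4 i j,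
    ← integral_const_mul, ← integral_const_mul, ← integral_const_mul, ← integral_sub, ← integral_sub,
    ← integral_add]
  · congr 1; ext ζ
    have h1 : ((‖rft f ζ - empFt x ζ‖ ^ 2 : ℝ) : ℂ)
        = (rft f ζ - empFt x ζ) * (starRingEnd ℂ) (rft f ζ - empFt x ζ) := by
      rw [Complex.mul_conj']; push_cast; rfl
    have h2 : (starRingEnd ℂ) (empFt x ζ) = (1 / (N : ℂ)) * ∑ i, (starRingEnd ℂ) (chr (x i) ζ) := by
      rw [empFt, map_mul, map_sum]; simp
    have h3 : ∀ i j, chr (x i - x j) ζ = chr (x i) ζ * (starRingEnd ℂ) (chr (x j) ζ) := fun i j => by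
      rw [sub_eq_add_neg, chr_add_left, chr_neg_left]
    rw [Complex.ofReal_mul, h1, RingHom.map_sub, h2, empFt]
    simp only [h3, ← Finset.mul_sum, ← Finset.sum_mul]
    ring
  · exact (i1.sub ((integrable_finsetSum _ fun i _ => i2 i).const_mul _)).sub
      ((integrable_finsetSum _ fun i _ => i3 i).const_mul _)
  · exact (integrable_finsetSum _ fun i _ => integrable_finsetSum _ fun j _ => i4 i j).const_mul _
  · exact i1.sub ((integrable_finsetSum _ fun i _ => i2 i).const_mul _)
  · exact (integrable_finsetSum _ fun i _ => i3 i).const_mul _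
  · exact i1
  · exact (integrable_finsetSum _ fun i _ => i2 i).const_mul _

/-! ### The Coulomb energy as a superposition of Gaussian energies -/

lemma coulomb_eq_neg_log_sq (z : Plane) :
    4 * Real.pi * coulomb z = -Real.log (‖z‖ ^ 2) := by
  have := Real.pi_ne_zero
  rw [coulomb, Real.log_pow]; push_cast; field_simp; ring

lemma ae_ne_plane (y : Plane) : ∀ᵐ x : Plane, x ≠ y :=
  Measure.ae_ne volume y

lemma ae_fst_ne_snd : ∀ᵐ z : Plane × Plane, z.1 ≠ z.2 := by
  rw [Measure.volume_eq_prod]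
  refine (Measure.ae_prod_iff_ae_ae ?_).2 (Eventually.of_forall fun x => ?_)
  · exact (measurableSet_eq_fun measurable_fst measurable_snd).compl
  · filter_upwards [ae_ne_plane x] with y hy using hy.symm

/-- The superposition formula with r = |z₁ - z₂|²; unit mass turns the subtracted term into exp(-t).
-/
lemma selfGauss_log {f : Plane → ℝ} (hf : IsDensity f) (h1 : ∫ x, f x = 1) :
    IntegrableOn (fun t => t⁻¹ * (selfGauss f t - Real.exp (-t))) (Set.Ioi 0) ∧
      ∫ t in Set.Ioi 0, t⁻¹ * (selfGauss f t - Real.exp (-t))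
        = 4 * Real.pi * ∫ z : Plane × Plane, f z.1 * f z.2 * coulomb (z.1 - z.2) := by
  have hff : Integrable (fun z : Plane × Plane => f z.1 * f z.2) :=
    hf.integrable.mul_prod hf.integrable
  have hr0 : ∀ᵐ z : Plane × Plane, 0 < ‖z.1 - z.2‖ ^ 2 := by
    filter_upwards [ae_fst_ne_snd] with z hz
    have := norm_pos_iff.2 (sub_ne_zero.2 hz)
    positivity
  have key := integral_mul_neg_log (ν := (volume : Measure (Plane × Plane)))
    (r := fun z => ‖z.1 - z.2‖ ^ 2) (h := fun z => f z.1 * f z.2) (by fun_prop) hr0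
    hff.aestronglyMeasurable ((hf.integrable_mul_mul_log.const_mul 2).congr
      (Eventually.of_forall fun z => by simp only [Real.log_pow]; push_cast; ring))
  have h11 : ∫ z : Plane × Plane, f z.1 * f z.2 = 1 := by
    rw [Measure.volume_eq_prod, integral_prod_mul, h1, one_mul]
  have e : ∀ t ∈ Set.Ioi (0 : ℝ), (∫ z : Plane × Plane, f z.1 * f z.2 *
      (t⁻¹ * (Real.exp (-(‖z.1 - z.2‖ ^ 2 * t)) - Real.exp (-(1 * t)))))
      = t⁻¹ * (selfGauss f t - Real.exp (-t)) := by
    intro t ht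
    have hi : Integrable (fun z : Plane × Plane =>
        f z.1 * f z.2 * Real.exp (-(‖z.1 - z.2‖ ^ 2 * t))) :=
      hff.mul_bdd (c := 1) (by fun_prop) (Eventually.of_forall fun z => by
        have : 0 ≤ ‖z.1 - z.2‖ ^ 2 * t := mul_nonneg (by positivity) (le_of_lt ht)
        simpa using this)
    have : ∀ z : Plane × Plane, f z.1 * f z.2 *
      (t⁻¹ * (Real.exp (-(‖z.1 - z.2‖ ^ 2 * t)) - Real.exp (-(1 * t))))
      = t⁻¹ * (f z.1 * f z.2 * Real.exp (-(‖z.1 - z.2‖ ^ 2 * t)) - f z.1 * f z.2 * Real.exp (-t)) :=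
        fun z => by rw [one_mul]; ring
    simp_rw [this]
    rw [integral_const_mul, integral_sub hi (hff.mul_const _), integral_mul_const, h11, one_mul,
      selfGauss]
  refine ⟨(key.1.congr ?_), ?_⟩
  · filter_upwards [ae_restrict_mem measurableSet_Ioi] with t ht using e t ht
  · rw [← setIntegral_congr_fun measurableSet_Ioi e, key.2, ← integral_const_mul]
    congr 1; ext z
    rw [← coulomb_eq_neg_log_sq]; ring

lemma pointGauss_log {f : Plane → ℝ} (hf : IsDensity f) (h1 : ∫ x, f x = 1) (y : Plane) :
    IntegrableOn (fun t => t⁻¹ * (pointGauss f y t - Real.exp (-t))) (Set.Ioi 0) ∧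
      ∫ t in Set.Ioi 0, t⁻¹ * (pointGauss f y t - Real.exp (-t))
        = 4 * Real.pi * ∫ z, f z * coulomb (z - y) := by
  have hr0 : ∀ᵐ z : Plane, 0 < ‖z - y‖ ^ 2 := by
    filter_upwards [ae_ne_plane y] with z hz
    have := norm_pos_iff.2 (sub_ne_zero.2 hz)
    positivity
  have key := integral_mul_neg_log (ν := (volume : Measure Plane))
    (r := fun z => ‖z - y‖ ^ 2) (h := f) (by fun_prop) hr0
    hf.integrable.aestronglyMeasurable (((hf.integrable_mul_log y).const_mul 2).congr
      (Eventually.of_forall fun z => by simp only [Real.log_pow]; push_cast; ring))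
  have e : ∀ t ∈ Set.Ioi (0 : ℝ), (∫ z, f z *
      (t⁻¹ * (Real.exp (-(‖z - y‖ ^ 2 * t)) - Real.exp (-(1 * t)))))
      = t⁻¹ * (pointGauss f y t - Real.exp (-t)) := by
    intro t ht
    have hi : Integrable (fun z => f z * Real.exp (-(‖z - y‖ ^ 2 * t))) :=
      hf.integrable.mul_bdd (c := 1) (by fun_prop) (Eventually.of_forall fun z => by
        have : 0 ≤ ‖z - y‖ ^ 2 * t := mul_nonneg (by positivity) (le_of_lt ht)
        simpa using this)
    have : ∀ z, f z * (t⁻¹ * (Real.exp (-(‖z - y‖ ^ 2 * t)) - Real.exp (-(1 * t))))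
      = t⁻¹ * (f z * Real.exp (-(‖z - y‖ ^ 2 * t)) - f z * Real.exp (-t)) :=
        fun z => by rw [one_mul]; ring
    simp_rw [this]
    rw [integral_const_mul, integral_sub hi (hf.integrable.mul_const _), integral_mul_const, h1,
      one_mul, pointGauss]
  refine ⟨(key.1.congr ?_), ?_⟩
  · filter_upwards [ae_restrict_mem measurableSet_Ioi] with t ht using e t ht
  · rw [← setIntegral_congr_fun measurableSet_Ioi e, key.2, ← integral_const_mul]
    congr 1; ext z
    rw [← coulomb_eq_neg_log_sq]; ring

lemma exp_norm_sq_log {y : Plane} (hy : y ≠ 0) :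
    IntegrableOn (fun t => t⁻¹ * (Real.exp (-(‖y‖ ^ 2 * t)) - Real.exp (-t))) (Set.Ioi 0) ∧
      ∫ t in Set.Ioi 0, t⁻¹ * (Real.exp (-(‖y‖ ^ 2 * t)) - Real.exp (-t))
        = 4 * Real.pi * coulomb y := by
  have h0 : 0 < ‖y‖ ^ 2 := by have := norm_pos_iff.2 hy; positivity
  -- The pointwise identity is the general one for a Dirac mass.
  have key := integral_mul_neg_log (ν := Measure.dirac y)
    (r := fun z => ‖z‖ ^ 2) (h := fun _ => 1) (by fun_prop)
    (by rw [ae_dirac_eq]; exact h0) aestronglyMeasurable_const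
    (integrable_dirac (by exact enorm_lt_top))
  simp only [integral_dirac, one_mul] at key
  rw [coulomb_eq_neg_log_sq]
  exact key

/-- The Coulomb energy off the diagonal is the integral of the Gaussian energies, with the diagonal
contribution `1 / N` removed. -/
lemma offDiagEnergy_eq_integral {f : Plane → ℝ} (hf : IsDensity f) (h1 : ∫ x, f x = 1) {N : ℕ}
    (hN : 1 ≤ N) {x : Fin N → Plane} (hx : Function.Injective x) :
    IntegrableOn (fun t => t⁻¹ * (fullGauss f x t - (1 - Real.exp (-t)) / N)) (Set.Ioi 0) ∧
      ∫ t in Set.Ioi 0, t⁻¹ * (fullGauss f x t - (1 - Real.exp (-t)) / N)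
        = 4 * Real.pi * offDiagEnergy (density f - empirical x) := by
  have hN0 : (N : ℝ) ≠ 0 := by positivity
  have hA := selfGauss_log hf h1
  have hB := fun i => pointGauss_log hf h1 (x i)
  set c : Fin N → Fin N → ℝ → ℝ := fun i j t =>
    if i = j then 0 else t⁻¹ * (Real.exp (-(‖x i - x j‖ ^ 2 * t)) - Real.exp (-t)) with hc
  have hC : ∀ i j, IntegrableOn (c i j) (Set.Ioi 0) ∧
      ∫ t in Set.Ioi 0, c i j t = 4 * Real.pi * coulomb (x i - x j) := by
    intro i j
    by_cases hij : i = j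
    · simp [hc, hij, coulomb_zero]
    · simp only [hc, hij, if_false]
      exact exp_norm_sq_log (sub_ne_zero.2 (hx.ne hij))
  -- Restoring the N diagonal terms costs 1 - exp(-t) each, with prefactor 1/N².
  have hsc : ∀ t, (1 / (N : ℝ) ^ 2) * ∑ i, ∑ j, c i j t
      = t⁻¹ * ((1 / (N : ℝ) ^ 2) * (∑ i, ∑ j, Real.exp (-(‖x i - x j‖ ^ 2 * t)))
        - 1 / N - (1 - 1 / N) * Real.exp (-t)) := by
    intro t
    have : ∀ i j, c i j t = t⁻¹ * (Real.exp (-(‖x i - x j‖ ^ 2 * t)) - Real.exp (-t)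
        - if i = j then (1 - Real.exp (-t)) else 0) := by
      intro i j
      by_cases hij : i = j <;> simp [hc, hij]
    simp only [this, ← Finset.mul_sum, Finset.sum_sub_distrib, Finset.sum_ite_eq, Finset.mem_univ,
      if_true, Finset.sum_const, Finset.card_univ, Fintype.card_fin, nsmul_eq_mul]
    field_simp
    ring
  -- The multiples of exp(-t) have total coefficient -1 + 2 - (1 - 1/N) = 1/N: by neutrality only
  -- the diagonal defect (1 - exp(-t))/N survives.
  have hdec : ∀ t, t⁻¹ * (fullGauss f x t - (1 - Real.exp (-t)) / N)
      = t⁻¹ * (selfGauss f t - Real.exp (-t))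
        - (2 / (N : ℝ)) * (∑ i, t⁻¹ * (pointGauss f (x i) t - Real.exp (-t)))
        + (1 / (N : ℝ) ^ 2) * ∑ i, ∑ j, c i j t := by
    intro t
    rw [hsc, fullGauss, ← Finset.mul_sum, Finset.sum_sub_distrib]
    simp only [Finset.sum_const, Finset.card_univ, Fintype.card_fin, nsmul_eq_mul]
    field_simp
    ring
  have iB : IntegrableOn (fun t => (2 / (N : ℝ)) *
      (∑ i, t⁻¹ * (pointGauss f (x i) t - Real.exp (-t)))) (Set.Ioi 0) :=
    (integrable_finsetSum _ fun i _ => (hB i).1).const_mul _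
  have iC : IntegrableOn (fun t => (1 / (N : ℝ) ^ 2) * ∑ i, ∑ j, c i j t) (Set.Ioi 0) :=
    (integrable_finsetSum _ fun i _ => integrable_finsetSum _ fun j _ => (hC i j).1).const_mul _
  have hfx : ∀ y, Integrable (fun z => f z * coulomb (z - y)) := fun y =>
    ((hf.integrable_mul_log y).const_mul (-(1 / (2 * Real.pi)))).congr
      (Eventually.of_forall fun z => by simp only [coulomb]; ring)
  have hff : Integrable (fun z : Plane × Plane => f z.1 * f z.2 * coulomb (z.1 - z.2)) :=
    (hf.integrable_mul_mul_log.const_mul (-(1 / (2 * Real.pi)))).congr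
      (Eventually.of_forall fun z => by simp only [coulomb]; ring)
  simp_rw [hdec]
  have iAB : IntegrableOn (fun t => t⁻¹ * (selfGauss f t - Real.exp (-t)) - (2 / (N : ℝ)) *
      (∑ i, t⁻¹ * (pointGauss f (x i) t - Real.exp (-t)))) (Set.Ioi 0) := hA.1.sub iB
  refine ⟨iAB.add iC, ?_⟩
  rw [integral_add iAB iC, integral_sub hA.1 iB, hA.2, integral_const_mul,
    integral_const_mul, integral_finsetSum _ fun i _ => (hB i).1,
    integral_finsetSum _ fun i _ => integrable_finsetSum _ fun j _ => (hC i j).1,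
    Finset.sum_congr rfl fun i _ => (hB i).2,
    Finset.sum_congr rfl fun i _ => integral_finsetSum _ fun j _ => (hC i j).1,
    Finset.sum_congr rfl fun i _ => Finset.sum_congr rfl fun j _ => (hC i j).2,
    offDiagEnergy_density_sub_empirical hf.integrable hff hfx]
  simp only [← Finset.mul_sum]
  ring

/-! ### Positivity of the truncated Gaussian energies -/

lemma pointGauss_le {f : Plane → ℝ} (hf : IsDensity f) (y : Plane) {t : ℝ} (ht : 0 < t) :
    pointGauss f y t ≤ normLinf f * (Real.pi / t) := by
  have hg : Integrable fun z : Plane => Real.exp (-(‖z - y‖ ^ 2 * t)) :=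
    ((integrable_exp_neg_mul_norm_sq ht).comp_sub_right y).congr
      (Eventually.of_forall fun z => by simp only []; ring_nf)
  have h1 : ∫ z : Plane, Real.exp (-(‖z - y‖ ^ 2 * t)) = Real.pi / t := by
    rw [← integral_exp_neg_mul_norm_sq ht,
      ← integral_sub_right_eq_self (fun z : Plane => Real.exp (-t * ‖z‖ ^ 2)) y]
    congr 1; ext z; ring_nf
  rw [← h1, ← integral_const_mul, pointGauss]
  refine integral_mono_ae ?_ (hg.const_mul _) ?_
  · exact hf.integrable.mul_bdd (c := 1) (by fun_prop) (Eventually.of_forall fun z => by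
        have : 0 ≤ ‖z - y‖ ^ 2 * t := mul_nonneg (by positivity) (le_of_lt ht)
        simpa using this)
  · filter_upwards [ae_norm_le_normLinf hf.memLp_top] with z hz
    exact mul_le_mul_of_nonneg_right ((le_abs_self _).trans hz) (Real.exp_pos _).le

/-- The Gaussian energy, with the interaction with the points switched off for `t > N`. -/
def truncGauss (f : Plane → ℝ) {N : ℕ} (x : Fin N → Plane) (t : ℝ) : ℝ :=
  if t ≤ N then fullGauss f x t else selfGauss f t

/-- The error made in truncating the Gaussian energies. -/
def truncErr (N : ℕ) (m : ℝ) : ℝ → ℝ :=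
  (Set.Ioc (0 : ℝ) 1).indicator (fun _ => 1 / (N : ℝ))
    + (Set.Ioc 1 (N : ℝ)).indicator (fun t => (1 / (N : ℝ)) * t⁻¹)
    + (Set.Ioi (N : ℝ)).indicator (fun t => 2 * Real.pi * m * t ^ (-2 : ℝ))

lemma integral_truncErr {N : ℕ} (hN : 1 ≤ N) (m : ℝ) :
    IntegrableOn (truncErr N m) (Set.Ioi 0) ∧
      ∫ t in Set.Ioi 0, truncErr N m t = (1 + Real.log N) / N + 2 * Real.pi * m / N := by
  have hN1 : (1 : ℝ) ≤ N := by exact_mod_cast hN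
  have hN0 : (0 : ℝ) < N := by positivity
  have i1 : IntegrableOn (fun _ => 1 / (N : ℝ)) (Set.Ioc (0 : ℝ) 1) :=
    integrableOn_const measure_Ioc_lt_top.ne
  have i2 : IntegrableOn (fun t => (1 / (N : ℝ)) * t⁻¹) (Set.Ioc 1 (N : ℝ)) := by
    refine (ContinuousOn.integrableOn_Icc ?_).mono_set Set.Ioc_subset_Icc_self
    exact continuousOn_const.mul (continuousOn_inv₀.mono fun t ht => (zero_lt_one.trans_le ht.1).ne')
  have i3 : IntegrableOn (fun t => 2 * Real.pi * m * t ^ (-2 : ℝ)) (Set.Ioi (N : ℝ)) :=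
    (integrableOn_Ioi_rpow_of_lt (by norm_num) hN0).const_mul _
  have j1 := (i1.integrable_indicator measurableSet_Ioc).integrableOn (s := Set.Ioi 0)
  have j2 := (i2.integrable_indicator measurableSet_Ioc).integrableOn (s := Set.Ioi 0)
  have j3 := (i3.integrable_indicator measurableSet_Ioi).integrableOn (s := Set.Ioi 0)
  refine ⟨(j1.add j2).add j3, ?_⟩
  simp only [truncErr, Pi.add_apply]
  rw [integral_add (by exact j1.add j2) j3, integral_add j1 j2, setIntegral_indicator measurableSet_Ioc,
    setIntegral_indicator measurableSet_Ioc, setIntegral_indicator measurableSet_Ioi,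
    Set.inter_eq_right.2 Set.Ioc_subset_Ioi_self,
    Set.inter_eq_right.2 (Set.Ioc_subset_Ioi_self.trans (Set.Ioi_subset_Ioi zero_le_one)),
    Set.inter_eq_right.2 (Set.Ioi_subset_Ioi hN0.le), integral_const_mul, integral_const_mul,
    integral_Ioi_rpow_of_lt (by norm_num) hN0, ← intervalIntegral.integral_of_le hN1,
    integral_inv_of_pos one_pos hN0]
  have : (N : ℝ) ^ (-2 + 1 : ℝ) = (N : ℝ)⁻¹ := by
    rw [show (-2 + 1 : ℝ) = -1 by norm_num, Real.rpow_neg_one]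
  rw [this]
  simp
  field_simp
  ring

/-- Three regimes. For t ≤ 1 the defect 1 - exp(-t) ≤ t cancels t⁻¹; for 1 < t ≤ N it is bounded by
1, which produces the logarithm; for t > N the interaction is discarded. -/
lemma truncGauss_le {f : Plane → ℝ} (hf : IsDensity f) {N : ℕ} (hN : 1 ≤ N) (x : Fin N → Plane)
    {t : ℝ} (ht : 0 < t) :
    t⁻¹ * truncGauss f x t
      ≤ t⁻¹ * (fullGauss f x t - (1 - Real.exp (-t)) / N) + truncErr N (normLinf f) t := by
  have hN1 : (1 : ℝ) ≤ N := by exact_mod_cast hN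
  have hN0 : (0 : ℝ) < N := by positivity
  have hexp : 1 - Real.exp (-t) ≤ t := by linarith [Real.add_one_le_exp (-t)]
  have hexp1 : 1 - Real.exp (-t) ≤ 1 := by linarith [Real.exp_pos (-t)]
  simp only [truncGauss, truncErr, Pi.add_apply, Set.indicator_apply, Set.mem_Ioc, Set.mem_Ioi, ht,
    true_and]
  rcases le_or_gt t 1 with h1 | h1
  · have hle : t⁻¹ * ((1 - Real.exp (-t)) / N) ≤ 1 / N := by
      rw [← mul_div_assoc]
      gcongr
      rw [inv_mul_le_iff₀ ht]; linarith
    rw [if_pos (h1.trans hN1), if_pos h1, if_neg (by intro h; linarith [h.1]), if_neg (by linarith)]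
    linarith
  rcases le_or_gt t N with h2 | h2
  · have hle : t⁻¹ * ((1 - Real.exp (-t)) / N) ≤ 1 / N * t⁻¹ := by
      rw [mul_comm]; gcongr
    rw [if_pos h2, if_neg (by linarith), if_pos ⟨h1, h2⟩, if_neg (by linarith)]
    linarith
  · rw [if_neg (by linarith), if_neg (by linarith), if_neg (by intro h; linarith [h.2]), if_pos h2]
    have hD : (2 / (N : ℝ)) * (∑ i, pointGauss f (x i) t) ≤ 2 * (normLinf f * (Real.pi / t)) := by
      calc _ ≤ (2 / (N : ℝ)) * ∑ _i : Fin N, normLinf f * (Real.pi / t) := by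
            gcongr with i; exact pointGauss_le hf _ ht
        _ = _ := by
            rw [Finset.sum_const, Finset.card_univ, Fintype.card_fin, nsmul_eq_mul]; field_simp
    -- The diagonal of the point-point sum alone gives 1/N, which pays for the subtracted defect.
    have hS : 1 / (N : ℝ) ≤ (1 / (N : ℝ) ^ 2) * ∑ i, ∑ j, Real.exp (-(‖x i - x j‖ ^ 2 * t)) := by
      calc 1 / (N : ℝ) = (1 / (N : ℝ) ^ 2) * ∑ _i : Fin N, 1 := by simp; field_simp
        _ ≤ _ := by
            gcongr with i
            refine le_trans ?_ (Finset.single_le_sum (fun j _ => (Real.exp_pos _).le)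
              (Finset.mem_univ i))
            simp
    have hle : selfGauss f t ≤ fullGauss f x t - (1 - Real.exp (-t)) / N
        + 2 * (normLinf f * (Real.pi / t)) := by
      have : (1 - Real.exp (-t)) / N ≤ 1 / N := by gcongr
      rw [fullGauss]; linarith
    have hr : t ^ (-2 : ℝ) = t⁻¹ * t⁻¹ := by
      rw [Real.rpow_neg ht.le, Real.rpow_two, sq, mul_inv]
    calc _ ≤ t⁻¹ * (fullGauss f x t - (1 - Real.exp (-t)) / N
          + 2 * (normLinf f * (Real.pi / t))) := by gcongr
      _ = _ := by rw [hr]; ring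

lemma selfGauss_nonneg {f : Plane → ℝ} (hf : Integrable f) {t : ℝ} (ht : 0 < t) :
    0 ≤ selfGauss f t := by
  rw [selfGauss_eq hf ht]
  exact integral_nonneg fun ζ => mul_nonneg (gaussWeight_nonneg ht ζ) (by positivity)

lemma fullGauss_nonneg {f : Plane → ℝ} (hf : Integrable f) {N : ℕ} (x : Fin N → Plane) {t : ℝ}
    (ht : 0 < t) : 0 ≤ fullGauss f x t := by
  rw [fullGauss_eq hf x ht]
  exact integral_nonneg fun ζ => mul_nonneg (gaussWeight_nonneg ht ζ) (by positivity)

lemma lintegral_truncGauss_le {f : Plane → ℝ} (hf : IsDensity f) (h1 : ∫ x, f x = 1) {N : ℕ}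
    (hN : 1 ≤ N) {x : Fin N → Plane} (hx : Function.Injective x) :
    0 ≤ 4 * Real.pi * offDiagEnergy (density f - empirical x) +
        ((1 + Real.log N) / N + 2 * Real.pi * normLinf f / N) ∧
    ∫⁻ t in Set.Ioi 0, ENNReal.ofReal (t⁻¹ * truncGauss f x t)
      ≤ ENNReal.ofReal (4 * Real.pi * offDiagEnergy (density f - empirical x) +
        ((1 + Real.log N) / N + 2 * Real.pi * normLinf f / N)) := by
  obtain ⟨iJ, eJ⟩ := offDiagEnergy_eq_integral hf h1 hN hx
  obtain ⟨ie, ee⟩ := integral_truncErr hN (normLinf f)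
  have h0 : ∀ t ∈ Set.Ioi (0 : ℝ), 0 ≤ t⁻¹ * truncGauss f x t := fun t ht => by
    refine mul_nonneg (inv_nonneg.2 (le_of_lt ht)) ?_
    unfold truncGauss
    split_ifs
    exacts [fullGauss_nonneg hf.integrable x ht, selfGauss_nonneg hf.integrable ht]
  have hnn : ∀ᵐ t ∂(volume.restrict (Set.Ioi (0 : ℝ))),
      0 ≤ t⁻¹ * (fullGauss f x t - (1 - Real.exp (-t)) / N) + truncErr N (normLinf f) t := by
    filter_upwards [ae_restrict_mem measurableSet_Ioi] with t ht
    exact (h0 t ht).trans (truncGauss_le hf hN x ht)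
  rw [← eJ, ← ee, ← integral_add iJ ie]
  refine ⟨integral_nonneg_of_ae hnn, ?_⟩
  have iJe : IntegrableOn (fun t => t⁻¹ * (fullGauss f x t - (1 - Real.exp (-t)) / N)
      + truncErr N (normLinf f) t) (Set.Ioi 0) := iJ.add ie
  rw [ofReal_integral_eq_lintegral_ofReal iJe hnn]
  refine setLIntegral_mono_ae' measurableSet_Ioi (Eventually.of_forall fun t ht => ?_)
  exact ENNReal.ofReal_le_ofReal (truncGauss_le hf hN x ht)

/-! ### Smearing the point charges -/

lemma hasDerivAt_expNegInvGlue_div {c t : ℝ} (hc : 0 < c) (ht : 0 < t) :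
    HasDerivAt (fun s => expNegInvGlue (s / c) / c) ((t ^ 2)⁻¹ * Real.exp (-(c / t))) t := by
  have h : HasDerivAt (fun s => Real.exp (-(c / s)) / c) ((t ^ 2)⁻¹ * Real.exp (-(c / t))) t := by
    have h1 := ((((hasDerivAt_inv ht.ne').const_mul c).neg).exp).div_const c
    refine (h1.congr_deriv ?_)
    simp only [Pi.neg_apply, ← div_eq_mul_inv]
    field_simp
  refine h.congr_of_eventuallyEq ?_
  filter_upwards [lt_mem_nhds ht] with s hs
  rw [expNegInvGlue, if_neg (not_le.2 (by positivity)), inv_div]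

/-- The antiderivative is exp(-c/t)/c. Writing it with `expNegInvGlue` extends it continuously by 0
at t = 0, so that the endpoint a = 0 is covered. -/
lemma lintegral_inv_sq_mul_exp_Ioi {c a : ℝ} (hc : 0 < c) (ha : 0 ≤ a) :
    ∫⁻ t in Set.Ioi a, ENNReal.ofReal ((t ^ 2)⁻¹ * Real.exp (-(c / t)))
      = ENNReal.ofReal ((1 - expNegInvGlue (a / c)) / c) := by
  have hcont : Continuous fun s => expNegInvGlue (s / c) / c :=
    ((expNegInvGlue.contDiff (n := 0)).continuous.comp (continuous_id.div_const c)).div_const c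
  have hlim : Tendsto (fun s => expNegInvGlue (s / c) / c) atTop (𝓝 (1 / c)) := by
    have h1 : Tendsto (fun s : ℝ => Real.exp (-(c / s)) / c) atTop (𝓝 (Real.exp (-0) / c)) :=
      ((Real.continuous_exp.tendsto _).comp (tendsto_const_nhds.div_atTop tendsto_id).neg).div_const c
    rw [neg_zero, Real.exp_zero] at h1
    refine h1.congr' ?_
    filter_upwards [eventually_gt_atTop 0] with s hs
    rw [expNegInvGlue, if_neg (not_le.2 (by positivity)), inv_div]
  have hd : ∀ t ∈ Set.Ioi a, HasDerivAt (fun s => expNegInvGlue (s / c) / c)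
      ((t ^ 2)⁻¹ * Real.exp (-(c / t))) t :=
    fun t ht => hasDerivAt_expNegInvGlue_div hc (ha.trans_lt ht)
  have hn : ∀ t ∈ Set.Ioi a, 0 ≤ (t ^ 2)⁻¹ * Real.exp (-(c / t)) := fun t _ => by positivity
  rw [← ofReal_integral_eq_lintegral_ofReal
    (integrableOn_Ioi_deriv_of_nonneg hcont.continuousWithinAt hd hn hlim)
    ((ae_restrict_mem measurableSet_Ioi).mono hn),
    integral_Ioi_of_hasDerivAt_of_nonneg hcont.continuousWithinAt hd hn hlim]
  congr 1; ring

/-- The Fourier transform `exp (-|ζ|² / 4N)` of the Gaussian `(N / π) exp (-N |x|²)`. -/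
def smear (N : ℕ) (ζ : Plane) : ℝ := Real.exp (-(‖ζ‖ ^ 2 * (4 * (N : ℝ))⁻¹))

lemma smear_nonneg (N : ℕ) (ζ : Plane) : 0 ≤ smear N ζ := (Real.exp_pos _).le

lemma smear_le_one (N : ℕ) (ζ : Plane) : smear N ζ ≤ 1 := by
  rw [smear, Real.exp_le_one_iff]; simp; positivity

@[fun_prop] lemma continuous_smear (N : ℕ) : Continuous (smear N) := by
  unfold smear; fun_prop

/-- Integrating in t recovers the Coulomb weight |ζ|⁻²; the cut at t = N splits it in the
proportions θ and 1 - θ, where θ is the transform of the smearing Gaussian. -/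
lemma lintegral_gaussWeight_Ioi {N : ℕ} (hN : 1 ≤ N) {ζ : Plane} (hζ : ζ ≠ 0) :
    ∫⁻ t in Set.Ioi (N : ℝ), ENNReal.ofReal (t⁻¹ * gaussWeight t ζ)
      = ENNReal.ofReal (Real.pi⁻¹ * ((1 - smear N ζ) / ‖ζ‖ ^ 2)) := by
  have hN0 : (0 : ℝ) < N := by positivity
  have hz : 0 < ‖ζ‖ := norm_pos_iff.2 hζ
  have hpi := Real.pi_pos
  have hc : 0 < ‖ζ‖ ^ 2 / 4 := by positivity
  have e : ∀ t : ℝ, ENNReal.ofReal (t⁻¹ * gaussWeight t ζ) = ENNReal.ofReal ((4 * Real.pi)⁻¹) *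
      ENNReal.ofReal ((t ^ 2)⁻¹ * Real.exp (-(‖ζ‖ ^ 2 / 4 / t))) := fun t => by
    rw [← ENNReal.ofReal_mul (by positivity), gaussWeight]
    congr 1
    rw [div_div, mul_inv _ t]; ring
  simp_rw [e]
  rw [lintegral_const_mul' _ _ ENNReal.ofReal_ne_top, lintegral_inv_sq_mul_exp_Ioi hc hN0.le,
    ← ENNReal.ofReal_mul (by positivity), expNegInvGlue, if_neg (not_le.2 (by positivity)), smear]
  congr 1
  rw [inv_div, div_div, ← div_eq_mul_inv]
  field_simp

lemma lintegral_gaussWeight_Ioc {N : ℕ} (hN : 1 ≤ N) {ζ : Plane} (hζ : ζ ≠ 0) :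
    ∫⁻ t in Set.Ioc 0 (N : ℝ), ENNReal.ofReal (t⁻¹ * gaussWeight t ζ)
      = ENNReal.ofReal (Real.pi⁻¹ * (smear N ζ / ‖ζ‖ ^ 2)) := by
  have hN0 : (0 : ℝ) < N := by positivity
  have hz : 0 < ‖ζ‖ := norm_pos_iff.2 hζ
  have hpi := Real.pi_pos
  have hc : 0 < ‖ζ‖ ^ 2 / 4 := by positivity
  have e : ∀ t : ℝ, ENNReal.ofReal (t⁻¹ * gaussWeight t ζ) = ENNReal.ofReal ((4 * Real.pi)⁻¹) *
      ENNReal.ofReal ((t ^ 2)⁻¹ * Real.exp (-(‖ζ‖ ^ 2 / 4 / t))) := fun t => by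
    rw [← ENNReal.ofReal_mul (by positivity), gaussWeight]
    congr 1
    rw [div_div, mul_inv _ t]; ring
  have h0 : ∫⁻ t in Set.Ioi (0 : ℝ), ENNReal.ofReal (t⁻¹ * gaussWeight t ζ)
      = ENNReal.ofReal (Real.pi⁻¹ * (1 / ‖ζ‖ ^ 2)) := by
    simp_rw [e]
    rw [lintegral_const_mul' _ _ ENNReal.ofReal_ne_top, lintegral_inv_sq_mul_exp_Ioi hc le_rfl,
      ← ENNReal.ofReal_mul (by positivity), expNegInvGlue, if_pos (by simp)]
    congr 1
    field_simp
    norm_num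
  have hsplit : ∫⁻ t in Set.Ioi (0 : ℝ), ENNReal.ofReal (t⁻¹ * gaussWeight t ζ)
      = (∫⁻ t in Set.Ioc 0 (N : ℝ), ENNReal.ofReal (t⁻¹ * gaussWeight t ζ))
        + ∫⁻ t in Set.Ioi (N : ℝ), ENNReal.ofReal (t⁻¹ * gaussWeight t ζ) := by
    rw [← lintegral_union measurableSet_Ioi (Set.disjoint_left.2 fun t h h' => not_lt.2 h.2 h'),
      Set.Ioc_union_Ioi_eq_Ioi hN0.le]
  rw [h0, lintegral_gaussWeight_Ioi hN hζ] at hsplit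
  have h2 : 0 ≤ Real.pi⁻¹ * ((1 - smear N ζ) / ‖ζ‖ ^ 2) := by
    have := smear_le_one N ζ
    exact mul_nonneg (by positivity) (div_nonneg (by linarith) (by positivity))
  rw [ENNReal.eq_sub_of_add_eq ENNReal.ofReal_ne_top hsplit.symm, ← ENNReal.ofReal_sub _ h2]
  congr 1
  ring

lemma lintegral_gaussWeight_mul_eq {u : Plane → ℂ} (hu : Continuous u) {B : ℝ} (hB : ∀ ζ, ‖u ζ‖ ≤ B)
    {t : ℝ} (ht : 0 < t) :
    ENNReal.ofReal (t⁻¹ * ∫ ζ, gaussWeight t ζ * ‖u ζ‖ ^ 2)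
      = ∫⁻ ζ, ENNReal.ofReal (t⁻¹ * gaussWeight t ζ) * ‖u ζ‖ₑ ^ 2 := by
  have hB0 : 0 ≤ B := (norm_nonneg _).trans (hB 0)
  rw [← integral_const_mul, ofReal_integral_eq_lintegral_ofReal]
  · congr 1; ext ζ
    rw [← mul_assoc, ENNReal.ofReal_mul (mul_nonneg (inv_nonneg.2 ht.le) (gaussWeight_nonneg ht ζ)),
      ENNReal.ofReal_pow (norm_nonneg _), ofReal_norm]
  · refine ((integrable_gaussWeight ht).mul_bdd (c := B ^ 2) (by fun_prop)
      (Eventually.of_forall fun ζ => ?_)).const_mul _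
    rw [norm_pow, norm_norm]
    exact pow_le_pow_left₀ (norm_nonneg _) (hB ζ) 2
  · exact Eventually.of_forall fun ζ => mul_nonneg (inv_nonneg.2 ht.le)
      (mul_nonneg (gaussWeight_nonneg ht ζ) (by positivity))

lemma measurable_uncurry_gaussWeight :
    Measurable (Function.uncurry fun (t : ℝ) (ζ : Plane) => ENNReal.ofReal (t⁻¹ * gaussWeight t ζ)) := by
  unfold gaussWeight Function.uncurry
  fun_prop

/-- Tonelli in (t, ζ) on each side of the threshold t = N, followed by the explicit integrals of the
weights. -/
lemma lintegral_truncGauss_eq {f : Plane → ℝ} (hf : Integrable f) {N : ℕ}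
    (hN : 1 ≤ N) (x : Fin N → Plane) :
    ∫⁻ t in Set.Ioi 0, ENNReal.ofReal (t⁻¹ * truncGauss f x t)
      = ENNReal.ofReal Real.pi⁻¹ * ∫⁻ ζ, (ENNReal.ofReal (smear N ζ) * ‖rft f ζ - empFt x ζ‖ₑ ^ 2
        + ENNReal.ofReal (1 - smear N ζ) * ‖rft f ζ‖ₑ ^ 2) / ‖ζ‖ₑ ^ 2 := by
  have hN0 : (0 : ℝ) < N := by positivity
  have hF : Continuous (rft f) := continuous_ft hf.ofReal
  obtain ⟨B, hB⟩ : ∃ B : ℝ, ∀ ζ, ‖rft f ζ‖ ≤ B := ⟨_, norm_ft_le _⟩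
  have hB' : ∀ ζ, ‖rft f ζ - empFt x ζ‖ ≤ B + 1 := fun ζ =>
    (norm_sub_le _ _).trans (add_le_add (hB ζ) (norm_empFt_le x ζ))
  have hm := measurable_uncurry_gaussWeight
  have swap : ∀ (s : Set ℝ) (u : Plane → ℂ), Continuous u →
      ∫⁻ t in s, ∫⁻ ζ, ENNReal.ofReal (t⁻¹ * gaussWeight t ζ) * ‖u ζ‖ₑ ^ 2
        = ∫⁻ ζ, (∫⁻ t in s, ENNReal.ofReal (t⁻¹ * gaussWeight t ζ)) * ‖u ζ‖ₑ ^ 2 := by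
    intro s u hu
    rw [lintegral_lintegral_swap]
    · congr 1; ext ζ
      rw [lintegral_mul_const]
      exact hm.comp (measurable_id.prodMk measurable_const)
    · refine (hm.mul ?_).aemeasurable
      exact (hu.measurable.comp measurable_snd).enorm.pow_const 2
  have h1 : ∫⁻ t in Set.Ioc 0 (N : ℝ), ENNReal.ofReal (t⁻¹ * truncGauss f x t)
      = ∫⁻ ζ, (∫⁻ t in Set.Ioc 0 (N : ℝ), ENNReal.ofReal (t⁻¹ * gaussWeight t ζ))
        * ‖rft f ζ - empFt x ζ‖ₑ ^ 2 := by
    rw [← swap _ _ (by fun_prop)]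
    refine setLIntegral_congr_fun measurableSet_Ioc fun t ht => ?_
    beta_reduce
    rw [truncGauss, if_pos ht.2, fullGauss_eq hf x ht.1,
      lintegral_gaussWeight_mul_eq (by fun_prop) hB' ht.1]
  have h2 : ∫⁻ t in Set.Ioi (N : ℝ), ENNReal.ofReal (t⁻¹ * truncGauss f x t)
      = ∫⁻ ζ, (∫⁻ t in Set.Ioi (N : ℝ), ENNReal.ofReal (t⁻¹ * gaussWeight t ζ)) * ‖rft f ζ‖ₑ ^ 2 := by
    rw [← swap _ _ hF]
    refine setLIntegral_congr_fun measurableSet_Ioi fun t ht => ?_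
    have ht' : (N : ℝ) < t := ht
    beta_reduce
    rw [truncGauss, if_neg (not_le.2 ht'), selfGauss_eq hf (hN0.trans ht'),
      lintegral_gaussWeight_mul_eq hF hB (hN0.trans ht')]
  rw [← Set.Ioc_union_Ioi_eq_Ioi hN0.le, lintegral_union measurableSet_Ioi
    (Set.disjoint_left.2 fun t h h' => not_lt.2 h.2 h'), h1, h2, ← lintegral_add_left,
    ← lintegral_const_mul' _ _ ENNReal.ofReal_ne_top]
  · refine lintegral_congr_ae ?_
    filter_upwards [ae_ne_plane 0] with ζ hζ
    have hz : 0 < ‖ζ‖ := norm_pos_iff.2 hζ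
    have hpi : 0 ≤ Real.pi⁻¹ := inv_nonneg.2 Real.pi_pos.le
    rw [lintegral_gaussWeight_Ioc hN hζ, lintegral_gaussWeight_Ioi hN hζ, ENNReal.ofReal_mul hpi,
      ENNReal.ofReal_mul hpi, ENNReal.ofReal_div_of_pos (by positivity),
      ENNReal.ofReal_div_of_pos (by positivity), ENNReal.ofReal_pow (norm_nonneg _), ofReal_norm]
    simp only [div_eq_mul_inv]
    ring
  · refine Measurable.mul ?_ (by fun_prop)
    exact Measurable.lintegral_prod_left' (f := Function.uncurry fun (t : ℝ) (ζ : Plane) =>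
      ENNReal.ofReal (t⁻¹ * gaussWeight t ζ)) hm

/-- The Gaussian `(N / π) exp (-N |x|²)`. -/
def bump (N : ℕ) : Plane → ℝ := gaussWeight (4 * (N : ℝ))⁻¹

lemma integrable_bump {N : ℕ} (hN : 1 ≤ N) : Integrable (bump N) :=
  integrable_gaussWeight (by positivity)

lemma continuous_bump (N : ℕ) : Continuous (bump N) := continuous_gaussWeight _

lemma bump_nonneg {N : ℕ} (hN : 1 ≤ N) (x : Plane) : 0 ≤ bump N x :=
  gaussWeight_nonneg (by positivity) x

/-- The self-duality of Gaussians with the roles of space and frequency exchanged, at t = 1/(4N). -/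
lemma rft_bump {N : ℕ} (hN : 1 ≤ N) (ζ : Plane) : rft (bump N) ζ = smear N ζ := by
  rw [smear, ofReal_exp_neg_norm_sq_mul (by positivity), rft, ft]
  congr 1; ext x
  rw [chr_comm, mul_comm]; rfl

lemma bump_eq {N : ℕ} (hN : 1 ≤ N) (x : Plane) :
    bump N x = N / Real.pi * Real.exp (-N * ‖x‖ ^ 2) := by
  have hN0 : (N : ℝ) ≠ 0 := by positivity
  have := Real.pi_ne_zero
  rw [bump, gaussWeight]
  congr 1
  · field_simp
  · congr 1; field_simp

/-- `f` minus the smeared empirical density. -/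
def smeared (f : Plane → ℝ) {N : ℕ} (x : Fin N → Plane) (y : Plane) : ℝ :=
  f y - (1 / (N : ℝ)) * ∑ i, bump N (y - x i)

lemma integrable_smeared {f : Plane → ℝ} (hf : Integrable f) {N : ℕ} (hN : 1 ≤ N)
    (x : Fin N → Plane) : Integrable (smeared f x) :=
  hf.sub ((integrable_finsetSum _ fun i _ => (integrable_bump hN).comp_sub_right (x i)).const_mul _)

lemma rft_smeared {f : Plane → ℝ} (hf : Integrable f) {N : ℕ} (hN : 1 ≤ N)
    (x : Fin N → Plane) (ζ : Plane) :
    rft (smeared f x) ζ = rft f ζ - smear N ζ * empFt x ζ := by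
  have hb : ∀ i, Integrable fun y => ((bump N (y - x i) : ℝ) : ℂ) := fun i =>
    ((integrable_bump hN).comp_sub_right (x i)).ofReal
  have e : ∀ i, ft (fun y => ((bump N (y - x i) : ℝ) : ℂ)) ζ = chr (x i) ζ * smear N ζ := by
    intro i
    have := ft_comp_add_right (fun y => ((bump N y : ℝ) : ℂ)) (-x i) ζ
    rw [neg_neg] at this
    rw [← rft_bump hN, rft, ← this]
    rfl
  have h1 : ft (fun y => (1 / (N : ℂ)) * ∑ i, ((bump N (y - x i) : ℝ) : ℂ)) ζ
      = smear N ζ * empFt x ζ := by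
    have : ∀ y, chr y ζ * ((1 / (N : ℂ)) * ∑ i, ((bump N (y - x i) : ℝ) : ℂ))
        = (1 / (N : ℂ)) * ∑ i, chr y ζ * ((bump N (y - x i) : ℝ) : ℂ) := fun y => by
      rw [Finset.mul_sum, Finset.mul_sum, Finset.mul_sum]
      exact Finset.sum_congr rfl fun i _ => by ring
    rw [ft]
    simp_rw [this]
    rw [integral_const_mul, integral_finsetSum _ fun i _ => integrable_chr_mul (hb i) ζ]
    simp only [ft] at e
    simp only [e]
    rw [← Finset.sum_mul, empFt]
    ring
  have h2 := ft_sub hf.ofReal ((integrable_finsetSum Finset.univ fun i _ => hb i).const_mul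
    (1 / (N : ℂ))) ζ
  rw [← h1, rft, rft]
  refine Eq.trans ?_ h2
  congr 1; ext y; simp [smeared]

/-- Convexity of the square, used with a = f̂ - μ̂_N and b = f̂: the combination is then f̂ - θ
μ̂_N, the transform of the smeared difference. -/
lemma enorm_convex_comb_sq_le {θ : ℝ} (h0 : 0 ≤ θ) (h1 : θ ≤ 1) (a b : ℂ) :
    ‖θ * a + (1 - θ) * b‖ₑ ^ 2
      ≤ ENNReal.ofReal θ * ‖a‖ₑ ^ 2 + ENNReal.ofReal (1 - θ) * ‖b‖ₑ ^ 2 := by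
  have h2 : 0 ≤ 1 - θ := by linarith
  simp only [← ofReal_norm, ← ENNReal.ofReal_pow (norm_nonneg _)]
  rw [← ENNReal.ofReal_mul h0, ← ENNReal.ofReal_mul h2, ← ENNReal.ofReal_add (by positivity)
    (by positivity)]
  refine ENNReal.ofReal_le_ofReal ?_
  have h3 : ‖θ * a + (1 - θ) * b‖ ≤ θ * ‖a‖ + (1 - θ) * ‖b‖ := by
    refine (norm_add_le _ _).trans (le_of_eq ?_)
    rw [norm_mul, norm_mul, Complex.norm_of_nonneg h0]
    congr 2
    rw [← Complex.ofReal_one, ← Complex.ofReal_sub, Complex.norm_of_nonneg h2]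
  calc _ ≤ (θ * ‖a‖ + (1 - θ) * ‖b‖) ^ 2 := by gcongr
    _ ≤ _ := by nlinarith [mul_nonneg (mul_nonneg h0 h2) (sq_nonneg (‖a‖ - ‖b‖))]

/-- Coercivity of the renormalized Coulomb energy, in the homogeneous `H⁻¹` norm of the smeared
difference. -/
lemma lintegral_rft_smeared_le {f : Plane → ℝ} (hf : IsDensity f) (h1 : ∫ x, f x = 1) {N : ℕ}
    (hN : 1 ≤ N) {x : Fin N → Plane} (hx : Function.Injective x) :
    0 ≤ offDiagEnergy (density f - empirical x) + Real.log N / (2 * N) + (1 + normLinf f) / N ∧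
    ∫⁻ ζ, ‖rft (smeared f x) ζ‖ₑ ^ 2 / ‖ζ‖ₑ ^ 2
      ≤ ENNReal.ofReal (4 * Real.pi ^ 2 * (offDiagEnergy (density f - empirical x)
        + Real.log N / (2 * N) + (1 + normLinf f) / N)) := by
  obtain ⟨h0, hle⟩ := lintegral_truncGauss_le hf h1 hN hx
  rw [lintegral_truncGauss_eq hf.integrable hN] at hle
  have hN1 : (1 : ℝ) ≤ N := by exact_mod_cast hN
  have hN0 : (0 : ℝ) < N := by positivity
  have hm := normLinf_nonneg f
  have hpi := Real.pi_gt_three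
  have hlog : 0 ≤ Real.log N := Real.log_nonneg hN1
  set E := offDiagEnergy (density f - empirical x)
  -- The truncation only needs ln N / (4πN), less than the available ln N / 2N; the slack is
  -- dropped.
  have hcmp : 4 * Real.pi * E + ((1 + Real.log N) / N + 2 * Real.pi * normLinf f / N)
      ≤ 4 * Real.pi * (E + Real.log N / (2 * N) + (1 + normLinf f) / N) := by
    have e1 : 4 * Real.pi * (E + Real.log N / (2 * N) + (1 + normLinf f) / N)
      - (4 * Real.pi * E + ((1 + Real.log N) / N + 2 * Real.pi * normLinf f / N))
      = ((2 * Real.pi - 1) * Real.log N + (4 * Real.pi - 1) + 2 * Real.pi * normLinf f) / N := by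
      field_simp; ring
    have e2 : 0 ≤ ((2 * Real.pi - 1) * Real.log N + (4 * Real.pi - 1)
        + 2 * Real.pi * normLinf f) / N := by
      have h2 : 0 ≤ (2 * Real.pi - 1) * Real.log N := mul_nonneg (by linarith) hlog
      have h3 : 0 ≤ 2 * Real.pi * normLinf f := by positivity
      exact div_nonneg (by linarith) hN0.le
    linarith
  refine ⟨nonneg_of_mul_nonneg_right (h0.trans hcmp) (by positivity), ?_⟩
  have hpi0 : 0 < Real.pi := Real.pi_pos
  calc _ ≤ ∫⁻ ζ, (ENNReal.ofReal (smear N ζ) * ‖rft f ζ - empFt x ζ‖ₑ ^ 2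
        + ENNReal.ofReal (1 - smear N ζ) * ‖rft f ζ‖ₑ ^ 2) / ‖ζ‖ₑ ^ 2 := by
        refine lintegral_mono fun ζ => ENNReal.div_le_div_right ?_ _
        refine le_trans (le_of_eq ?_) (enorm_convex_comb_sq_le (smear_nonneg N ζ) (smear_le_one N ζ) _ _)
        rw [rft_smeared hf.integrable hN]
        congr 2; ring
    _ = ENNReal.ofReal Real.pi * (ENNReal.ofReal Real.pi⁻¹ *
        ∫⁻ ζ, (ENNReal.ofReal (smear N ζ) * ‖rft f ζ - empFt x ζ‖ₑ ^ 2
        + ENNReal.ofReal (1 - smear N ζ) * ‖rft f ζ‖ₑ ^ 2) / ‖ζ‖ₑ ^ 2) := by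
        rw [← mul_assoc, ← ENNReal.ofReal_mul hpi0.le, mul_inv_cancel₀ hpi0.ne', ENNReal.ofReal_one,
          one_mul]
    _ ≤ ENNReal.ofReal Real.pi * ENNReal.ofReal (4 * Real.pi * (E + Real.log N / (2 * N)
        + (1 + normLinf f) / N)) := by
        gcongr; exact hle.trans (ENNReal.ofReal_le_ofReal hcmp)
    _ = _ := by rw [← ENNReal.ofReal_mul hpi0.le]; congr 1; ring

/-! ### The correction constant and the modulated energy -/

/-- The nonnegativity half of the coercivity estimate exhibits the member 1 + |M|. Without a member
the infimum would carry no information. -/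
lemma correctionSet_nonempty (M : ℝ) : (correctionSet M).Nonempty := by
  refine ⟨1 + |M|, by positivity, fun N X μ hN hX hμ h1 hM => ?_⟩
  have h := (lintegral_rft_smeared_le hμ h1 hN hX).1
  rw [hM] at h
  have h2 : (1 + M) / (N : ℝ) ≤ (1 + |M|) / N := by gcongr; exact le_abs_self M
  linarith

lemma correction_nonneg (M : ℝ) : 0 ≤ correction M := Real.sInf_nonneg fun _ hb => hb.1

/-- The constraints are closed lower bounds on b, so the infimum satisfies them. -/
lemma offDiagEnergy_add_correction_nonneg {N : ℕ} {X : Fin N → Plane} {μ : Plane → ℝ} (hN : 1 ≤ N)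
    (hX : Function.Injective X) (hμ : IsDensity μ) (h1 : ∫ x, μ x = 1) :
    0 ≤ offDiagEnergy (density μ - empirical X) + correction (normLinf μ) / N
      + Real.log N / (2 * N) := by
  have hN0 : (0 : ℝ) < N := by positivity
  have h : -(offDiagEnergy (density μ - empirical X) + Real.log N / (2 * N)) * N
      ≤ correction (normLinf μ) := by
    refine le_csInf (correctionSet_nonempty _) fun b hb => ?_
    have := hb.2 N X μ hN hX hμ h1 rfl
    rw [← le_div_iff₀ hN0]
    linarith
  rw [← le_div_iff₀ hN0] at h
  linarith

lemma IsDensity.add_sub {f g h : Plane → ℝ} (hf : IsDensity f) (hg : IsDensity g)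
    (hh : IsDensity h) : IsDensity (fun x => f x + g x - h x) where
  memLp_one := (hf.memLp_one.add hg.memLp_one).sub hh.memLp_one
  memLp_top := (hf.memLp_top.add hg.memLp_top).sub hh.memLp_top
  compact := by
    have h1 : HasCompactSupport (fun x => f x + g x) := hf.compact.add hg.compact
    exact h1.sub hh.compact

lemma IsDensity.sub {f g : Plane → ℝ} (hf : IsDensity f) (hg : IsDensity g) :
    IsDensity (fun x => f x - g x) where
  memLp_one := hf.memLp_one.sub hg.memLp_one
  memLp_top := hf.memLp_top.sub hg.memLp_top
  compact := by exact HasCompactSupport.sub hf.compact hg.compact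

lemma IsDensity.memLp_two {f : Plane → ℝ} (hf : IsDensity f) : MemLp f 2 volume :=
  memLp_two_of_memLp_one_top hf.memLp_one hf.memLp_top

lemma normLinf_add_sub_le {f g h : Plane → ℝ} (hf : IsDensity f) (hg : IsDensity g)
    (hh : IsDensity h) :
    normLinf (fun x => f x + g x - h x) ≤ normLinf f + normLinf g + normLinf h := by
  have h1 := hf.memLp_top
  have h2 := hg.memLp_top
  have h3 := hh.memLp_top
  unfold normLinf
  rw [← ENNReal.toReal_add h1.2.ne h2.2.ne,
    ← ENNReal.toReal_add (ENNReal.add_ne_top.2 ⟨h1.2.ne, h2.2.ne⟩) h3.2.ne]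
  refine ENNReal.toReal_mono (by finiteness [h1.2.ne, h2.2.ne, h3.2.ne]) ?_
  refine (eLpNorm_sub_le (h1.1.add h2.1) h3.1 le_top).trans ?_
  gcongr
  exact eLpNorm_add_le h1.1 h2.1 le_top

/-- The kinetic part of the modulated energy. -/
def kinetic (v : Plane → Plane) {N : ℕ} (Q P : Fin N → Plane) : ℝ :=
  1 / (N : ℝ) * ∑ i, ‖v (Q i) - P i‖ ^ 2

lemma kinetic_nonneg (v : Plane → Plane) {N : ℕ} (Q P : Fin N → Plane) : 0 ≤ kinetic v Q P := by
  unfold kinetic; positivity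

/-- The remaining terms of the modulated energy add up to a nonnegative number by the definition of
the correction. -/
lemma kinetic_add_sq_le_modulatedEnergy {ω ρ ωN : Plane → ℝ} (v : Plane → Plane) {N : ℕ}
    (hN : 1 ≤ N) {Q : Fin N → Plane} (P : Fin N → Plane) (hω : IsDensity ω) (hρ : IsDensity ρ)
    (hωN : IsDensity ωN) (h1 : ∫ x, (ρ x + ω x - ωN x) = 1) (hQ : Function.Injective Q) :
    kinetic v Q P + (eLpNorm (fun x => ω x - ωN x) 2 volume).toReal ^ 2
      ≤ modulatedEnergy ω ρ v ωN Q P := by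
  have := offDiagEnergy_add_correction_nonneg hN hQ (hρ.add_sub hω hωN) h1
  unfold modulatedEnergy kinetic
  linarith

/-- The part of the modulated energy which controls the Sobolev norms. -/
lemma kinetic_add_energy_le {ω ρ ωN : Plane → ℝ} (v : Plane → Plane) {N : ℕ}
    (Q P : Fin N → Plane) (hω : IsDensity ω) (hρ : IsDensity ρ)
    (hωN : IsDensity ωN) {M : ℝ} (hM : normLinf ω ≤ M) (hM' : normLinf ωN ≤ M) :
    kinetic v Q P + (eLpNorm (fun x => ω x - ωN x) 2 volume).toReal ^ 2
        + (offDiagEnergy (density (fun x => ρ x + ω x - ωN x) - empirical Q) + Real.log N / (2 * N)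
          + (1 + normLinf (fun x => ρ x + ω x - ωN x)) / N)
      ≤ modulatedEnergy ω ρ v ωN Q P + (1 + 2 * M) * ((1 + normLinf ρ) / N) := by
  have h0 := normLinf_nonneg ρ
  have hM0 : 0 ≤ M := (normLinf_nonneg ω).trans hM
  have h2 := normLinf_add_sub_le hρ hω hωN
  have h3 : (1 + normLinf (fun x => ρ x + ω x - ωN x)) / (N : ℝ)
      ≤ (1 + 2 * M) * ((1 + normLinf ρ) / N) := by
    rw [← mul_div_assoc]
    gcongr
    nlinarith [mul_nonneg hM0 h0]
  have h4 : 0 ≤ correction (normLinf (fun x => ρ x + ω x - ωN x)) / N :=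
    div_nonneg (correction_nonneg _) (Nat.cast_nonneg _)
  unfold modulatedEnergy
  rw [← kinetic]
  linarith

/-! ### Fields in `W^{2,∞}` are Lipschitz -/

lemma norm_integral_normed_smul_le (φ : ContDiffBump (0 : Plane)) {Dv : Plane → Plane →L[ℝ] Plane}
    (hD : MemLp Dv ∞ volume) (z e : Plane) :
    ‖∫ s, φ.normed volume (z - s) • Dv s e‖ ≤ normLinf Dv * ‖e‖ := by
  have hi : Integrable (fun s => φ.normed volume (z - s)) :=
    φ.integrable_normed.comp_sub_left z
  calc _ ≤ ∫ s, φ.normed volume (z - s) * (normLinf Dv * ‖e‖) := by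
        refine norm_integral_le_of_norm_le (hi.mul_const _) ?_
        filter_upwards [ae_norm_le_normLinf hD] with s hs
        rw [norm_smul, Real.norm_of_nonneg (φ.nonneg_normed _)]
        gcongr
        · exact φ.nonneg_normed _
        · exact (Dv s).le_of_opNorm_le hs e
    _ = _ := by
        rw [integral_mul_const, integral_sub_left_eq_self (fun s => φ.normed volume s),
          φ.integral_normed, one_mul]

-- The derivative falls on the smooth kernel, and s ↦ φ(z - s) is the test function in the
-- definition of the weak derivative; the signs from reflection and from integration by parts
-- cancel.
open Convolution in
lemma hasFDerivAt_mollify (φ : ContDiffBump (0 : Plane)) {v : Plane → Plane}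
    {Dv : Plane → Plane →L[ℝ] Plane} (hw : HasWeakFDeriv v Dv) (z : Plane) :
    ∃ A : Plane →L[ℝ] Plane, HasFDerivAt
      (φ.normed volume ⋆[ContinuousLinearMap.lsmul ℝ ℝ, volume] v) A z ∧
      ∀ e, A e = ∫ s, φ.normed volume (z - s) • Dv s e := by
  have hc := φ.hasCompactSupport_normed (μ := volume)
  have hs : ContDiff ℝ (⊤ : ℕ∞) (φ.normed volume) := φ.contDiff_normed
  have hcf : HasCompactSupport (fderiv ℝ (φ.normed volume)) := hc.fderiv ℝ
  have hsf : Continuous (fderiv ℝ (φ.normed volume)) := hs.continuous_fderiv (by simp)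
  have hex : ConvolutionExists (fderiv ℝ (φ.normed volume)) v
      (ContinuousLinearMap.precompL Plane (ContinuousLinearMap.lsmul ℝ ℝ)) volume :=
    HasCompactSupport.convolutionExists_left _ hcf hsf hw.1
  refine ⟨_, hc.hasFDerivAt_convolution_left (ContinuousLinearMap.lsmul ℝ ℝ)
    (hs.of_le (by exact_mod_cast le_top)) hw.1 z, fun e => ?_⟩
  have hψ : ContDiff ℝ (⊤ : ℕ∞) (fun s => φ.normed volume (z - s)) := by fun_prop
  have hψc : HasCompactSupport (fun s => φ.normed volume (z - s)) :=
    hc.comp_homeomorph (Homeomorph.subLeft z)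
  have hd : ∀ s, fderiv ℝ (fun s => φ.normed volume (z - s)) s e
      = -fderiv ℝ (φ.normed volume) (z - s) e := by
    intro s
    have h1 : HasFDerivAt (φ.normed volume) (fderiv ℝ (φ.normed volume) (z - s)) (z - s) :=
      (hs.differentiable (by simp) _).hasFDerivAt
    have h2 := h1.comp s ((hasFDerivAt_id s).const_sub z)
    rw [show (fun s => φ.normed volume (z - s)) = φ.normed volume ∘ fun s => z - s from rfl, h2.fderiv]
    simp
  have h := hw.2.2 _ hψ hψc e
  simp only [hd, neg_smul, integral_neg, neg_inj] at h
  rw [← h, ← integral_sub_left_eq_self _ volume z, convolution_def,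
    ContinuousLinearMap.integral_apply]
  · congr 1; ext s; simp
  · exact hex z

/-- Mollifications of v have gradient bounded by ‖∇v‖_∞, being averages of the weak gradient, and
converge pointwise because v is continuous. -/
lemma IsW2Inf.norm_sub_le {v : Plane → Plane} {Dv : Plane → Plane →L[ℝ] Plane}
    {D2v : Plane → Plane →L[ℝ] Plane →L[ℝ] Plane} (hv : IsW2Inf v Dv D2v) (x y : Plane) :
    ‖v x - v y‖ ≤ normLinf Dv * ‖x - y‖ := by
  let φ : ℕ → ContDiffBump (0 : Plane) := fun n =>
    ⟨1 / ((n : ℝ) + 1) / 2, 1 / ((n : ℝ) + 1), by positivity, half_lt_self (by positivity)⟩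
  have hφ : Tendsto (fun n => (φ n).rOut) atTop (𝓝 0) := tendsto_one_div_add_atTop_nhds_zero_nat
  have hlim := fun z => ContDiffBump.convolution_tendsto_right_of_continuous hφ hv.cont z
    (μ := volume)
  refine le_of_tendsto ((hlim x).sub (hlim y)).norm (Eventually.of_forall fun n => ?_)
  choose A hA hA' using fun z => hasFDerivAt_mollify (φ n) hv.weak_deriv z
  refine Convex.norm_image_sub_le_of_norm_hasFDerivWithin_le (s := Set.univ)
    (fun z _ => (hA z).hasFDerivWithinAt) (fun z _ => ?_) convex_univ trivial trivial
  refine ContinuousLinearMap.opNorm_le_bound _ (normLinf_nonneg _) fun e => ?_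
  rw [hA']
  exact norm_integral_normed_smul_le _ hv.memLp_deriv z e

/-! ### The monokinetic defect in Fourier variables -/

lemma norm_chr_sub_le {E : Type*} [NormedAddCommGroup E] [InnerProductSpace ℝ E] (x y ζ : E) :
    ‖chr x ζ - chr y ζ‖ ≤ ‖x - y‖ * ‖ζ‖ := by
  have h := enorm_chr_sub_one_le (x - y) ζ
  rw [← ofReal_norm, ← ofReal_norm, ← ofReal_norm, ← ENNReal.ofReal_mul (norm_nonneg _),
    ENNReal.ofReal_le_ofReal_iff (by positivity)] at h
  have e : chr x ζ - chr y ζ = (chr (x - y) ζ - 1) * chr y ζ := by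
    rw [sub_mul, ← chr_add_left, one_mul, sub_add_cancel]
  rwa [e, norm_mul, norm_chr, mul_one]

lemma integral_bump_eq_one {N : ℕ} (hN : 1 ≤ N) : ∫ z, bump N z = 1 := by
  have hN0 : (0 : ℝ) < N := by positivity
  have hpi := Real.pi_ne_zero
  simp_rw [bump_eq hN]
  rw [integral_const_mul, integral_exp_neg_mul_norm_sq hN0]
  field_simp

/-- Half of the Gaussian decay absorbs the factor √N |z| ≤ exp(N|z|²/2); the gain (√N)⁻¹ is the
smearing scale. -/
lemma bump_mul_norm_le {N : ℕ} (hN : 1 ≤ N) (z : Plane) :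
    bump N z * ‖z‖ ≤ (N / Real.pi * (Real.sqrt N)⁻¹) * Real.exp (-(N / 2 : ℝ) * ‖z‖ ^ 2) := by
  have hN0 : (0 : ℝ) < N := by positivity
  have hpi := Real.pi_pos
  have hs : 0 < Real.sqrt N := Real.sqrt_pos.2 hN0
  rw [bump_eq hN, mul_assoc, mul_assoc]
  refine mul_le_mul_of_nonneg_left ?_ (by positivity)
  have h1 : Real.sqrt N * ‖z‖ ≤ Real.exp ((N / 2 : ℝ) * ‖z‖ ^ 2) := by
    have h2 := Real.add_one_le_exp ((N / 2 : ℝ) * ‖z‖ ^ 2)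
    have h3 : (Real.sqrt N * ‖z‖) ^ 2 = N * ‖z‖ ^ 2 := by rw [mul_pow, Real.sq_sqrt hN0.le]
    nlinarith [sq_nonneg (Real.sqrt N * ‖z‖ - 1)]
  rw [inv_mul_eq_div, le_div_iff₀ hs]
  calc Real.exp (-N * ‖z‖ ^ 2) * ‖z‖ * Real.sqrt N
      = Real.exp (-N * ‖z‖ ^ 2) * (Real.sqrt N * ‖z‖) := by ring
    _ ≤ Real.exp (-N * ‖z‖ ^ 2) * Real.exp ((N / 2 : ℝ) * ‖z‖ ^ 2) := by gcongr
    _ = _ := by rw [← Real.exp_add]; congr 1; ring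

lemma integral_bump_mul_norm_le {N : ℕ} (hN : 1 ≤ N) :
    Integrable (fun z => bump N z * ‖z‖) ∧ ∫ z, bump N z * ‖z‖ ≤ 2 / Real.sqrt N := by
  have hN0 : (0 : ℝ) < N := by positivity
  have hpi := Real.pi_pos
  have hg := (integrable_exp_neg_mul_norm_sq (b := (N / 2 : ℝ)) (by positivity)).const_mul
    (N / Real.pi * (Real.sqrt N)⁻¹)
  have hi : Integrable (fun z => bump N z * ‖z‖) := by
    refine hg.mono' ((continuous_bump N).mul continuous_norm).aestronglyMeasurable
      (Eventually.of_forall fun z => ?_)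
    rw [Real.norm_of_nonneg (mul_nonneg (bump_nonneg hN z) (norm_nonneg z))]
    exact bump_mul_norm_le hN z
  refine ⟨hi, (integral_mono hi hg (bump_mul_norm_le hN)).trans (le_of_eq ?_)⟩
  rw [integral_const_mul, integral_exp_neg_mul_norm_sq (by positivity)]
  field_simp

/-- Replacing a point by a Gaussian costs `2 L / √N` on an `L`-Lipschitz function. -/
lemma norm_sub_integral_bump_mul_le {N : ℕ} (hN : 1 ≤ N) {φ : Plane → ℂ} (hφ : Continuous φ)
    (hφ1 : ∀ x, ‖φ x‖ ≤ 1) {L : ℝ} (hL : 0 ≤ L) (hφL : ∀ x y, ‖φ x - φ y‖ ≤ L * ‖x - y‖) (q : Plane) :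
    ‖φ q - ∫ y, (bump N (y - q) : ℂ) * φ y‖ ≤ L * (2 / Real.sqrt N) := by
  have hb := (integrable_bump hN).comp_sub_right q
  have h1 : φ q = ∫ y, (bump N (y - q) : ℂ) * φ q := by
    rw [integral_mul_const, integral_complex_ofReal, integral_sub_right_eq_self (bump N) q,
      integral_bump_eq_one hN]
    simp
  obtain ⟨hi, hle⟩ := integral_bump_mul_norm_le hN
  have h2 : Integrable fun y => (bump N (y - q) : ℂ) * φ y :=
    hb.ofReal.mul_bdd (c := 1) hφ.aestronglyMeasurable (Eventually.of_forall hφ1)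
  have h3 : Integrable fun y => (bump N (y - q) : ℂ) * φ q := hb.ofReal.mul_const _
  conv_lhs => rw [h1]
  rw [← integral_sub h3 h2]
  calc _ ≤ ∫ y, L * (bump N (y - q) * ‖y - q‖) := by
        refine norm_integral_le_of_norm_le ((hi.comp_sub_right q).const_mul L)
          (Eventually.of_forall fun y => ?_)
        rw [← mul_sub, norm_mul, Complex.norm_of_nonneg (bump_nonneg hN _)]
        have := hφL q y
        rw [norm_sub_rev q y] at this
        calc _ ≤ bump N (y - q) * (L * ‖y - q‖) :=
              mul_le_mul_of_nonneg_left this (bump_nonneg hN _)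
          _ = _ := by ring
    _ ≤ _ := by
        rw [integral_const_mul, integral_sub_right_eq_self (fun z => bump N z * ‖z‖) q]
        gcongr

lemma norm_chr_mul_sub_le {v : Plane → Plane} {G : ℝ}
    (hv : ∀ x y, ‖v x - v y‖ ≤ G * ‖x - y‖) (ζ₁ ζ₂ : Plane) (x y : Plane) :
    ‖chr x ζ₁ * chr (v x) ζ₂ - chr y ζ₁ * chr (v y) ζ₂‖ ≤ (‖ζ₁‖ + G * ‖ζ₂‖) * ‖x - y‖ := by
  have e : chr x ζ₁ * chr (v x) ζ₂ - chr y ζ₁ * chr (v y) ζ₂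
      = (chr x ζ₁ - chr y ζ₁) * chr (v x) ζ₂ + chr y ζ₁ * (chr (v x) ζ₂ - chr (v y) ζ₂) := by ring
  rw [e]
  refine (norm_add_le _ _).trans ?_
  rw [norm_mul, norm_mul, norm_chr, norm_chr, mul_one, one_mul]
  have h1 := norm_chr_sub_le x y ζ₁
  have h2 := norm_chr_sub_le (v x) (v y) ζ₂
  have h3 := mul_le_mul_of_nonneg_right (hv x y) (norm_nonneg ζ₂)
  linarith

/-- Cauchy–Schwarz for the average; this is where the kinetic term, a mean of squares, enters. -/
lemma norm_avg_sq_le {N : ℕ} (a : Fin N → ℂ) :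
    ‖(1 / (N : ℝ)) • ∑ i, a i‖ ^ 2 ≤ 1 / (N : ℝ) * ∑ i, ‖a i‖ ^ 2 := by
  rcases Nat.eq_zero_or_pos N with rfl | hN
  · simp
  have hN0 : (0 : ℝ) < N := by positivity
  rw [norm_smul, mul_pow, Real.norm_of_nonneg (by positivity)]
  have h1 : ‖∑ i, a i‖ ^ 2 ≤ (∑ i, ‖a i‖) ^ 2 := by gcongr; exact norm_sum_le _ _
  have h2 := sq_sum_le_card_mul_sum_sq (s := Finset.univ) (f := fun i => ‖a i‖)
  rw [Finset.card_univ, Fintype.card_fin] at h2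
  calc _ ≤ (1 / (N : ℝ)) ^ 2 * (N * ∑ i, ‖a i‖ ^ 2) := by gcongr; exact h1.trans h2
    _ = _ := by field_simp

/-- The error of replacing `p_i` by `v(q_i)`, in Fourier variables. -/
lemma norm_avg_chr_sub_sq_le (v : Plane → Plane) {N : ℕ} (Q P : Fin N → Plane) (ζ₁ ζ₂ : Plane) :
    ‖(1 / (N : ℝ)) • ∑ i, chr (Q i) ζ₁ * (chr (P i) ζ₂ - chr (v (Q i)) ζ₂)‖ ^ 2
      ≤ ‖ζ₂‖ ^ 2 * kinetic v Q P := by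
  refine (norm_avg_sq_le _).trans ?_
  have h : ∀ i, ‖chr (Q i) ζ₁ * (chr (P i) ζ₂ - chr (v (Q i)) ζ₂)‖ ^ 2
      ≤ ‖ζ₂‖ ^ 2 * ‖v (Q i) - P i‖ ^ 2 := fun i => by
    rw [norm_mul, norm_chr, one_mul, ← mul_pow, norm_sub_rev (v (Q i)), mul_comm]
    gcongr
    exact norm_chr_sub_le _ _ _
  calc _ ≤ 1 / (N : ℝ) * ∑ i, ‖ζ₂‖ ^ 2 * ‖v (Q i) - P i‖ ^ 2 := by gcongr with i; exact h i
    _ = _ := by rw [kinetic, ← Finset.mul_sum]; ring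

/-- The error of smearing the points, in Fourier variables. -/
lemma norm_avg_smear_sq_le {v : Plane → Plane} (hvc : Continuous v) {G : ℝ} (hG : 0 ≤ G)
    (hv : ∀ x y, ‖v x - v y‖ ≤ G * ‖x - y‖) {N : ℕ} (hN : 1 ≤ N) (Q : Fin N → Plane)
    (ζ₁ ζ₂ : Plane) :
    ‖(1 / (N : ℝ)) • ∑ i, (chr (Q i) ζ₁ * chr (v (Q i)) ζ₂
        - ∫ y, (bump N (y - Q i) : ℂ) * (chr y ζ₁ * chr (v y) ζ₂))‖ ^ 2
      ≤ (‖ζ₁‖ + G * ‖ζ₂‖) ^ 2 * (4 / N) := by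
  have hN0 : (0 : ℝ) < N := by positivity
  refine (norm_avg_sq_le _).trans ?_
  calc _ ≤ 1 / (N : ℝ) * ∑ _i : Fin N, ((‖ζ₁‖ + G * ‖ζ₂‖) * (2 / Real.sqrt N)) ^ 2 := by
        gcongr with i
        exact norm_sub_integral_bump_mul_le hN (φ := fun y => chr y ζ₁ * chr (v y) ζ₂) (by fun_prop)
          (fun x => by simp) (by positivity) (norm_chr_mul_sub_le hv ζ₁ ζ₂) (Q i)
    _ = _ := by
        rw [Finset.sum_const, Finset.card_univ, Fintype.card_fin, nsmul_eq_mul, mul_pow, div_pow,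
          Real.sq_sqrt hN0.le]
        field_simp
        norm_num

lemma memLp_two_bump {N : ℕ} (hN : 1 ≤ N) (q : Plane) :
    MemLp (fun y => bump N (y - q)) 2 volume := by
  have hb := (integrable_bump hN).comp_sub_right q
  refine memLp_two_of_memLp_one_top (memLp_one_iff_integrable.2 hb)
    (memLp_top_of_bound hb.aestronglyMeasurable (N / Real.pi) (Eventually.of_forall fun y => ?_))
  have := Real.pi_pos
  rw [Real.norm_of_nonneg (bump_nonneg hN _), bump_eq hN]
  refine mul_le_of_le_one_right (by positivity) (Real.exp_le_one_iff.2 ?_)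
  have : 0 ≤ (N : ℝ) * ‖y - q‖ ^ 2 := by positivity
  linarith

lemma memLp_two_smeared {f : Plane → ℝ} (hf : IsDensity f) {N : ℕ} (hN : 1 ≤ N)
    (x : Fin N → Plane) : MemLp (smeared f x) 2 volume :=
  hf.memLp_two.sub ((memLp_finsetSum _ fun i _ => memLp_two_bump hN (x i)).const_mul _)

/-- Decomposition of the Fourier transform of the monokinetic defect. -/
lemma fourierMeasure_monokinetic_defect_eq {ω ρ ωN : Plane → ℝ} (hω : IsDensity ω)
    (hρ : IsDensity ρ) (hωN : IsDensity ωN) {v : Plane → Plane} (hv : Continuous v) {N : ℕ}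
    (hN : 1 ≤ N) (Q P : Fin N → Plane) (ζ : Phase) :
    fourierMeasure (empirical (fun i => (WithLp.toLp 2 (Q i, P i) : Phase)) - monokinetic ρ v) ζ
      = (1 / (N : ℝ)) • (∑ i, chr (Q i) ζ.fst * (chr (P i) ζ.snd - chr (v (Q i)) ζ.snd))
        + (1 / (N : ℝ)) • (∑ i, (chr (Q i) ζ.fst * chr (v (Q i)) ζ.snd
          - ∫ y, (bump N (y - Q i) : ℂ) * (chr y ζ.fst * chr (v y) ζ.snd)))
        - ft (fun x => chr (v x) ζ.snd *
            ((smeared (fun x => ρ x + ω x - ωN x) Q x : ℝ) : ℂ)) ζ.fst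
        + ft (fun x => chr (v x) ζ.snd * ((ω x - ωN x : ℝ) : ℂ)) ζ.fst := by
  rw [fourierMeasure_empirical_sub_monokinetic Q P hρ.integrable hv]
  set φ : Plane → ℂ := fun y => chr y ζ.fst * chr (v y) ζ.snd with hφ
  have hφc : Continuous φ := by fun_prop
  have hφi : ∀ g : Plane → ℝ, Integrable g → Integrable fun y => (g y : ℂ) * φ y := fun g hg =>
    hg.ofReal.mul_bdd (c := 1) hφc.aestronglyMeasurable (Eventually.of_forall fun y => by simp [hφ])
  have hft : ∀ g : Plane → ℝ, ft (fun x => chr (v x) ζ.snd * (g x : ℂ)) ζ.fst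
      = ∫ y, (g y : ℂ) * φ y := fun g => by
    rw [ft]; congr 1; ext y; simp only [hφ]; ring
  have hb := fun i => (integrable_bump hN).comp_sub_right (Q i)
  have hsm := integrable_smeared (hρ.add_sub hω hωN).integrable hN Q
  -- By definition ρ = smeared f + μ_N * η_N - (ω - ω_N).
  have hd : (fun y => (ρ y : ℂ) * φ y) = fun y =>
      ((smeared (fun x => ρ x + ω x - ωN x) Q y : ℝ) : ℂ) * φ y
        + (1 / (N : ℂ)) * (∑ i, (bump N (y - Q i) : ℂ) * φ y) - ((ω y - ωN y : ℝ) : ℂ) * φ y := by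
    ext y
    rw [smeared, ← Finset.sum_mul]
    push_cast
    ring
  have hS : Integrable fun y => (1 / (N : ℂ)) * (∑ i, (bump N (y - Q i) : ℂ) * φ y) :=
    (integrable_finsetSum _ fun i _ => hφi _ (hb i)).const_mul _
  have hAS : Integrable fun y => ((smeared (fun x => ρ x + ω x - ωN x) Q y : ℝ) : ℂ) * φ y
      + (1 / (N : ℂ)) * (∑ i, (bump N (y - Q i) : ℂ) * φ y) := (hφi _ hsm).add hS
  rw [hft, hft (fun x => smeared (fun x => ρ x + ω x - ωN x) Q x), hft (fun x => ω x - ωN x), hd,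
    integral_sub hAS (hφi _ (hω.sub hωN).integrable),
    integral_add (hφi _ hsm) hS, integral_const_mul, integral_finsetSum _ fun i _ => hφi _ (hb i)]
  simp only [mul_sub, Finset.sum_sub_distrib, hφ, Complex.real_smul]
  push_cast
  ring

/-! ### The negative Sobolev norm of the monokinetic defect -/

/-- Only this inequality is needed, and it holds without joint measurability of F. -/
lemma lintegral_phase_le (F : Plane → Plane → ℝ≥0∞) :
    ∫⁻ ζ : Phase, F ζ.fst ζ.snd ≤ ∫⁻ ζ₂, ∫⁻ ζ₁, F ζ₁ ζ₂ := by
  have h1 : ∫⁻ ζ : Phase, F ζ.fst ζ.snd = ∫⁻ z : Plane × Plane, F z.1 z.2 :=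
    (WithLp.volume_preserving_ofLp Plane Plane).lintegral_comp_emb
      (MeasurableEquiv.toLp 2 (Plane × Plane)).symm.measurableEmbedding (fun z => F z.1 z.2)
  rw [h1, Measure.volume_eq_prod, ← lintegral_prod_swap]
  exact lintegral_prod_le _

lemma norm_phase_sq (ζ : Phase) : ‖ζ‖ ^ 2 = ‖ζ.fst‖ ^ 2 + ‖ζ.snd‖ ^ 2 :=
  WithLp.prod_norm_sq_eq_of_L2 ζ

lemma rpow_neg_five (s : ℝ) (hs : 0 ≤ s) : (1 + s) ^ (-5 : ℝ) = ((1 + s) ^ 5)⁻¹ := by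
  rw [Real.rpow_neg (by linarith), show (5 : ℝ) = ((5 : ℕ) : ℝ) by norm_num, Real.rpow_natCast]

lemma weight_mul_le (ζ : Phase) :
    (1 + ‖ζ‖ ^ 2) ^ (-5 : ℝ) * (1 + ‖ζ‖ ^ 2) ≤ bessel ζ.fst * bessel ζ.snd := by
  rw [rpow_neg_five _ (sq_nonneg _), norm_phase_sq, bessel, bessel, ← mul_inv]
  set a := ‖ζ.fst‖ ^ 2
  set b := ‖ζ.snd‖ ^ 2
  have ha : 0 ≤ a := sq_nonneg _
  have hb : 0 ≤ b := sq_nonneg _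
  have e : ((1 + (a + b)) ^ 5)⁻¹ * (1 + (a + b)) = ((1 + (a + b)) ^ 2 * (1 + (a + b)) ^ 2)⁻¹ := by
    field_simp
  rw [e]
  gcongr <;> linarith

/-- Here 5 = 2 + 2 + 1: two powers per variable for integrability, and one in ζ₂ against the growth
of the Lipschitz constant of x ↦ exp(-i v(x)·ζ₂). -/
lemma weight_le (ζ : Phase) :
    (1 + ‖ζ‖ ^ 2) ^ (-5 : ℝ) ≤ bessel ζ.fst * ((1 + ‖ζ.snd‖ ^ 2)⁻¹ * bessel ζ.snd) := by
  rw [rpow_neg_five _ (sq_nonneg _), norm_phase_sq, bessel, bessel, ← mul_inv, ← mul_inv]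
  set a := ‖ζ.fst‖ ^ 2
  set b := ‖ζ.snd‖ ^ 2
  have ha : 0 ≤ a := sq_nonneg _
  have hb : 0 ≤ b := sq_nonneg _
  have e : (1 + (a + b)) ^ 5 = (1 + (a + b)) ^ 2 * ((1 + (a + b)) * (1 + (a + b)) ^ 2) := by ring
  rw [e]
  gcongr <;> linarith

lemma norm_add_sub_add_sq_le (a b c d : ℂ) :
    ‖a + b - c + d‖ ^ 2 ≤ 4 * (‖a‖ ^ 2 + ‖b‖ ^ 2 + ‖c‖ ^ 2 + ‖d‖ ^ 2) := by
  have h : ‖a + b - c + d‖ ≤ ‖a‖ + ‖b‖ + ‖c‖ + ‖d‖ :=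
    (norm_add_le _ _).trans (by gcongr; exact (norm_sub_le _ _).trans (by gcongr; exact norm_add_le _ _))
  have h2 : ‖a + b - c + d‖ ^ 2 ≤ (‖a‖ + ‖b‖ + ‖c‖ + ‖d‖) ^ 2 := by gcongr
  nlinarith [sq_nonneg (‖a‖ - ‖b‖), sq_nonneg (‖a‖ - ‖c‖), sq_nonneg (‖a‖ - ‖d‖),
    sq_nonneg (‖b‖ - ‖c‖), sq_nonneg (‖b‖ - ‖d‖), sq_nonneg (‖c‖ - ‖d‖)]

/-- Pointwise bound of the weighted Fourier transform of the monokinetic defect. -/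
lemma weight_mul_fourierMeasure_defect_le {ω ρ ωN : Plane → ℝ} (hω : IsDensity ω)
    (hρ : IsDensity ρ) (hωN : IsDensity ωN) {v : Plane → Plane} (hvc : Continuous v) {G : ℝ}
    (hG : 0 ≤ G) (hv : ∀ x y, ‖v x - v y‖ ≤ G * ‖x - y‖) {N : ℕ}
    (hN : 1 ≤ N) (Q P : Fin N → Plane) (ζ : Phase) :
    (1 + ‖ζ‖ ^ 2) ^ (-5 : ℝ) * ‖fourierMeasure
        (empirical (fun i => (WithLp.toLp 2 (Q i, P i) : Phase)) - monokinetic ρ v) ζ‖ ^ 2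
      ≤ 4 * (bessel ζ.fst * (bessel ζ.snd * (kinetic v Q P + (1 + G) ^ 2 * (4 / N)))
        + bessel ζ.fst * ‖ft (fun x => chr (v x) ζ.snd *
            ((smeared (fun x => ρ x + ω x - ωN x) Q x : ℝ) : ℂ)) ζ.fst‖ ^ 2
            * ((1 + ‖ζ.snd‖ ^ 2)⁻¹ * bessel ζ.snd)
        + ‖ft (fun x => chr (v x) ζ.snd * ((ω x - ωN x : ℝ) : ℂ)) ζ.fst‖ ^ 2
            * ((1 + ‖ζ.snd‖ ^ 2)⁻¹ * bessel ζ.snd)) := by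
  rw [fourierMeasure_monokinetic_defect_eq hω hρ hωN hvc hN]
  have h1 := norm_avg_chr_sub_sq_le v Q P ζ.fst ζ.snd
  have h2 := norm_avg_smear_sq_le hvc hG hv hN Q ζ.fst ζ.snd
  set T1 := (1 / (N : ℝ)) • (∑ i, chr (Q i) ζ.fst * (chr (P i) ζ.snd - chr (v (Q i)) ζ.snd))
  set T2 := (1 / (N : ℝ)) • (∑ i, (chr (Q i) ζ.fst * chr (v (Q i)) ζ.snd
          - ∫ y, (bump N (y - Q i) : ℂ) * (chr y ζ.fst * chr (v y) ζ.snd)))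
  set A := ft (fun x => chr (v x) ζ.snd *
            ((smeared (fun x => ρ x + ω x - ωN x) Q x : ℝ) : ℂ)) ζ.fst
  set B := ft (fun x => chr (v x) ζ.snd * ((ω x - ωN x : ℝ) : ℂ)) ζ.fst
  have hk := kinetic_nonneg v Q P
  set k := kinetic v Q P
  have hN0 : (0 : ℝ) ≤ 4 / N := by positivity
  have hw : 0 ≤ (1 + ‖ζ‖ ^ 2) ^ (-5 : ℝ) := by positivity
  have hb1 := bessel_pos ζ.fst
  have hb2 := bessel_pos ζ.snd
  have hc : 0 ≤ (1 + ‖ζ.snd‖ ^ 2)⁻¹ * bessel ζ.snd := by positivity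
  -- Both point errors grow quadratically in the frequency, so they use up one factor 1 + |ζ|² of
  -- the weight.
  have hT : ‖T1‖ ^ 2 + ‖T2‖ ^ 2 ≤ (1 + ‖ζ‖ ^ 2) * (k + (1 + G) ^ 2 * (4 / N)) := by
    have e1 : ‖ζ.snd‖ ^ 2 * k ≤ (1 + ‖ζ‖ ^ 2) * k := by
      gcongr; rw [norm_phase_sq]; nlinarith [sq_nonneg ‖ζ.fst‖]
    have e2 : (‖ζ.fst‖ + G * ‖ζ.snd‖) ^ 2 * (4 / N) ≤ (1 + ‖ζ‖ ^ 2) * ((1 + G) ^ 2 * (4 / N)) := by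
      rw [← mul_assoc]
      gcongr
      rw [norm_phase_sq]
      nlinarith [sq_nonneg (G * ‖ζ.fst‖ - ‖ζ.snd‖), sq_nonneg G,
        mul_nonneg hG (sq_nonneg ‖ζ.fst‖), mul_nonneg hG (sq_nonneg ‖ζ.snd‖)]
    linarith
  have hA : (1 + ‖ζ‖ ^ 2) ^ (-5 : ℝ) * ‖A‖ ^ 2
      ≤ bessel ζ.fst * ‖A‖ ^ 2 * ((1 + ‖ζ.snd‖ ^ 2)⁻¹ * bessel ζ.snd) := by
    rw [mul_right_comm]; gcongr; exact weight_le ζ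
  have hB : (1 + ‖ζ‖ ^ 2) ^ (-5 : ℝ) * ‖B‖ ^ 2
      ≤ ‖B‖ ^ 2 * ((1 + ‖ζ.snd‖ ^ 2)⁻¹ * bessel ζ.snd) := by
    rw [mul_comm]; gcongr
    exact (weight_le ζ).trans (mul_le_of_le_one_left hc (bessel_le_one _))
  have hTT : (1 + ‖ζ‖ ^ 2) ^ (-5 : ℝ) * (‖T1‖ ^ 2 + ‖T2‖ ^ 2)
      ≤ bessel ζ.fst * (bessel ζ.snd * (k + (1 + G) ^ 2 * (4 / N))) := by
    calc _ ≤ (1 + ‖ζ‖ ^ 2) ^ (-5 : ℝ) * ((1 + ‖ζ‖ ^ 2) * (k + (1 + G) ^ 2 * (4 / N))) := by gcongr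
      _ = ((1 + ‖ζ‖ ^ 2) ^ (-5 : ℝ) * (1 + ‖ζ‖ ^ 2)) * (k + (1 + G) ^ 2 * (4 / N)) := by ring
      _ ≤ (bessel ζ.fst * bessel ζ.snd) * (k + (1 + G) ^ 2 * (4 / N)) := by
          exact mul_le_mul_of_nonneg_right (weight_mul_le ζ) (by positivity)
      _ = _ := by ring
  have hD := mul_le_mul_of_nonneg_left (norm_add_sub_add_sq_le T1 T2 A B) hw
  linarith

lemma memLp_two_chr_mul {g : Plane → ℝ} (h2 : MemLp g 2 volume) {v : Plane → Plane}
    (hv : Continuous v) (ζ₂ : Plane) : MemLp (fun x => chr (v x) ζ₂ * (g x : ℂ)) 2 volume := by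
  have h3 : MemLp (fun x => (g x : ℂ)) 2 volume := h2.ofReal
  refine h3.of_le ?_ (Eventually.of_forall fun x => by simp)
  exact (by fun_prop : Continuous fun x => chr (v x) ζ₂).aestronglyMeasurable.mul h3.1

lemma integrable_chr_comp_mul {g : Plane → ℝ} (h1 : Integrable g) {v : Plane → Plane}
    (hv : Continuous v) (ζ₂ : Plane) : Integrable (fun x => chr (v x) ζ₂ * (g x : ℂ)) :=
  h1.ofReal.bdd_mul (c := 1)
    (by fun_prop : Continuous fun x => chr (v x) ζ₂).aestronglyMeasurable
    (Eventually.of_forall fun x => by simp)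

/-- The integral `∫ (1 + |ζ|²)⁻² dζ` over the plane. -/
def besselMass : ℝ≥0∞ := ∫⁻ ζ : Plane, ENNReal.ofReal (bessel ζ)

lemma besselMass_ne_top : besselMass ≠ ∞ := integrable_bessel.lintegral_lt_top.ne

/-- Integrate in ζ₁ first: for fixed ζ₂ the phase exp(-i v(x)·ζ₂) is a fixed multiplier of modulus 1
and Lipschitz constant G|ζ₂|, so the multiplication estimate and Plancherel apply. The remaining
weight is integrable in ζ₂. -/
lemma lintegral_fourierMeasure_defect_le {ω ρ ωN : Plane → ℝ} (hω : IsDensity ω)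
    (hρ : IsDensity ρ) (hωN : IsDensity ωN) {v : Plane → Plane} (hvc : Continuous v) {G : ℝ}
    (hG : 0 ≤ G) (hv : ∀ x y, ‖v x - v y‖ ≤ G * ‖x - y‖) {N : ℕ}
    (hN : 1 ≤ N) (Q P : Fin N → Plane) :
    ∫⁻ ζ, ENNReal.ofReal ((1 + ‖ζ‖ ^ 2) ^ (-5 : ℝ)) * ‖fourierMeasure
        (empirical (fun i => (WithLp.toLp 2 (Q i, P i) : Phase)) - monokinetic ρ v) ζ‖ₑ ^ 2
      ≤ 4 * (besselMass * (besselMass * ENNReal.ofReal (kinetic v Q P + (1 + G) ^ 2 * (4 / N))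
        + ENNReal.ofReal (8 * (1 + G) ^ 2) *
          (∫⁻ ζ, ‖rft (smeared (fun x => ρ x + ω x - ωN x) Q) ζ‖ₑ ^ 2 / ‖ζ‖ₑ ^ 2)
        + plancherelConst Plane * ∫⁻ x, ‖ω x - ωN x‖ₑ ^ 2)) := by
  set f : Plane → ℝ := fun x => ρ x + ω x - ωN x with hf
  have hfd : IsDensity f := hρ.add_sub hω hωN
  set τ := kinetic v Q P + (1 + G) ^ 2 * (4 / N) with hτ
  have hτ0 : 0 ≤ τ := add_nonneg (kinetic_nonneg v Q P) (by positivity)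
  set c3 : Plane → ℝ := fun ζ₂ => (1 + ‖ζ₂‖ ^ 2)⁻¹ * bessel ζ₂ with hc3
  have hc0 : ∀ ζ₂, 0 ≤ c3 ζ₂ := fun ζ₂ => mul_nonneg (by positivity) (bessel_pos ζ₂).le
  set A : Plane → Plane → ℂ := fun ζ₁ ζ₂ => ft (fun x => chr (v x) ζ₂ * ((smeared f Q x : ℝ) : ℂ)) ζ₁
  set B : Plane → Plane → ℂ := fun ζ₁ ζ₂ => ft (fun x => chr (v x) ζ₂ * ((ω x - ωN x : ℝ) : ℂ)) ζ₁
  set Ef := ∫⁻ ζ, ‖rft (smeared f Q) ζ‖ₑ ^ 2 / ‖ζ‖ₑ ^ 2 with hEf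
  set L := ∫⁻ x, ‖ω x - ωN x‖ₑ ^ 2 with hL
  have hsm1 := integrable_smeared hfd.integrable hN Q
  have hsm2 := memLp_two_smeared hfd hN Q
  have hg := hω.sub hωN
  have sqe : ∀ z : ℂ, ENNReal.ofReal (‖z‖ ^ 2) = ‖z‖ₑ ^ 2 := fun z => by
    rw [ENNReal.ofReal_pow (norm_nonneg _), ofReal_norm]
  let F : Plane → Plane → ℝ≥0∞ := fun ζ₁ ζ₂ =>
    4 * (ENNReal.ofReal (bessel ζ₁) * ENNReal.ofReal (bessel ζ₂ * τ)
        + ENNReal.ofReal (bessel ζ₁) * ‖A ζ₁ ζ₂‖ₑ ^ 2 * ENNReal.ofReal (c3 ζ₂)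
        + ‖B ζ₁ ζ₂‖ₑ ^ 2 * ENNReal.ofReal (c3 ζ₂))
  have hpt : ∀ ζ : Phase, ENNReal.ofReal ((1 + ‖ζ‖ ^ 2) ^ (-5 : ℝ)) * ‖fourierMeasure
        (empirical (fun i => (WithLp.toLp 2 (Q i, P i) : Phase)) - monokinetic ρ v) ζ‖ₑ ^ 2
      ≤ F ζ.fst ζ.snd := by
    intro ζ
    have h := weight_mul_fourierMeasure_defect_le hω hρ hωN hvc hG hv hN Q P ζ
    have hb1 := (bessel_pos ζ.fst).le
    have hb2 := (bessel_pos ζ.snd).le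
    have hc := hc0 ζ.snd
    simp only [F]
    rw [← sqe, ← sqe, ← sqe, ← ENNReal.ofReal_mul (by positivity), ← ENNReal.ofReal_mul hb1,
      ← ENNReal.ofReal_mul hb1, ← ENNReal.ofReal_mul (by positivity),
      ← ENNReal.ofReal_mul (by positivity), ← ENNReal.ofReal_add (by positivity) (by positivity),
      ← ENNReal.ofReal_add (by positivity) (by positivity), ← ENNReal.ofReal_ofNat 4,
      ← ENNReal.ofReal_mul (by positivity)]
    exact ENNReal.ofReal_le_ofReal h
  refine (lintegral_mono hpt).trans ((lintegral_phase_le F).trans ?_)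
  have hA : ∀ ζ₂, ∫⁻ ζ₁, ENNReal.ofReal (bessel ζ₁) * ‖A ζ₁ ζ₂‖ₑ ^ 2
      ≤ ENNReal.ofReal (4 * (1 + (G * ‖ζ₂‖ + 1) ^ 2)) * Ef := by
    intro ζ₂
    have h := lintegral_bessel_mul_ft_mul_le (f := fun x => ((smeared f Q x : ℝ) : ℂ))
      (w := fun x => chr (v x) ζ₂) (L := G * ‖ζ₂‖) hsm1.ofReal hsm2.ofReal (by fun_prop)
      (fun x => by simp) (by positivity) (fun x y => by
        refine (norm_chr_sub_le _ _ _).trans ?_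
        have := mul_le_mul_of_nonneg_right (hv x y) (norm_nonneg ζ₂)
        linarith)
    refine h.trans (le_of_eq ?_)
    rw [ENNReal.ofReal_mul (by norm_num), ENNReal.ofReal_add (p := 1)
      (q := (G * ‖ζ₂‖ + 1) ^ 2) zero_le_one (by positivity),
      ENNReal.ofReal_pow (by positivity), ENNReal.ofReal_one, ENNReal.ofReal_ofNat]
    rfl
  have hB : ∀ ζ₂, ∫⁻ ζ₁, ‖B ζ₁ ζ₂‖ₑ ^ 2 = plancherelConst Plane * L := by
    intro ζ₂
    rw [lintegral_enorm_ft_sq (integrable_chr_comp_mul hg.integrable hvc ζ₂)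
      (memLp_two_chr_mul hg.memLp_two hvc ζ₂)]
    congr 1
    refine lintegral_congr fun x => ?_
    rw [enorm_mul, enorm_chr, one_mul, ← ofReal_norm, Complex.norm_real, ofReal_norm]
  have hinner : ∀ ζ₂, ∫⁻ ζ₁, 4 * (ENNReal.ofReal (bessel ζ₁) * ENNReal.ofReal (bessel ζ₂ * τ)
        + ENNReal.ofReal (bessel ζ₁) * ‖A ζ₁ ζ₂‖ₑ ^ 2 * ENNReal.ofReal (c3 ζ₂)
        + ‖B ζ₁ ζ₂‖ₑ ^ 2 * ENNReal.ofReal (c3 ζ₂))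
      ≤ ENNReal.ofReal (bessel ζ₂) * (4 * (besselMass * ENNReal.ofReal τ
        + ENNReal.ofReal (8 * (1 + G) ^ 2) * Ef + plancherelConst Plane * L)) := by
    intro ζ₂
    have hb := (bessel_pos ζ₂).le
    have mb : Measurable fun ζ₁ : Plane => ENNReal.ofReal (bessel ζ₁) :=
      continuous_bessel.measurable.ennreal_ofReal
    have mA : Measurable fun ζ₁ => ‖A ζ₁ ζ₂‖ₑ ^ 2 :=
      ((continuous_ft (integrable_chr_comp_mul hsm1 hvc ζ₂)).measurable.enorm).pow_const 2
    rw [lintegral_const_mul' _ _ (by norm_num), lintegral_add_left, lintegral_add_left,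
      lintegral_mul_const' _ _ ENNReal.ofReal_ne_top, lintegral_mul_const' _ _ ENNReal.ofReal_ne_top,
      lintegral_mul_const' _ _ ENNReal.ofReal_ne_top, hB, ← besselMass]
    · have k1 : besselMass * ENNReal.ofReal (bessel ζ₂ * τ)
          = ENNReal.ofReal (bessel ζ₂) * (besselMass * ENNReal.ofReal τ) := by
        rw [ENNReal.ofReal_mul hb]; ring
      -- The reserved factor (1 + |ζ₂|²)⁻¹ absorbs the quadratic growth in ζ₂ of the multiplier
      -- constant.
      have h5 : 4 * (1 + (G * ‖ζ₂‖ + 1) ^ 2) * c3 ζ₂ ≤ bessel ζ₂ * (8 * (1 + G) ^ 2) := by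
        simp only [hc3]
        rw [← mul_assoc, mul_comm (bessel ζ₂)]
        refine mul_le_mul_of_nonneg_right ?_ hb
        rw [← div_eq_mul_inv, div_le_iff₀ (by positivity)]
        nlinarith [sq_nonneg (G - ‖ζ₂‖), mul_nonneg hG (sq_nonneg ‖ζ₂‖), sq_nonneg ‖ζ₂‖,
          sq_nonneg G, sq_nonneg (G * ‖ζ₂‖)]
      have k2 : (∫⁻ ζ₁, ENNReal.ofReal (bessel ζ₁) * ‖A ζ₁ ζ₂‖ₑ ^ 2) * ENNReal.ofReal (c3 ζ₂)
          ≤ ENNReal.ofReal (bessel ζ₂) * (ENNReal.ofReal (8 * (1 + G) ^ 2) * Ef) := by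
        calc _ ≤ ENNReal.ofReal (4 * (1 + (G * ‖ζ₂‖ + 1) ^ 2)) * Ef * ENNReal.ofReal (c3 ζ₂) := by
              gcongr; exact hA ζ₂
          _ = ENNReal.ofReal (4 * (1 + (G * ‖ζ₂‖ + 1) ^ 2) * c3 ζ₂) * Ef := by
              rw [ENNReal.ofReal_mul (q := c3 ζ₂) (by positivity)]; ring
          _ ≤ ENNReal.ofReal (bessel ζ₂ * (8 * (1 + G) ^ 2)) * Ef :=
              mul_le_mul' (ENNReal.ofReal_le_ofReal h5) le_rfl
          _ = _ := by rw [ENNReal.ofReal_mul hb]; ring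
      have k3 : plancherelConst Plane * L * ENNReal.ofReal (c3 ζ₂)
          ≤ ENNReal.ofReal (bessel ζ₂) * (plancherelConst Plane * L) := by
        rw [mul_comm]
        gcongr
        refine mul_le_of_le_one_left hb (inv_le_one_of_one_le₀ ?_)
        nlinarith [sq_nonneg ‖ζ₂‖]
      calc _ ≤ 4 * (ENNReal.ofReal (bessel ζ₂) * (besselMass * ENNReal.ofReal τ)
            + ENNReal.ofReal (bessel ζ₂) * (ENNReal.ofReal (8 * (1 + G) ^ 2) * Ef)
            + ENNReal.ofReal (bessel ζ₂) * (plancherelConst Plane * L)) := by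
            exact mul_le_mul' le_rfl (add_le_add (add_le_add k1.le k2) k3)
        _ = _ := by ring
    · exact mb.mul_const _
    · exact (mb.mul_const _).add ((mb.mul mA).mul_const _)
  refine (lintegral_mono hinner).trans (le_of_eq ?_)
  rw [lintegral_mul_const _ continuous_bessel.measurable.ennreal_ofReal, ← besselMass]
  ring

/-! ### The modulated energy controls the Sobolev norms -/

lemma lintegral_enorm_sub_sq_eq {f g : Plane → ℝ} (hf : IsDensity f) (hg : IsDensity g) :
    ∫⁻ x, ‖f x - g x‖ₑ ^ 2
      = ENNReal.ofReal ((eLpNorm (fun x => f x - g x) 2 volume).toReal ^ 2) := by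
  rw [← eLpNorm_two_sq, ENNReal.ofReal_pow ENNReal.toReal_nonneg,
    ENNReal.ofReal_toReal (hf.sub hg).memLp_two.2.ne]

lemma defect_bound_le {I p κ l e n γ : ℝ} (hI : 0 ≤ I) (hp : 0 ≤ p) (hκ : 0 ≤ κ) (hl : 0 ≤ l)
    (he : 0 ≤ e) (hn : 0 ≤ n) (hγ : 1 ≤ γ) :
    4 * (I * (I * (κ + γ * (4 * n)) + 8 * γ * (4 * Real.pi ^ 2 * e) + p * l))
      ≤ 4 * (I * (4 * I + 32 * Real.pi ^ 2 + p)) * γ * (κ + l + e + n) := by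
  have hγ0 : 0 ≤ γ := zero_le_one.trans hγ
  have t1 : κ + γ * (4 * n) ≤ 4 * (γ * (κ + l + e + n)) := by
    have h1 : κ ≤ γ * κ := le_mul_of_one_le_left hκ hγ
    have h2 : 0 ≤ γ * (3 * κ + 4 * l + 4 * e) := by positivity
    linarith
  have t2 : 8 * γ * (4 * Real.pi ^ 2 * e) ≤ 32 * Real.pi ^ 2 * (γ * (κ + l + e + n)) := by
    have h2 : 0 ≤ 32 * Real.pi ^ 2 * (γ * (κ + l + n)) := by positivity
    linarith
  have t3 : l ≤ γ * (κ + l + e + n) := by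
    have h1 : l ≤ γ * l := le_mul_of_one_le_left hl hγ
    have h2 : 0 ≤ γ * (κ + e + n) := by positivity
    linarith
  calc _ ≤ 4 * (I * (I * (4 * (γ * (κ + l + e + n))) + 32 * Real.pi ^ 2 * (γ * (κ + l + e + n))
        + p * (γ * (κ + l + e + n)))) := by gcongr
    _ = _ := by ring

lemma exists_sobolevNorm_monokinetic_defect_le : ∃ K : ℝ, 0 < K ∧
    ∀ (M : ℝ) (N : ℕ) (ω ρ ωN : Plane → ℝ) (v : Plane → Plane) (Dv : Plane → Plane →L[ℝ] Plane)
      (D2v : Plane → Plane →L[ℝ] Plane →L[ℝ] Plane) (Q P : Fin N → Plane),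
      1 ≤ N → IsDensity ω → IsDensity ρ → IsDensity ωN → ∫ x, (ρ x + ω x - ωN x) = 1 →
      normLinf ω ≤ M → normLinf ωN ≤ M → IsW2Inf v Dv D2v → Function.Injective Q →
      sobolevNorm (-5)
          (empirical (fun i => (WithLp.toLp 2 (Q i, P i) : Phase)) - monokinetic ρ v)
        ≤ ENNReal.ofReal (K * (1 + |M|) * (1 + gradNorm Dv D2v ^ 2) *
            Real.sqrt (modulatedEnergy ω ρ v ωN Q P + (1 + normLinf ρ) * (N : ℝ) ^ (-1 : ℝ))) := by
  have hI := ENNReal.ofReal_toReal besselMass_ne_top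
  have hp := ENNReal.ofReal_toReal (plancherelConst_ne_top (E := Plane))
  set I' := besselMass.toReal
  set p' := (plancherelConst Plane).toReal
  have hI0 : 0 ≤ I' := ENNReal.toReal_nonneg
  have hp0 : 0 ≤ p' := ENNReal.toReal_nonneg
  set K := 4 * (I' * (4 * I' + 32 * Real.pi ^ 2 + p')) with hK
  have hK0 : 0 ≤ K := by positivity
  -- The 4 is 2 · 2: one factor from 1 + G ≤ 2(1 + g²), with g = ‖∇v‖_{W^{1,∞}}, the other from K(2
  -- + 2M) ≤ (2(1 + K)(1 + M))².
  refine ⟨4 * (1 + K), by positivity, ?_⟩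
  intro M N ω ρ ωN v Dv D2v Q P hN hω hρ hωN h1 hM hM' hv hQ
  have hN0 : (0 : ℝ) < N := by positivity
  have hM0 : 0 ≤ M := (normLinf_nonneg ω).trans hM
  have hG0 := normLinf_nonneg Dv
  have hρ0 := normLinf_nonneg ρ
  have hGg : normLinf Dv ≤ gradNorm Dv D2v := by
    have := normLinf_nonneg D2v
    unfold gradNorm; linarith
  have hle := lintegral_fourierMeasure_defect_le hω hρ hωN hv.cont hG0 hv.norm_sub_le hN Q P
  obtain ⟨he0, heE⟩ := lintegral_rft_smeared_le (hρ.add_sub hω hωN) h1 hN hQ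
  have hS := kinetic_add_energy_le v Q P hω hρ hωN hM hM'
  have hH := kinetic_add_sq_le_modulatedEnergy v hN P hω hρ hωN h1 hQ
  have hk := kinetic_nonneg v Q P
  rw [lintegral_enorm_sub_sq_eq hω hωN] at hle
  have hl : 0 ≤ (eLpNorm (fun x => ω x - ωN x) 2 volume).toReal ^ 2 := sq_nonneg _
  rw [Real.rpow_neg_one, ← div_eq_mul_inv]
  set f : Plane → ℝ := fun x => ρ x + ω x - ωN x
  set e := offDiagEnergy (density f - empirical Q) + Real.log N / (2 * N) + (1 + normLinf f) / N
  set l := (eLpNorm (fun x => ω x - ωN x) 2 volume).toReal ^ 2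
  set κ := kinetic v Q P
  set G := normLinf Dv
  set g := gradNorm Dv D2v
  set H := modulatedEnergy ω ρ v ωN Q P
  set X := H + (1 + normLinf ρ) / N
  have hX1 : (1 : ℝ) / N ≤ (1 + normLinf ρ) / N := by gcongr; linarith
  have hX0 : 0 ≤ X := add_nonneg (by linarith) (by positivity)
  -- Nonnegativity of the modulated energy allows its coefficient to be raised from 1 to 2 + 2M.
  have htot : κ + l + e + 1 / N ≤ (2 + 2 * M) * X := by
    have h2 : 0 ≤ (1 + 2 * M) * H := mul_nonneg (by linarith) (by linarith)
    simp only [X]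
    linarith
  have hGG : 1 ≤ (1 + G) ^ 2 := by nlinarith
  have hbound : ∫⁻ ζ, ENNReal.ofReal ((1 + ‖ζ‖ ^ 2) ^ (-5 : ℝ)) * ‖fourierMeasure
        (empirical (fun i => (WithLp.toLp 2 (Q i, P i) : Phase)) - monokinetic ρ v) ζ‖ₑ ^ 2
      ≤ ENNReal.ofReal (K * (1 + G) ^ 2 * ((2 + 2 * M) * X)) := by
    calc _ ≤ 4 * (besselMass * (besselMass * ENNReal.ofReal (κ + (1 + G) ^ 2 * (4 / N))
        + ENNReal.ofReal (8 * (1 + G) ^ 2) * ENNReal.ofReal (4 * Real.pi ^ 2 * e)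
        + plancherelConst Plane * ENNReal.ofReal l)) := hle.trans (by gcongr)
      _ = ENNReal.ofReal (4 * (I' * (I' * (κ + (1 + G) ^ 2 * (4 / N))
        + 8 * (1 + G) ^ 2 * (4 * Real.pi ^ 2 * e) + p' * l))) := by
          rw [← hI, ← hp, ← ENNReal.ofReal_mul hI0, ← ENNReal.ofReal_mul (by positivity),
            ← ENNReal.ofReal_mul hp0, ← ENNReal.ofReal_add (by positivity) (by positivity),
            ← ENNReal.ofReal_add (by positivity) (by positivity), ← ENNReal.ofReal_mul hI0,
            ← ENNReal.ofReal_ofNat 4, ← ENNReal.ofReal_mul (by positivity)]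
      _ ≤ _ := by
          refine ENNReal.ofReal_le_ofReal ?_
          have e4 : (4 : ℝ) / N = 4 * (1 / N) := by ring
          rw [e4]
          exact (defect_bound_le hI0 hp0 hk hl he0 (by positivity) hGG).trans (by gcongr)
  have hfin : K * (1 + G) ^ 2 * ((2 + 2 * M) * X)
      ≤ (4 * (1 + K) * (1 + |M|) * (1 + g ^ 2) * Real.sqrt X) ^ 2 := by
    rw [mul_pow, Real.sq_sqrt hX0, abs_of_nonneg hM0, ← mul_assoc]
    gcongr
    have b1 : (1 + G) ^ 2 ≤ (2 * (1 + g ^ 2)) ^ 2 := by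
      gcongr
      nlinarith [sq_nonneg (g - 1)]
    have b2 : K * (2 + 2 * M) ≤ (2 * ((1 + K) * (1 + M))) ^ 2 := by
      have : 1 ≤ (1 + K) * (1 + M) := by nlinarith [mul_nonneg hK0 hM0]
      have : K * (1 + M) ≤ (1 + K) * (1 + M) := by gcongr; linarith
      nlinarith
    calc K * (1 + G) ^ 2 * (2 + 2 * M) = (K * (2 + 2 * M)) * (1 + G) ^ 2 := by ring
      _ ≤ (2 * ((1 + K) * (1 + M))) ^ 2 * (2 * (1 + g ^ 2)) ^ 2 := by gcongr
      _ = _ := by ring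
  have hR : 0 ≤ 4 * (1 + K) * (1 + |M|) * (1 + g ^ 2) * Real.sqrt X := by positivity
  rw [sobolevNorm]
  calc _ ≤ (ENNReal.ofReal ((4 * (1 + K) * (1 + |M|) * (1 + g ^ 2) * Real.sqrt X) ^ 2)) ^ (1 / 2 : ℝ) :=
        ENNReal.rpow_le_rpow (hbound.trans (ENNReal.ofReal_le_ofReal hfin)) (by norm_num)
    _ = _ := by
        rw [ENNReal.ofReal_rpow_of_nonneg (sq_nonneg _) (by norm_num), ← Real.sqrt_eq_rpow,
          Real.sqrt_sq hR]

/-! ### Convergence of the spatial densities -/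

/-- The position defect is the unsmearing error (1 - θ) μ̂_N, minus the smeared difference, plus ω -
ω_N. For a < -1 the weight is at most |ζ|⁻², so the smeared term is bounded by the homogeneous H⁻¹
norm. -/
lemma lintegral_fourierMeasure_density_le {a : ℝ} (ha : a < -1) {ω ρ ωN : Plane → ℝ}
    (hω : IsDensity ω) (hρ : IsDensity ρ) (hωN : IsDensity ωN) {N : ℕ} (hN : 1 ≤ N)
    (Q : Fin N → Plane) :
    ∫⁻ ζ, ENNReal.ofReal ((1 + ‖ζ‖ ^ 2) ^ a) * ‖fourierMeasure (empirical Q - density ρ) ζ‖ₑ ^ 2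
      ≤ 4 * ((∫⁻ ζ, ‖rft (smeared (fun x => ρ x + ω x - ωN x) Q) ζ‖ₑ ^ 2 / ‖ζ‖ₑ ^ 2)
        + (∫⁻ ζ : Plane, ENNReal.ofReal ((1 + ‖ζ‖ ^ 2) ^ a * (1 - smear N ζ) ^ 2))
        + plancherelConst Plane * ∫⁻ x, ‖ω x - ωN x‖ₑ ^ 2) := by
  set f : Plane → ℝ := fun x => ρ x + ω x - ωN x with hf
  have hfd : IsDensity f := hρ.add_sub hω hωN
  have hg := hω.sub hωN
  have hfi : Integrable fun x => (f x : ℂ) := hfd.integrable.ofReal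
  have hgi : Integrable fun x => ((ω x - ωN x : ℝ) : ℂ) := hg.integrable.ofReal
  -- The zero summand puts the sum in the shape of the four-term inequality.
  have hdec : ∀ ζ, fourierMeasure (empirical Q - density ρ) ζ
      = ((1 - smear N ζ : ℝ) : ℂ) * empFt Q ζ + 0 - rft (smeared f Q) ζ
        + rft (fun x => ω x - ωN x) ζ := by
    intro ζ
    have h1 : rft ρ ζ = rft f ζ - rft (fun x => ω x - ωN x) ζ := by
      refine Eq.trans ?_ (ft_sub hfi hgi ζ)
      rw [rft]
      congr 1; ext x; simp only [hf]; push_cast; ring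
    have h2 : fourierMeasure (empirical Q - density ρ) ζ = empFt Q ζ - rft ρ ζ := by
      rw [fourierMeasure_empirical_sub_density Q hρ.integrable, empFt, rft, Complex.real_smul]
      push_cast
      ring
    rw [h2, rft_smeared hfd.integrable hN, h1]
    push_cast
    ring
  have hpt : ∀ ζ, ENNReal.ofReal ((1 + ‖ζ‖ ^ 2) ^ a) *
        ‖fourierMeasure (empirical Q - density ρ) ζ‖ₑ ^ 2
      ≤ 4 * (‖rft (smeared f Q) ζ‖ₑ ^ 2 / ‖ζ‖ₑ ^ 2
        + ENNReal.ofReal ((1 + ‖ζ‖ ^ 2) ^ a * (1 - smear N ζ) ^ 2)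
        + ‖rft (fun x => ω x - ωN x) ζ‖ₑ ^ 2) := by
    intro ζ
    have sqe : ∀ z : ℂ, ‖z‖ₑ ^ 2 = ENNReal.ofReal (‖z‖ ^ 2) := fun z => by
      rw [ENNReal.ofReal_pow (norm_nonneg _), ofReal_norm]
    have hs := smear_nonneg N ζ
    have hs1 := smear_le_one N ζ
    have hw0 : 0 ≤ (1 + ‖ζ‖ ^ 2) ^ a := by positivity
    have h1ζ : 1 ≤ 1 + ‖ζ‖ ^ 2 := by nlinarith [sq_nonneg ‖ζ‖]
    have hw1 : (1 + ‖ζ‖ ^ 2) ^ a ≤ 1 := Real.rpow_le_one_of_one_le_of_nonpos h1ζ (by linarith)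
    have hw2 : (1 + ‖ζ‖ ^ 2) ^ a ≤ (1 + ‖ζ‖ ^ 2)⁻¹ := by
      rw [← Real.rpow_neg_one]
      exact Real.rpow_le_rpow_of_exponent_le h1ζ ha.le
    have hw3 : ENNReal.ofReal ((1 + ‖ζ‖ ^ 2) ^ a) ≤ (‖ζ‖ₑ ^ 2)⁻¹ := by
      refine (ENNReal.ofReal_le_ofReal hw2).trans ?_
      rw [ENNReal.ofReal_inv_of_pos (by positivity), ENNReal.inv_le_inv, ← ofReal_norm,
        ← ENNReal.ofReal_pow (norm_nonneg _)]
      exact ENNReal.ofReal_le_ofReal (by linarith)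
    set s := smear N ζ
    set W := (1 + ‖ζ‖ ^ 2) ^ a
    set c := rft (smeared f Q) ζ
    set d := rft (fun x => ω x - ωN x) ζ
    have ha2 : ‖((1 - s : ℝ) : ℂ) * empFt Q ζ‖ ^ 2 ≤ (1 - s) ^ 2 := by
      rw [norm_mul, mul_pow, Complex.norm_real, Real.norm_eq_abs, sq_abs]
      refine mul_le_of_le_one_right (sq_nonneg _) ?_
      exact pow_le_one₀ (norm_nonneg _) (norm_empFt_le Q ζ)
    have hD := norm_add_sub_add_sq_le (((1 - s : ℝ) : ℂ) * empFt Q ζ) 0 c d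
    rw [← hdec, norm_zero] at hD
    calc _ ≤ ENNReal.ofReal (4 * (W * ‖c‖ ^ 2 + W * (1 - s) ^ 2 + W * ‖d‖ ^ 2)) := by
          rw [sqe, ← ENNReal.ofReal_mul hw0]
          refine ENNReal.ofReal_le_ofReal ?_
          calc _ ≤ W * (4 * ((1 - s) ^ 2 + ‖c‖ ^ 2 + ‖d‖ ^ 2)) := by
                gcongr; linarith
            _ = _ := by ring
      _ = 4 * (ENNReal.ofReal W * ‖c‖ₑ ^ 2 + ENNReal.ofReal (W * (1 - s) ^ 2)
            + ENNReal.ofReal W * ‖d‖ₑ ^ 2) := by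
          rw [sqe, sqe, ← ENNReal.ofReal_mul hw0, ← ENNReal.ofReal_mul hw0,
            ← ENNReal.ofReal_add (by positivity) (by positivity),
            ← ENNReal.ofReal_add (by positivity) (by positivity), ← ENNReal.ofReal_ofNat 4,
            ← ENNReal.ofReal_mul (by positivity)]
      _ ≤ _ := by
          refine mul_le_mul' le_rfl (add_le_add (add_le_add ?_ le_rfl) ?_)
          · rw [mul_comm, div_eq_mul_inv]
            exact mul_le_mul' le_rfl hw3
          · refine mul_le_of_le_one_left' ?_
            rw [← ENNReal.ofReal_one]
            exact ENNReal.ofReal_le_ofReal hw1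
  refine (lintegral_mono hpt).trans (le_of_eq ?_)
  have hd : Continuous (rft fun x => ω x - ωN x) := continuous_ft hg.integrable.ofReal
  have hc : Continuous (rft (smeared f Q)) :=
    continuous_ft (integrable_smeared hfd.integrable hN Q).ofReal
  have hg2 : MemLp (fun x => ((ω x - ωN x : ℝ) : ℂ)) 2 volume := hg.memLp_two.ofReal
  have hpl : ∫⁻ ζ, ‖rft (fun x => ω x - ωN x) ζ‖ₑ ^ 2
      = plancherelConst Plane * ∫⁻ x, ‖ω x - ωN x‖ₑ ^ 2 := by
    rw [rft, lintegral_enorm_ft_sq hgi hg2]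
    congr 1
    refine lintegral_congr fun x => ?_
    rw [← ofReal_norm, Complex.norm_real, ofReal_norm]
  rw [lintegral_const_mul' _ _ (by norm_num), lintegral_add_right _ (by fun_prop),
    lintegral_add_left, hpl]
  exact (hc.measurable.enorm.pow_const 2).div (by fun_prop)

lemma tendsto_smear (ζ : Plane) : Tendsto (fun N : ℕ => smear N ζ) atTop (𝓝 1) := by
  have h : Tendsto (fun N : ℕ => ‖ζ‖ ^ 2 * (4 * (N : ℝ))⁻¹) atTop (𝓝 (‖ζ‖ ^ 2 * 0)) :=
    (tendsto_inv_atTop_zero.comp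
      (tendsto_natCast_atTop_atTop.const_mul_atTop (by norm_num : (0 : ℝ) < 4))).const_mul _
  have h2 := (Real.continuous_exp.tendsto _).comp h.neg
  rw [mul_zero, neg_zero, Real.exp_zero] at h2
  exact h2

/-- Dominated convergence: the weight is integrable on the plane exactly because a < -1, and θ → 1
at each frequency. -/
lemma tendsto_lintegral_smear {a : ℝ} (ha : a < -1) :
    Tendsto (fun N : ℕ => ∫⁻ ζ : Plane, ENNReal.ofReal ((1 + ‖ζ‖ ^ 2) ^ a * (1 - smear N ζ) ^ 2))
      atTop (𝓝 0) := by
  have hi : Integrable fun ζ : Plane => (1 + ‖ζ‖ ^ 2) ^ a := by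
    have := integrable_rpow_neg_one_add_norm_sq (E := Plane) (μ := volume) (r := -(2 * a))
      (by simp; linarith)
    refine this.congr (Eventually.of_forall fun ζ => ?_)
    simp only [neg_neg]
    congr 1
    ring
  have hcw : Continuous fun ζ : Plane => (1 + ‖ζ‖ ^ 2) ^ a :=
    (by fun_prop : Continuous fun ζ : Plane => 1 + ‖ζ‖ ^ 2).rpow_const
      fun ζ => Or.inl (by positivity)
  have h := tendsto_lintegral_of_dominated_convergence (μ := (volume : Measure Plane))
    (F := fun (N : ℕ) ζ => ENNReal.ofReal ((1 + ‖ζ‖ ^ 2) ^ a * (1 - smear N ζ) ^ 2)) (f := fun _ => 0)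
    (fun ζ => ENNReal.ofReal ((1 + ‖ζ‖ ^ 2) ^ a)) (fun N => by
      have : Continuous fun ζ : Plane => (1 + ‖ζ‖ ^ 2) ^ a * (1 - smear N ζ) ^ 2 := by fun_prop
      exact this.measurable.ennreal_ofReal)
    (fun N => Eventually.of_forall fun ζ => by
      refine ENNReal.ofReal_le_ofReal (mul_le_of_le_one_right (by positivity) ?_)
      have h0 := smear_nonneg N ζ
      have h1 := smear_le_one N ζ
      exact pow_le_one₀ (by linarith) (by linarith))
    hi.lintegral_lt_top.ne
    (Eventually.of_forall fun ζ => by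
      have h1 : Tendsto (fun N : ℕ => (1 + ‖ζ‖ ^ 2) ^ a * (1 - smear N ζ) ^ 2) atTop
          (𝓝 ((1 + ‖ζ‖ ^ 2) ^ a * (1 - 1) ^ 2)) :=
        ((((tendsto_smear ζ).const_sub 1).pow 2).const_mul _)
      have h2 := (ENNReal.continuous_ofReal.tendsto _).comp h1
      rw [sub_self, zero_pow two_ne_zero, mul_zero, ENNReal.ofReal_zero] at h2
      exact h2)
  simpa using h

lemma tendsto_sobolevNorm_of_lintegral {E : Type*} [NormedAddCommGroup E] [InnerProductSpace ℝ E]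
    [FiniteDimensional ℝ E] [MeasurableSpace E] [BorelSpace E] {s : ℝ} {σ : ℕ → SignedMeasure E}
    (h : Tendsto (fun N => ∫⁻ ζ : E, ENNReal.ofReal ((1 + ‖ζ‖ ^ 2) ^ s) *
      ‖fourierMeasure (σ N) ζ‖ₑ ^ 2) atTop (𝓝 0)) :
    Tendsto (fun N => sobolevNorm s (σ N)) atTop (𝓝 0) := by
  have := ((ENNReal.continuous_rpow_const (y := 1 / 2)).tendsto 0).comp h
  rw [ENNReal.zero_rpow_of_pos (by norm_num)] at this
  exact this

lemma tendsto_sobolevNorm_empirical {a : ℝ} (ha : a < -1) {ω ρ : Plane → ℝ} {v : Plane → Plane}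
    {ωN : ℕ → Plane → ℝ} {Q P : (N : ℕ) → Fin N → Plane} (hω : IsDensity ω) (hρ : IsDensity ρ)
    (hN : ∀ N : ℕ, 1 ≤ N → IsDensity (ωN N) ∧ ∫ x, (ρ x + ω x - ωN N x) = 1 ∧
      Function.Injective (Q N)) {M : ℝ} (hM : normLinf ω ≤ M)
    (hM' : ∀ N : ℕ, 1 ≤ N → normLinf (ωN N) ≤ M)
    (hH : Tendsto (fun N : ℕ => modulatedEnergy ω ρ v (ωN N) (Q N) (P N)) atTop (𝓝 0)) :
    Tendsto (fun N : ℕ => sobolevNorm a (empirical (Q N) - density ρ)) atTop (𝓝 0) := by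
  -- This single null sequence dominates both the coercive energy and the squared L² distance of ω_N
  -- from ω.
  set Y : ℕ → ℝ := fun N => modulatedEnergy ω ρ v (ωN N) (Q N) (P N)
    + (1 + 2 * M) * ((1 + normLinf ρ) / N) with hY
  have hYlim : Tendsto Y atTop (𝓝 0) := by
    have h2 : Tendsto (fun N : ℕ => (1 + 2 * M) * ((1 + normLinf ρ) / (N : ℝ))) atTop
        (𝓝 ((1 + 2 * M) * 0)) :=
      (tendsto_const_nhds.div_atTop tendsto_natCast_atTop_atTop).const_mul _
    simpa using hH.add h2
  have hbd : Tendsto (fun N : ℕ => 4 * (ENNReal.ofReal (4 * Real.pi ^ 2 * Y N)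
      + (∫⁻ ζ : Plane, ENNReal.ofReal ((1 + ‖ζ‖ ^ 2) ^ a * (1 - smear N ζ) ^ 2))
      + plancherelConst Plane * ENNReal.ofReal (Y N))) atTop (𝓝 0) := by
    have h1 := (ENNReal.continuous_ofReal.tendsto _).comp (hYlim.const_mul (4 * Real.pi ^ 2))
    have h2 := ENNReal.Tendsto.const_mul (a := plancherelConst Plane)
      ((ENNReal.continuous_ofReal.tendsto _).comp hYlim) (Or.inr plancherelConst_ne_top)
    have h3 := ENNReal.Tendsto.const_mul (a := 4) ((h1.add (tendsto_lintegral_smear ha)).add h2)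
      (Or.inr (by norm_num))
    rw [mul_zero, ENNReal.ofReal_zero, mul_zero, add_zero, add_zero, mul_zero] at h3
    exact h3
  refine tendsto_sobolevNorm_of_lintegral (tendsto_of_tendsto_of_tendsto_of_le_of_le'
    tendsto_const_nhds hbd (Eventually.of_forall fun _ => bot_le) ?_)
  filter_upwards [eventually_ge_atTop 1] with N h1N
  obtain ⟨hωN, hint, hQ⟩ := hN N h1N
  refine (lintegral_fourierMeasure_density_le ha hω hρ hωN h1N (Q N)).trans ?_
  obtain ⟨he0, heE⟩ := lintegral_rft_smeared_le (hρ.add_sub hω hωN) hint h1N hQ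
  have hS := kinetic_add_energy_le v (Q N) (P N) hω hρ hωN hM (hM' N h1N)
  have hk := kinetic_nonneg v (Q N) (P N)
  have hl : 0 ≤ (eLpNorm (fun x => ω x - ωN N x) 2 volume).toReal ^ 2 := sq_nonneg _
  rw [lintegral_enorm_sub_sq_eq hω hωN]
  refine mul_le_mul' le_rfl (add_le_add (add_le_add (heE.trans ?_) le_rfl)
    (mul_le_mul' le_rfl (ENNReal.ofReal_le_ofReal ?_)))
  · refine ENNReal.ofReal_le_ofReal (mul_le_mul_of_nonneg_left ?_ (by positivity))
    simp only [hY]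
    linarith
  · simp only [hY]
    linarith

lemma tendsto_eLpNorm_sub {ω ρ : Plane → ℝ} {v : Plane → Plane}
    {ωN : ℕ → Plane → ℝ} {Q P : (N : ℕ) → Fin N → Plane} (hω : IsDensity ω) (hρ : IsDensity ρ)
    (hN : ∀ N : ℕ, 1 ≤ N → IsDensity (ωN N) ∧ ∫ x, (ρ x + ω x - ωN N x) = 1 ∧
      Function.Injective (Q N))
    (hH : Tendsto (fun N : ℕ => modulatedEnergy ω ρ v (ωN N) (Q N) (P N)) atTop (𝓝 0)) :
    Tendsto (fun N : ℕ => eLpNorm (fun x => ωN N x - ω x) 2 volume) atTop (𝓝 0) := by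
  have hlim : Tendsto (fun N : ℕ => ENNReal.ofReal
      (Real.sqrt (modulatedEnergy ω ρ v (ωN N) (Q N) (P N)))) atTop (𝓝 0) := by
    have h := (ENNReal.continuous_ofReal.tendsto _).comp ((Real.continuous_sqrt.tendsto _).comp hH)
    rw [Real.sqrt_zero, ENNReal.ofReal_zero] at h
    exact h
  refine tendsto_of_tendsto_of_tendsto_of_le_of_le' tendsto_const_nhds hlim
    (Eventually.of_forall fun _ => bot_le) ?_
  filter_upwards [eventually_ge_atTop 1] with N h1N
  obtain ⟨hωN, hint, hQ⟩ := hN N h1N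
  have h := kinetic_add_sq_le_modulatedEnergy v h1N (P N) hω hρ hωN hint hQ
  have hk := kinetic_nonneg v (Q N) (P N)
  have hc : eLpNorm (fun x => ωN N x - ω x) 2 volume = eLpNorm (fun x => ω x - ωN N x) 2 volume :=
    eLpNorm_sub_comm (ωN N) ω 2 volume
  rw [hc, ← ENNReal.ofReal_toReal (hω.sub hωN).memLp_two.2.ne]
  exact ENNReal.ofReal_le_ofReal (Real.le_sqrt_of_sq_le (by linarith))

end Spray

end

/-! ### The quantitative bound and its consequences for convergence -/

theorem proposition1p6 :
    (∃ β : ℝ, 0 < β ∧ ∀ M : ℝ, ∃ C : ℝ, 0 < C ∧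
      ∀ (N : ℕ) (ω ρ ωN : Spray.Plane → ℝ) (v : Spray.Plane → Spray.Plane)
        (Dv : Spray.Plane → Spray.Plane →L[ℝ] Spray.Plane)
        (D2v : Spray.Plane → Spray.Plane →L[ℝ] Spray.Plane →L[ℝ] Spray.Plane)
        (Q P : Fin N → Spray.Plane),
        1 ≤ N → Spray.IsDensity ω → Spray.IsDensity ρ → Spray.IsDensity ωN →
        ∫ x, (ρ x + ω x - ωN x) = 1 →
        Spray.normLinf ω ≤ M → Spray.normLinf ωN ≤ M →
        Spray.IsW2Inf v Dv D2v → Function.Injective Q →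
        Spray.sobolevNorm (-5)
            (Spray.empirical (fun i => (WithLp.toLp 2 (Q i, P i) : Spray.Phase))
              - Spray.monokinetic ρ v)
          ≤ ENNReal.ofReal (C * (1 + Spray.gradNorm Dv D2v ^ 2) *
              Real.sqrt (Spray.modulatedEnergy ω ρ v ωN Q P
                + (1 + Spray.normLinf ρ) * (N : ℝ) ^ (-β)))) ∧
    (∀ (ω ρ : Spray.Plane → ℝ) (v : Spray.Plane → Spray.Plane)
        (Dv : Spray.Plane → Spray.Plane →L[ℝ] Spray.Plane)
        (D2v : Spray.Plane → Spray.Plane →L[ℝ] Spray.Plane →L[ℝ] Spray.Plane)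
        (ωN : ℕ → Spray.Plane → ℝ) (Q P : (N : ℕ) → Fin N → Spray.Plane),
        Spray.IsDensity ω → Spray.IsDensity ρ → Spray.IsW2Inf v Dv D2v →
        (∀ N : ℕ, 1 ≤ N → Spray.IsDensity (ωN N) ∧ ∫ x, (ρ x + ω x - ωN N x) = 1 ∧
          Function.Injective (Q N)) →
        (∃ K : ℝ, ∀ N : ℕ, 1 ≤ N → Spray.normLinf (ωN N) ≤ K) →
        Tendsto (fun N : ℕ => Spray.modulatedEnergy ω ρ v (ωN N) (Q N) (P N)) atTop (𝓝 0) →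
        Tendsto (fun N : ℕ => eLpNorm (fun x => ωN N x - ω x) 2 volume) atTop (𝓝 0) ∧
        (∀ a : ℝ, a < -1 →
          Tendsto (fun N : ℕ => Spray.sobolevNorm a (Spray.empirical (Q N) - Spray.density ρ))
            atTop (𝓝 0)) ∧
        Tendsto (fun N : ℕ => Spray.sobolevNorm (-5)
          (Spray.empirical (fun i => (WithLp.toLp 2 (Q N i, P N i) : Spray.Phase))
            - Spray.monokinetic ρ v)) atTop (𝓝 0)) := by
  obtain ⟨K, hK, hmain⟩ := Spray.exists_sobolevNorm_monokinetic_defect_le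
  -- All squared errors are O(1/N), so β = 1; the constant depends on M only through the factor 1 +
  -- |M|.
  refine ⟨⟨1, one_pos, fun M => ⟨K * (1 + |M|), by positivity, hmain M⟩⟩, ?_⟩
  intro ω ρ v Dv D2v ωN Q P hω hρ hv hN ⟨K', hK'⟩ hH
  -- The quantitative bound asks for one M that bounds both ω and every ω_N.
  set M := max (Spray.normLinf ω) K' with hM
  have hM1 : Spray.normLinf ω ≤ M := le_max_left _ _
  have hM2 : ∀ N : ℕ, 1 ≤ N → Spray.normLinf (ωN N) ≤ M :=
    fun N h1 => (hK' N h1).trans (le_max_right _ _)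
  refine ⟨Spray.tendsto_eLpNorm_sub hω hρ hN hH,
    fun a ha => Spray.tendsto_sobolevNorm_empirical ha hω hρ hN hM1 hM2 hH, ?_⟩
  have hlim : Tendsto (fun N : ℕ => ENNReal.ofReal (K * (1 + |M|) * (1 + Spray.gradNorm Dv D2v ^ 2) *
      Real.sqrt (Spray.modulatedEnergy ω ρ v (ωN N) (Q N) (P N)
        + (1 + Spray.normLinf ρ) * (N : ℝ) ^ (-1 : ℝ)))) atTop (𝓝 0) := by
    have h1 : Tendsto (fun N : ℕ => (N : ℝ) ^ (-1 : ℝ)) atTop (𝓝 0) :=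
      (tendsto_rpow_neg_atTop one_pos).comp tendsto_natCast_atTop_atTop
    have h2 := (Real.continuous_sqrt.tendsto _).comp
      (hH.add (h1.const_mul (1 + Spray.normLinf ρ)))
    have h3 := (ENNReal.continuous_ofReal.tendsto _).comp
      (h2.const_mul (K * (1 + |M|) * (1 + Spray.gradNorm Dv D2v ^ 2)))
    rw [mul_zero, add_zero, Real.sqrt_zero, mul_zero, ENNReal.ofReal_zero] at h3
    exact h3
  refine tendsto_of_tendsto_of_tendsto_of_le_of_le' tendsto_const_nhds hlim
    (Eventually.of_forall fun _ => bot_le) ?_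
  filter_upwards [eventually_ge_atTop 1] with N h1N
  obtain ⟨hωN, hint, hQ⟩ := hN N h1N
  exact hmain M N ω ρ (ωN N) v Dv D2v (Q N) (P N) h1N hω hρ hωN hint hM1 (hM2 N h1N) hv hQ
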